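/- Work in coordinates $x^0,\dots,x^3$ on an open set $U\subseteq\mathbb R^4$; all fields are smooth on $U$. Let $g_{\mu\nu}$ be a Lorentzian metric, with Levi-Civita connection $\overset{\circ}{\nabla}$ and Einstein tensor $\overset{\circ}{G}_{\mu\nu}$, let $\phi$ be a function, $\pi_\mu$ a one-form and $\lambda^\mu$ a vector field on $U$, and let $c_1,c_2,c_3,\xi,\kappa\in\mathbb R$ with $\kappa\neq0$. Let $\nabla$ be the torsion-free affine connection with nonmetricity $$-\nabla_\mu g_{\nu\rho}=Q_{\mu\nu\rho}=c_1\pi_\mu g_{\nu\rho}+c_2(\pi_\rho g_{\mu\nu}+\pi_\nu g_{\rho\mu})+2c_3\pi_\mu\pi_\nu\pi_\rho ,$$ i.e. the connection whose coefficients are the Christoffel symbols of $g$ plus the distortion $N^\mu{}_{\rho\nu}=\frac12 g^{\lambda\mu}(-Q_{\lambda\nu\rho}+Q_{\rho\lambda\nu}+Q_{\nu\rho\lambda})$, and let $R$ be its Ricci scalar. Consider the action $$S=\frac1{2\kappa}\int\sqrt{-g}\,\big(R+\xi\nabla_\mu\pi^\mu\big)\,d^4x+\int\sqrt{-g}\,\lambda^\mu(\pi_\mu-\partial_\mu\phi)\,d^4x+S_{\mathrm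 m}[g,\psi],\qquad S_{\mathrm m}=\int L(x,g,\partial g,\psi,\partial\psi)\,d^4x ,$$ where $L$ is an arbitrary smooth matter Lagrangian density, independent of $\pi,\phi,\lambda$, and $\psi$ are matter fields with values in a real normed space. The stress tensor is $T^{\mu\nu}=\frac{2}{\sqrt{-g}}\frac{\delta S_{\mathrm m}}{\delta g_{\mu\nu}}$ with $\frac{\delta S_{\mathrm m}}{\delta g_{\mu\nu}}=\frac{\partial L}{\partial g_{\mu\nu}}-\partial_\alpha\frac{\partial L}{\partial(\partial_\alpha g_{\mu\nu})}$ (symmetrised in $\mu\nu$). Call $(g,\pi,\phi,\lambda)$ stationary if, for fixed $\psi$ and for every compact $K\subseteq U$, the first variation of the action over $K$ vanishes for all smooth variations of $g_{\mu\nu},\pi_\mu,\phi,\lambda^\mu$ supported in $K$. Put $$b_1=-\tfrac32c_1^2+c_2(3c_2+\xi)+c_1(3c_2+2\xi),\qquad b_2=2c_3(3c_2+\xi),$$ and consider on $U$ the equations $$\text{(M)}\quad \overset{\circ}{G}_{\mu\nu}+\partial_\mu\phi\,\partial_\nu\phi\,\big(b_1+b_2(\partial\phi)^2\big)-\tfrac12g_{\mu\nu}(\partial\phi)^2\big(b_1+\tfrac{b_2}{2}(\partial\phi)^2\big)=\kappa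 T_{\mu\nu},$$ $$\text{(S)}\quad b_1\overset{\circ}{\nabla}_\mu\overset{\circ}{\nabla}{}^\mu\phi+b_2\Big((\partial\phi)^2\,\overset{\circ}{\nabla}_\nu\overset{\circ}{\nabla}{}^\nu\phi+2\,\overset{\circ}{\nabla}_\mu\phi\,\overset{\circ}{\nabla}{}^\nu\phi\,\overset{\circ}{\nabla}_\nu\overset{\circ}{\nabla}{}^\mu\phi\Big)=0,$$ where $(\partial\phi)^2=\overset{\circ}{\nabla}_\mu\phi\overset{\circ}{\nabla}{}^\mu\phi$. Then: 1. For every compact $K\subseteq U$ and every smooth symmetric variation $\delta g$ supported in $K$, $\frac{d}{d\varepsilon}\big|_{\varepsilon=0}S_{\mathrm m}[g+\varepsilon\,\delta g,\psi]=\frac12\int_K\sqrt{-g}\,T^{\mu\nu}\delta g_{\mu\nu}\,d^4x$. 2. $(g,\pi,\phi,\lambda)$ is stationary if and only if, on $U$, $\pi_\mu=\partial_\mu\phi$, $\ \kappa\lambda^\mu+(b_1+b_2\pi_\rho\pi^\rho)\pi^\mu=0$, $\ \overset{\circ}{\nabla}_\mu\lambda^\mu=0$, and (M) and (S) hold. 3.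 For given $(g,\phi,\psi)$ there are smooth $\pi,\lambda$ on $U$ such that $(g,\pi,\phi,\lambda)$ is stationary if and only if (M) and (S) hold. 4. If (M) and (S) hold, then $\overset{\circ}{\nabla}_\mu T^{\mu\nu}=0$ on $U$. -/

import Mathlib

open MeasureTheory
open scoped ContDiff

noncomputable section

namespace VectorialNonmetricity

/-! Everything is written in local coordinates `x⁰, …, x³` on an open set of `ℝ⁴`. A field is a
function on all of `ℝ⁴` of which only the values on that open set matter. -/

/-- Coordinate space `ℝ⁴`. -/
abbrev Pt : Type := Fin 4 → ℝ

/-- Components `A_{μν}` or `A^{μν}` of a tensor with two indices at a point. -/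
abbrev Tensor2 : Type := Fin 4 → Fin 4 → ℝ

/-- The coordinate derivative `∂_μ f`. -/
def pd {F : Type*} [NormedAddCommGroup F] [NormedSpace ℝ F] (μ : Fin 4) (f : Pt → F) (x : Pt) : F :=
  fderiv ℝ f x (Pi.single μ 1)

/-! ### Metric -/

/-- `g` (with components `g_{μν}`) is a smooth Lorentzian metric on `U`. A symmetric real `4 × 4`
matrix has negative determinant exactly when its signature is `(-,+,+,+)` or `(+,-,-,-)`. -/
structure IsLorentzMetricOn (U : Set Pt) (g : Pt → Tensor2) : Prop where
  smooth : ContDiffOn ℝ ∞ g U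
  symm : ∀ x ∈ U, ∀ μ ν, g x μ ν = g x ν μ
  det_neg : ∀ x ∈ U, (Matrix.of (g x)).det < 0

/-- The inverse metric `g^{μν}`. -/
def ginv (g : Pt → Tensor2) (x : Pt) (μ ν : Fin 4) : ℝ := (Matrix.of (g x))⁻¹ μ ν

/-- The density `√(-g)`. -/
def sqrtNegDet (g : Pt → Tensor2) (x : Pt) : ℝ := Real.sqrt (-(Matrix.of (g x)).det)

/-- `w^μ = g^{μν} w_ν`. -/
def raise (g : Pt → Tensor2) (w : Pt → Fin 4 → ℝ) (x : Pt) (μ : Fin 4) : ℝ :=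
  ∑ ν, ginv g x μ ν * w x ν

/-- `w_μ w^μ`. -/
def normSq (g : Pt → Tensor2) (w : Pt → Fin 4 → ℝ) (x : Pt) : ℝ :=
  ∑ μ, w x μ * raise g w x μ

/-- `dφ`, with components `∂_μ φ`. -/
def grad (φ : Pt → ℝ) (x : Pt) (μ : Fin 4) : ℝ := pd μ φ x

/-! ### Affine connections, given by their coefficients `Γ^μ_{νρ}`; the last index is the direction
of differentiation: `∇_ρ V^μ = ∂_ρ V^μ + Γ^μ_{νρ} V^ν`. -/

/-- Coefficient functions `Γ x μ ν ρ = Γ^μ_{νρ}(x)`. -/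
abbrev Conn : Type := Pt → Fin 4 → Fin 4 → Fin 4 → ℝ

/-- `∇_ρ V^μ`. -/
def covVec (Γ : Conn) (V : Pt → Fin 4 → ℝ) (x : Pt) (ρ μ : Fin 4) : ℝ :=
  pd ρ (fun y => V y μ) x + ∑ ν, Γ x μ ν ρ * V x ν

/-- `∇_μ V^μ`. -/
def divVec (Γ : Conn) (V : Pt → Fin 4 → ℝ) (x : Pt) : ℝ := ∑ μ, covVec Γ V x μ μ

/-- `∇_μ T^{μν}`. -/
def divTensor (Γ : Conn) (T : Pt → Tensor2) (x : Pt) (ν : Fin 4) : ℝ :=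
  ∑ μ, (pd μ (fun y => T y μ ν) x + ∑ α, Γ x μ α μ * T x α ν + ∑ α, Γ x ν α μ * T x μ α)

/-- `R^μ_{νρσ} = Γ^λ_{νσ} Γ^μ_{λρ} - Γ^λ_{νρ} Γ^μ_{λσ} + ∂_ρ Γ^μ_{νσ} - ∂_σ Γ^μ_{νρ}`. -/
def riemann (Γ : Conn) (x : Pt) (μ ν ρ σ : Fin 4) : ℝ :=
  (∑ l, (Γ x l ν σ * Γ x μ l ρ - Γ x l ν ρ * Γ x μ l σ))
    + pd ρ (fun y => Γ y μ ν σ) x - pd σ (fun y => Γ y μ ν ρ) x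

/-- `R_{νσ} = R^μ_{νμσ}`. -/
def ricci (Γ : Conn) (x : Pt) (ν σ : Fin 4) : ℝ := ∑ μ, riemann Γ x μ ν μ σ

/-- `R = g^{νσ} R_{νσ}`. -/
def scalarCurv (g : Pt → Tensor2) (Γ : Conn) (x : Pt) : ℝ :=
  ∑ ν, ∑ σ, ginv g x ν σ * ricci Γ x ν σ

/-- The Levi-Civita connection (Christoffel symbols). -/
def leviCivita (g : Pt → Tensor2) : Conn := fun x μ ν ρ =>
  (1 / 2) * ∑ σ, ginv g x μ σ *
    (pd ν (fun y => g y σ ρ) x + pd ρ (fun y => g y σ ν) x - pd σ (fun y => g y ν ρ) x)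

/-- The Einstein tensor `G_{μν}` of the Levi-Civita connection. -/
def einstein (g : Pt → Tensor2) (x : Pt) (μ ν : Fin 4) : ℝ :=
  ricci (leviCivita g) x μ ν - (1 / 2) * g x μ ν * scalarCurv g (leviCivita g) x

/-! ### Vectorial nonmetricity -/

/-- `Q_{μνρ} = c₁ π_μ g_{νρ} + c₂ (π_ρ g_{μν} + π_ν g_{ρμ}) + 2 c₃ π_μ π_ν π_ρ`. -/
def nonmetricity (c₁ c₂ c₃ : ℝ) (g : Pt → Tensor2) (π : Pt → Fin 4 → ℝ)
    (x : Pt) (μ ν ρ : Fin 4) : ℝ :=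
  c₁ * π x μ * g x ν ρ + c₂ * (π x ρ * g x μ ν + π x ν * g x ρ μ)
    + 2 * c₃ * π x μ * π x ν * π x ρ

/-- Distortion `N^μ_{ρν} = ½ g^{λμ} (-Q_{λνρ} + Q_{ρλν} + Q_{νρλ})` of a torsion-free connection. -/
def distortion (c₁ c₂ c₃ : ℝ) (g : Pt → Tensor2) (π : Pt → Fin 4 → ℝ)
    (x : Pt) (μ ρ ν : Fin 4) : ℝ :=
  (1 / 2) * ∑ l, ginv g x l μ * (-nonmetricity c₁ c₂ c₃ g π x l ν ρ
    + nonmetricity c₁ c₂ c₃ g π x ρ l ν + nonmetricity c₁ c₂ c₃ g π x ν ρ l)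

/-- The torsion-free connection with `-∇_μ g_{νρ} = Q_{μνρ}`. -/
def vnConn (c₁ c₂ c₃ : ℝ) (g : Pt → Tensor2) (π : Pt → Fin 4 → ℝ) : Conn := fun x μ ν ρ =>
  leviCivita g x μ ν ρ + distortion c₁ c₂ c₃ g π x μ ρ ν

/-! ### Matter -/

/-- The point `(x, g, ∂g, ψ, ∂ψ)` at which a first-order matter Lagrangian is evaluated. -/
abbrev Jet (E : Type*) : Type _ := Pt × Tensor2 × (Fin 4 → Tensor2) × E × (Fin 4 → E)

/-- The jet of `(g, ψ)` at `x`; the metric derivatives are stored as `∂_α g_{μν}`. -/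
def jet {E : Type*} [NormedAddCommGroup E] [NormedSpace ℝ E]
    (g : Pt → Tensor2) (ψ : Pt → E) (x : Pt) : Jet E :=
  (x, g x, fun α μ ν => pd α (fun y => g y μ ν) x, ψ x, fun α => pd α ψ x)

/-- `L` is smooth at all jets over `U` whose metric entry is symmetric and Lorentzian. -/
def IsMatterLagrangianOn {E : Type*} [NormedAddCommGroup E] [NormedSpace ℝ E]
    (U : Set Pt) (L : Jet E → ℝ) : Prop :=
  ∀ x ∈ U, ∀ G : Tensor2, (∀ μ ν, G μ ν = G ν μ) → (Matrix.of G).det < 0 →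
    ∀ (dG : Fin 4 → Tensor2) (u : E) (du : Fin 4 → E), ContDiffAt ℝ ∞ L (x, G, dG, u, du)

/-- The symmetric matrix `½ (E_{μν} + E_{νμ})`. -/
def symUnit (μ ν : Fin 4) : Tensor2 := fun a b =>
  (1 / 2) * ((if a = μ ∧ b = ν then 1 else 0) + (if a = ν ∧ b = μ then 1 else 0))

/-- `∂L/∂g_{μν}` (symmetrised), along the fields. -/
def dLdg {E : Type*} [NormedAddCommGroup E] [NormedSpace ℝ E]
    (L : Jet E → ℝ) (g : Pt → Tensor2) (ψ : Pt → E) (x : Pt) (μ ν : Fin 4) : ℝ :=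
  fderiv ℝ L (jet g ψ x) (0, symUnit μ ν, 0, 0, 0)

/-- `∂L/∂(∂_α g_{μν})` (symmetrised in `μν`), along the fields. -/
def dLddg {E : Type*} [NormedAddCommGroup E] [NormedSpace ℝ E]
    (L : Jet E → ℝ) (g : Pt → Tensor2) (ψ : Pt → E) (x : Pt) (α μ ν : Fin 4) : ℝ :=
  fderiv ℝ L (jet g ψ x) (0, 0, Pi.single α (symUnit μ ν), 0, 0)

/-- The stress tensor `T^{μν} = (2/√(-g)) δS_m/δg_{μν}`, with the variational derivative
`δS_m/δg_{μν} = ∂L/∂g_{μν} - ∂_α (∂L/∂(∂_α g_{μν}))`. -/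
def stressUp {E : Type*} [NormedAddCommGroup E] [NormedSpace ℝ E]
    (L : Jet E → ℝ) (g : Pt → Tensor2) (ψ : Pt → E) (x : Pt) (μ ν : Fin 4) : ℝ :=
  (2 / sqrtNegDet g x) *
    (dLdg L g ψ x μ ν - ∑ α, pd α (fun y => dLddg L g ψ y α μ ν) x)

/-- `T_{μν} = g_{μα} g_{νβ} T^{αβ}`. -/
def stressDown {E : Type*} [NormedAddCommGroup E] [NormedSpace ℝ E]
    (L : Jet E → ℝ) (g : Pt → Tensor2) (ψ : Pt → E) (x : Pt) (μ ν : Fin 4) : ℝ :=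
  ∑ α, ∑ β, g x μ α * g x ν β * stressUp L g ψ x α β

/-- The matter action over the region `K`; `L` is a density (it contains the factor `√(-g)`). -/
def matterAction {E : Type*} [NormedAddCommGroup E] [NormedSpace ℝ E]
    (L : Jet E → ℝ) (K : Set Pt) (g : Pt → Tensor2) (ψ : Pt → E) : ℝ :=
  ∫ x in K, L (jet g ψ x)

/-! ### The action -/

/-- `(1/2κ) ∫_K √(-g) (R + ξ ∇_μ π^μ) d⁴x`, with `R` and `∇` of the connection `vnConn`. -/
def gravAction (c₁ c₂ c₃ ξ κ : ℝ) (K : Set Pt) (g : Pt → Tensor2) (π : Pt → Fin 4 → ℝ) : ℝ :=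
  (1 / (2 * κ)) * ∫ x in K, sqrtNegDet g x *
    (scalarCurv g (vnConn c₁ c₂ c₃ g π) x + ξ * divVec (vnConn c₁ c₂ c₃ g π) (raise g π) x)

/-- `∫_K √(-g) λ^μ (π_μ - ∂_μ φ) d⁴x`. -/
def multiplierAction (K : Set Pt) (g : Pt → Tensor2) (π : Pt → Fin 4 → ℝ) (φ : Pt → ℝ)
    (lam : Pt → Fin 4 → ℝ) : ℝ :=
  ∫ x in K, sqrtNegDet g x * ∑ μ, lam x μ * (π x μ - pd μ φ x)

/-- The total action over the region `K`. -/
def totalAction {E : Type*} [NormedAddCommGroup E] [NormedSpace ℝ E]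
    (c₁ c₂ c₃ ξ κ : ℝ) (L : Jet E → ℝ) (K : Set Pt) (g : Pt → Tensor2) (π : Pt → Fin 4 → ℝ)
    (φ : Pt → ℝ) (lam : Pt → Fin 4 → ℝ) (ψ : Pt → E) : ℝ :=
  gravAction c₁ c₂ c₃ ξ κ K g π + multiplierAction K g π φ lam + matterAction L K g ψ

/-- A smooth variation that vanishes outside the compact set `K`. -/
def IsVariation {F : Type*} [NormedAddCommGroup F] [NormedSpace ℝ F] (K : Set Pt) (h : Pt → F) :
    Prop :=
  ContDiff ℝ ∞ h ∧ tsupport h ⊆ K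

/-- The total action is stationary at `(g, π, φ, λ)`, for fixed matter fields `ψ`: its first
variation vanishes for all variations of `g_{μν}`, `π_μ`, `φ` and `λ^μ` that are supported in a
compact subset of `U`. -/
def IsStationaryOn {E : Type*} [NormedAddCommGroup E] [NormedSpace ℝ E]
    (U : Set Pt) (c₁ c₂ c₃ ξ κ : ℝ) (L : Jet E → ℝ) (g : Pt → Tensor2) (π : Pt → Fin 4 → ℝ)
    (φ : Pt → ℝ) (lam : Pt → Fin 4 → ℝ) (ψ : Pt → E) : Prop :=
  ∀ K : Set Pt, IsCompact K → K ⊆ U →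
    ∀ (δg : Pt → Tensor2) (δπ : Pt → Fin 4 → ℝ) (δφ : Pt → ℝ) (δlam : Pt → Fin 4 → ℝ),
      IsVariation K δg → (∀ x μ ν, δg x μ ν = δg x ν μ) →
      IsVariation K δπ → IsVariation K δφ → IsVariation K δlam →
      HasDerivAt (fun ε : ℝ => totalAction c₁ c₂ c₃ ξ κ L K
        (fun x => g x + ε • δg x) (fun x => π x + ε • δπ x) (fun x => φ x + ε * δφ x)
        (fun x => lam x + ε • δlam x) ψ) 0 0

/-! ### The field equations -/

/-- `b₁ = -3c₁²/2 + c₂(3c₂ + ξ) + c₁(3c₂ + 2ξ)`. -/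
def b₁ (c₁ c₂ ξ : ℝ) : ℝ := -(3 * c₁ ^ 2 / 2) + c₂ * (3 * c₂ + ξ) + c₁ * (3 * c₂ + 2 * ξ)

/-- `b₂ = 2c₃(3c₂ + ξ)`. -/
def b₂ (c₂ c₃ ξ : ℝ) : ℝ := 2 * c₃ * (3 * c₂ + ξ)

/-- `G_{μν} + ∂_μφ ∂_νφ (b₁ + b₂ (∂φ)²) - ½ g_{μν} (∂φ)² (b₁ + ½ b₂ (∂φ)²) = κ T_{μν}` on `U`. -/
def MetricEq (U : Set Pt) (B₁ B₂ κ : ℝ) (g : Pt → Tensor2) (φ : Pt → ℝ) (T : Pt → Tensor2) :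
    Prop :=
  ∀ x ∈ U, ∀ μ ν, einstein g x μ ν
      + grad φ x μ * grad φ x ν * (B₁ + B₂ * normSq g (grad φ) x)
      - (1 / 2) * g x μ ν * normSq g (grad φ) x * (B₁ + B₂ / 2 * normSq g (grad φ) x)
    = κ * T x μ ν

/-- `b₁ ∇_μ∇^μφ + b₂ (∇_μφ ∇^μφ ∇_ν∇^νφ + 2 ∇_μφ ∇^νφ ∇_ν∇^μφ) = 0` on `U`, with the
Levi-Civita connection. -/
def ScalarEq (U : Set Pt) (B₁ B₂ : ℝ) (g : Pt → Tensor2) (φ : Pt → ℝ) : Prop :=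
  ∀ x ∈ U, B₁ * divVec (leviCivita g) (raise g (grad φ)) x
    + B₂ * (normSq g (grad φ) x * divVec (leviCivita g) (raise g (grad φ)) x
      + 2 * ∑ μ, ∑ ν, grad φ x μ * raise g (grad φ) x ν *
          covVec (leviCivita g) (raise g (grad φ)) x ν μ) = 0

end VectorialNonmetricity

end

/-!
The connection is the Levi-Civita connection plus a tensor `C` built algebraically from `g` and
`π`. Expanding the Ricci tensor of a sum of connections exactly (`ricci_add`) leaves a part linear
in `C`, which contracts with `√(-g) g^{νσ}` to a divergence by the Palatini identity
(`sum_ricciLin_eq_div`), and a quadratic part, which is evaluated by contracting indices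
(`vectorial_contractions`, `sum_ricciQuad`). With `P = π_μ π^μ` this gives (`gravLagrangian_eq`)

  `√(-g) (R + ξ ∇_μ π^μ) = √(-g) (R° + b₁ P + ½ b₂ P²) + ∂_μ (…)^μ`,

so the action is general relativity with a one-form whose Lagrangian is a function of `P`, the
multiplier `λ` forcing `π = dφ`.

For the first variation, the Levi-Civita connection of `g + ε δg` is again written as that of `g`
plus a tensor that vanishes for `ε = 0` and off the support of `δg`. By the same exact expansion
the Lagrangian of the varied fields is a function of `x` and `ε` plus the divergence of a field
supported where the variation is (`gravLagrangian_eq_reduced`). The divergence integrates to zero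
for each `ε`, so it need not be differentiated in `ε`; in the remaining function (`gravReduced`)
every term that involves derivatives of `δg` contains two factors vanishing at `ε = 0`, and so
does not contribute to the derivative there (`hasDerivAt_gravReduced`). `hasDerivAt_action`
combines this with differentiation under the integral sign over a compact set; the matter and the
multiplier action are treated by the same lemma, with the usual integration by parts.

The fundamental lemma of the calculus of variations, applied to one component of one field at a
time, then turns stationarity into the vanishing of the coefficients of `δg`, `δπ`, `δφ` and `δλ`
(`isStationaryOn_iff`). The coefficient of `δπ` determines `λ`, and `∇_μ λ^μ = 0` becomes the
scalar equation, which is the conservation of the current `(b₁ + b₂ (∂φ)²) ∂^μ φ`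
(`divVec_current`). Conservation of the stress tensor follows from the contracted Bianchi identity
(`contracted_bianchi`), the conservation of the current and the closedness of `dφ`
(`divTensor_gravEL`).
-/

noncomputable section

namespace VectorialNonmetricity

open Filter Topology

section Calculus

variable {F : Type*} [NormedAddCommGroup F] [NormedSpace ℝ F]

/-! ### Coordinate derivatives -/

theorem pd_congr {f₁ f₂ : Pt → F} {x : Pt} (h : f₁ =ᶠ[𝓝 x] f₂) (μ : Fin 4) :
    pd μ f₁ x = pd μ f₂ x := by
  simp only [pd, h.fderiv_eq]

theorem pd_congr_on {f₁ f₂ : Pt → F} {U : Set Pt} (hU : IsOpen U) (h : ∀ y ∈ U, f₁ y = f₂ y)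
    {x : Pt} (hx : x ∈ U) (μ : Fin 4) : pd μ f₁ x = pd μ f₂ x :=
  pd_congr (eventually_of_mem (hU.mem_nhds hx) h) μ

theorem pd_add {f₁ f₂ : Pt → F} {x : Pt} (h₁ : DifferentiableAt ℝ f₁ x)
    (h₂ : DifferentiableAt ℝ f₂ x) (μ : Fin 4) :
    pd μ (fun y => f₁ y + f₂ y) x = pd μ f₁ x + pd μ f₂ x := by
  simp [pd, fderiv_fun_add h₁ h₂]

theorem pd_sub {f₁ f₂ : Pt → F} {x : Pt} (h₁ : DifferentiableAt ℝ f₁ x)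
    (h₂ : DifferentiableAt ℝ f₂ x) (μ : Fin 4) :
    pd μ (fun y => f₁ y - f₂ y) x = pd μ f₁ x - pd μ f₂ x := by
  simp [pd, fderiv_fun_sub h₁ h₂]

theorem pd_neg (f : Pt → F) (x : Pt) (μ : Fin 4) : pd μ (fun y => -f y) x = -pd μ f x := by
  simp [pd]

theorem pd_smul_const (c : ℝ) {f : Pt → F} {x : Pt} (hf : DifferentiableAt ℝ f x) (μ : Fin 4) :
    pd μ (fun y => c • f y) x = c • pd μ f x := by
  simp [pd, fderiv_fun_const_smul hf]

theorem pd_const_mul (c : ℝ) {f : Pt → ℝ} {x : Pt} (hf : DifferentiableAt ℝ f x) (μ : Fin 4) :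
    pd μ (fun y => c * f y) x = c * pd μ f x := pd_smul_const c hf μ

theorem pd_mul {f₁ f₂ : Pt → ℝ} {x : Pt} (h₁ : DifferentiableAt ℝ f₁ x)
    (h₂ : DifferentiableAt ℝ f₂ x) (μ : Fin 4) :
    pd μ (fun y => f₁ y * f₂ y) x = pd μ f₁ x * f₂ x + f₁ x * pd μ f₂ x := by
  simp [pd, fderiv_fun_mul h₁ h₂]; ring

theorem pd_sum {ι : Type*} (s : Finset ι) {f : ι → Pt → F} {x : Pt}
    (h : ∀ i ∈ s, DifferentiableAt ℝ (f i) x) (μ : Fin 4) :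
    pd μ (fun y => ∑ i ∈ s, f i y) x = ∑ i ∈ s, pd μ (f i) x := by
  simp [pd, fderiv_fun_sum h]

theorem two_le_infty : (2 : WithTop ℕ∞) ≤ ∞ := WithTop.coe_le_coe.2 le_top

/-- Schwarz's theorem for coordinate derivatives. -/
theorem pd_comm {f : Pt → ℝ} {x : Pt} (hf : ContDiffAt ℝ ∞ f x) (μ ν : Fin 4) :
    pd μ (pd ν f) x = pd ν (pd μ f) x := by
  have hs : IsSymmSndFDerivAt ℝ f x := hf.isSymmSndFDerivAt (by simpa using two_le_infty)
  have hd : DifferentiableAt ℝ (fderiv ℝ f) x :=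
    (hf.fderiv_right (m := 1) (by simpa [one_add_one_eq_two] using two_le_infty)).differentiableAt
      one_ne_zero
  have key : ∀ α β, pd α (pd β f) x = fderiv ℝ (fderiv ℝ f) x (Pi.single α 1) (Pi.single β 1) := by
    intro α β
    have : pd β f = fun y => (fderiv ℝ f y) (Pi.single β 1) := rfl
    rw [pd, this, fderiv_clm_apply hd (differentiableAt_const _)]
    simp
  rw [key, key, hs.eq]

/-- A one-parameter family of fields is jointly smooth at `(x, ε)`. -/
abbrev SmoothFam (f : ℝ → Pt → F) (p : Pt × ℝ) : Prop :=
  ContDiffAt ℝ ∞ (fun q : Pt × ℝ => f q.2 q.1) p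

theorem SmoothFam.at {f : ℝ → Pt → F} {p : Pt × ℝ} (h : SmoothFam f p) :
    ContDiffAt ℝ ∞ (f p.2) p.1 := by
  have : ContDiffAt ℝ ∞ (fun y : Pt => (y, p.2)) p.1 := contDiffAt_id.prodMk contDiffAt_const
  exact ContDiffAt.comp p.1 (g := fun q : Pt × ℝ => f q.2 q.1) h this

theorem SmoothFam.const {f : Pt → F} {p : Pt × ℝ} (h : ContDiffAt ℝ ∞ f p.1) :
    SmoothFam (fun _ => f) p := ContDiffAt.comp p h contDiffAt_fst

theorem SmoothFam.pd {f : ℝ → Pt → F} {p : Pt × ℝ} (h : SmoothFam f p) (μ : Fin 4) :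
    SmoothFam (fun ε => pd μ (f ε)) p := by
  have h1 : ContDiffAt ℝ ∞ (fun q : Pt × ℝ => fderiv ℝ (f q.2) q.1) p := by
    refine ContDiffAt.fderiv (f := fun q : Pt × ℝ => f q.2) (g := Prod.fst) (n := ∞) ?_
      contDiffAt_fst (by simp)
    exact ContDiffAt.comp (g := fun q : Pt × ℝ => f q.2 q.1)
      (f := fun r : (Pt × ℝ) × Pt => (r.2, r.1.2)) (p, p.1) h
      (contDiffAt_snd.prodMk (contDiffAt_snd.comp _ contDiffAt_fst))
  exact h1.clm_apply contDiffAt_const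

theorem contDiffAt_pd {f : Pt → F} {x : Pt} (h : ContDiffAt ℝ ∞ f x) (μ : Fin 4) :
    ContDiffAt ℝ ∞ (pd μ f) x :=
  ((SmoothFam.const (p := (x, 0)) h).pd μ).at

theorem SmoothFam.differentiableAt_param {f : ℝ → Pt → F} {p : Pt × ℝ} (h : SmoothFam f p) :
    DifferentiableAt ℝ (fun ε => f ε p.1) p.2 := by
  have : DifferentiableAt ℝ (fun ε : ℝ => (p.1, ε)) p.2 := by fun_prop
  exact DifferentiableAt.comp p.2 (g := fun q : Pt × ℝ => f q.2 q.1)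
    (ContDiffAt.differentiableAt h (by simp)) this

/-! ### Derivatives of the determinant and of the inverse matrix -/

/-- Jacobi's formula: the determinant is multilinear in the rows, and replacing one row expands
along the adjugate. -/
theorem hasFDerivAt_det (A : Tensor2) :
    ∃ D : Tensor2 →L[ℝ] ℝ, HasFDerivAt (fun B : Tensor2 => (Matrix.of B).det) D A ∧
      ∀ B : Tensor2, D B = ∑ μ, ∑ ν, (Matrix.of A).adjugate ν μ * B μ ν := by
  have hc : Continuous fun B : Tensor2 => (Matrix.of B).det := by
    have : Continuous (fun B : Tensor2 => Matrix.of B) := continuous_id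
    exact this.matrix_det
  let m : ContinuousMultilinearMap ℝ (fun _ : Fin 4 => Fin 4 → ℝ) ℝ :=
    ⟨(Matrix.detRowAlternating (n := Fin 4) (R := ℝ)).toMultilinearMap, hc⟩
  refine ⟨m.linearDeriv A, m.hasFDerivAt A, fun B => ?_⟩
  rw [ContinuousMultilinearMap.linearDeriv_apply]
  refine Finset.sum_congr rfl fun μ _ => ?_
  have h1 : m (Function.update A μ (B μ)) = ((Matrix.of A).updateRow μ (B μ)).det := rfl
  rw [h1, ← Matrix.cramer_transpose_apply, Matrix.cramer_eq_adjugate_mulVec,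
    ← Matrix.adjugate_transpose]
  simp [Matrix.mulVec, dotProduct, Matrix.transpose_apply]

theorem contDiff_det : ContDiff ℝ ∞ (fun B : Tensor2 => (Matrix.of B).det) := by
  simp only [Matrix.det_apply, Matrix.of_apply]
  fun_prop

theorem contDiff_adjugate (μ ν : Fin 4) :
    ContDiff ℝ ∞ (fun B : Tensor2 => (Matrix.of B).adjugate μ ν) := by
  simp only [Matrix.adjugate_apply]
  have h : ContDiff ℝ ∞ (fun B : Tensor2 =>
      (fun a b => (Matrix.of B).updateRow ν (Pi.single μ 1) a b : Tensor2)) := by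
    rw [contDiff_pi]; intro a; rw [contDiff_pi]; intro b
    simp only [Matrix.updateRow_apply, Matrix.of_apply]
    split_ifs <;> fun_prop
  exact contDiff_det.comp h

theorem contDiffAt_inv_entry {A : Tensor2} (hA : (Matrix.of A).det ≠ 0) (μ ν : Fin 4) :
    ContDiffAt ℝ ∞ (fun B : Tensor2 => (Matrix.of B)⁻¹ μ ν) A := by
  simp only [Matrix.inv_def, Ring.inverse_eq_inv', Matrix.smul_apply, smul_eq_mul]
  exact (contDiff_det.contDiffAt.inv hA).mul (contDiff_adjugate μ ν).contDiffAt

/-- The derivative `-A⁻¹ A' A⁻¹` of the inverse along a curve, from differentiating `A⁻¹ A = 1`. -/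
theorem hasDerivAt_inv_entry {A : ℝ → Tensor2} {A' : Tensor2} {t : ℝ} (h : HasDerivAt A A' t)
    (hA : (Matrix.of (A t)).det ≠ 0) (μ ν : Fin 4) :
    HasDerivAt (fun s => (Matrix.of (A s))⁻¹ μ ν)
      (-∑ α, ∑ β, (Matrix.of (A t))⁻¹ μ α * A' α β * (Matrix.of (A t))⁻¹ β ν) t := by
  set H : Matrix (Fin 4) (Fin 4) ℝ := (Matrix.of (A t))⁻¹ with hH
  have hd : ∀ i j, DifferentiableAt ℝ (fun s => (Matrix.of (A s))⁻¹ i j) t := fun i j =>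
    DifferentiableAt.comp (g := fun B : Tensor2 => (Matrix.of B)⁻¹ i j) t
      ((contDiffAt_inv_entry hA i j).differentiableAt (by simp)) h.differentiableAt
  have hA' : ∀ i j, HasDerivAt (fun s => A s i j) (A' i j) t := fun i j =>
    (hasDerivAt_pi.1 ((hasDerivAt_pi.1 h) i)) j
  have hne : ∀ᶠ s in 𝓝 t, (Matrix.of (A s)).det ≠ 0 :=
    (contDiff_det.continuous.continuousAt.comp h.continuousAt).eventually_ne hA
  let B' : Matrix (Fin 4) (Fin 4) ℝ := fun i j => deriv (fun s => (Matrix.of (A s))⁻¹ i j) t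
  have hB : B' * Matrix.of (A t) + H * Matrix.of A' = 0 := by
    ext i k
    have h1 : HasDerivAt (fun s => ∑ j, (Matrix.of (A s))⁻¹ i j * A s j k)
        (∑ j, (B' i j * A t j k + H i j * A' j k)) t :=
      HasDerivAt.fun_sum fun j _ => (hd i j).hasDerivAt.mul (hA' j k)
    have h2 : (fun s => ∑ j, (Matrix.of (A s))⁻¹ i j * A s j k) =ᶠ[𝓝 t]
        fun _ => (1 : Matrix (Fin 4) (Fin 4) ℝ) i k := by
      filter_upwards [hne] with s hs
      rw [← Matrix.nonsing_inv_mul (Matrix.of (A s)) (isUnit_iff_ne_zero.2 hs), Matrix.mul_apply]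
      rfl
    have h3 := h1.unique ((hasDerivAt_const t _).congr_of_eventuallyEq h2)
    rw [Finset.sum_add_distrib] at h3
    simpa [Matrix.mul_apply] using h3
  have hinv : Matrix.of (A t) * H = 1 := Matrix.mul_nonsing_inv _ (isUnit_iff_ne_zero.2 hA)
  have hB' : B' = -(H * Matrix.of A' * H) := by
    calc B' = (B' * Matrix.of (A t)) * H := by rw [mul_assoc, hinv, mul_one]
      _ = _ := by rw [eq_neg_of_add_eq_zero_left hB, neg_mul]
  have := (hd μ ν).hasDerivAt
  have e : B' μ ν = -∑ α, ∑ β, H μ α * A' α β * H β ν := by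
    rw [hB', Matrix.neg_apply, Matrix.mul_apply]
    simp only [Matrix.mul_apply, Finset.sum_mul, Matrix.of_apply]
    rw [Finset.sum_comm]
  rw [← e]
  exact this

theorem hasDerivAt_sqrt_neg_det {A : ℝ → Tensor2} {A' : Tensor2} {t : ℝ} (h : HasDerivAt A A' t)
    (hA : (Matrix.of (A t)).det < 0) :
    HasDerivAt (fun s => √(-(Matrix.of (A s)).det))
      (√(-(Matrix.of (A t)).det) * ((1 / 2) * ∑ μ, ∑ ν, (Matrix.of (A t))⁻¹ ν μ * A' μ ν)) t := by
  obtain ⟨D, hD, hDB⟩ := hasFDerivAt_det (A t)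
  have h1 : HasDerivAt (fun s => √(-(Matrix.of (A s)).det))
      (-D A' / (2 * √(-(Matrix.of (A t)).det))) t :=
    ((hD.comp_hasDerivAt t h).neg).sqrt (by simpa using hA.ne)
  convert h1 using 1
  have hs : 0 < √(-(Matrix.of (A t)).det) := Real.sqrt_pos.2 (by linarith)
  have hsq : √(-(Matrix.of (A t)).det) ^ 2 = -(Matrix.of (A t)).det := Real.sq_sqrt (by linarith)
  have h2 : D A' = (Matrix.of (A t)).det * ∑ μ, ∑ ν, (Matrix.of (A t))⁻¹ ν μ * A' μ ν := by
    rw [hDB, Finset.mul_sum]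
    refine Finset.sum_congr rfl fun μ _ => ?_
    rw [Finset.mul_sum]
    refine Finset.sum_congr rfl fun ν _ => ?_
    simp only [Matrix.inv_def, Ring.inverse_eq_inv', Matrix.smul_apply, smul_eq_mul]
    field_simp [hA.ne]
  rw [h2, eq_div_iff (by positivity)]
  linear_combination (∑ μ, ∑ ν, (Matrix.of (A t))⁻¹ ν μ * A' μ ν) * hsq

theorem hasDerivAt_line {f : Pt → F} {x : Pt} (hf : DifferentiableAt ℝ f x) (μ : Fin 4) :
    HasDerivAt (fun t : ℝ => f (x + t • (Pi.single μ 1 : Pt))) (pd μ f x) 0 := by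
  have h1 : HasDerivAt (fun t : ℝ => x + t • (Pi.single μ 1 : Pt)) (Pi.single μ 1) 0 := by
    simpa using ((hasDerivAt_id (0 : ℝ)).smul_const (Pi.single μ 1 : Pt)).const_add x
  have h2 : HasFDerivAt f (fderiv ℝ f x) (x + (0 : ℝ) • (Pi.single μ 1 : Pt)) := by
    simpa using hf.hasFDerivAt
  exact h2.comp_hasDerivAt 0 h1

theorem pd_apply₂ {f : Pt → Tensor2} {x : Pt} (hf : DifferentiableAt ℝ f x) (α μ ν : Fin 4) :
    pd α f x μ ν = pd α (fun y => f y μ ν) x := by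
  have h1 := (hasDerivAt_pi.1 ((hasDerivAt_pi.1 (hasDerivAt_line hf α)) μ)) ν
  have h2 : DifferentiableAt ℝ (fun y => f y μ ν) x := by fun_prop
  exact h1.unique (hasDerivAt_line h2 α)

/-! ### Integration -/

/-- Differentiation under the integral sign over a compact set. -/
theorem hasDerivAt_setIntegral {K : Set Pt} (hK : IsCompact K) {f : ℝ → Pt → ℝ} {f' : Pt → ℝ}
    (hf : ∀ x ∈ K, SmoothFam f (x, 0)) (hf' : ∀ x ∈ K, HasDerivAt (fun ε => f ε x) (f' x) 0) :
    ContinuousOn f' K ∧ HasDerivAt (fun ε => ∫ x in K, f ε x) (∫ x in K, f' x) 0 := by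
  set G : Pt × ℝ → ℝ := fun q => f q.2 q.1 with hG
  let N : Set (Pt × ℝ) := interior {p | ContDiffAt ℝ 1 G p}
  have hKN : K ×ˢ {(0 : ℝ)} ⊆ N := by
    rintro ⟨x, e⟩ ⟨hx, he⟩
    obtain rfl : e = 0 := he
    refine mem_interior_iff_mem_nhds.2 ?_
    exact ((hf x hx).of_le (by simp : (1 : WithTop ℕ∞) ≤ ∞)).eventually (by simp)
  obtain ⟨u, v, -, hv, hKu, h0v, huv⟩ :=
    generalized_tube_lemma hK isCompact_singleton isOpen_interior hKN
  obtain ⟨r, hr, hrv⟩ := Metric.nhds_basis_closedBall.mem_iff.1 (hv.mem_nhds (h0v rfl))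
  have hsm : ∀ x ∈ K, ∀ ε ∈ Metric.closedBall (0 : ℝ) r, ContDiffAt ℝ 1 G (x, ε) :=
    fun x hx ε hε => (interior_subset (huv ⟨hKu hx, hrv hε⟩) : _)
  let D : Pt × ℝ → ℝ := fun q => fderiv ℝ G q (0, 1)
  have hDc : ContinuousOn D (K ×ˢ Metric.closedBall (0 : ℝ) r) := by
    rintro ⟨x, ε⟩ ⟨hx, hε⟩
    have h1 : ContDiffAt ℝ 0 (fderiv ℝ G) (x, ε) := (hsm x hx ε hε).fderiv_right (by simp)
    exact (h1.continuousAt.clm_apply continuousAt_const).continuousWithinAt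
  have hDd : ∀ x ∈ K, ∀ ε ∈ Metric.closedBall (0 : ℝ) r,
      HasDerivAt (fun e => f e x) (D (x, ε)) ε := by
    intro x hx ε hε
    have h1 := ((hsm x hx ε hε).differentiableAt one_ne_zero).hasFDerivAt
    have h2 : HasDerivAt (fun e : ℝ => (x, e)) ((0 : Pt), (1 : ℝ)) ε :=
      (hasDerivAt_const ε x).prodMk (hasDerivAt_id ε)
    exact h1.comp_hasDerivAt ε h2
  have h0r : (0 : ℝ) ∈ Metric.closedBall (0 : ℝ) r := Metric.mem_closedBall_self hr.le
  have hfD : ∀ x ∈ K, f' x = D (x, 0) := fun x hx => (hf' x hx).unique (hDd x hx 0 h0r)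
  have hslice : ∀ {φ : Pt × ℝ → ℝ}, ContinuousOn φ (K ×ˢ Metric.closedBall (0 : ℝ) r) →
      ∀ ε ∈ Metric.closedBall (0 : ℝ) r, ContinuousOn (fun x => φ (x, ε)) K := by
    intro φ hφ ε hε
    exact hφ.comp (by fun_prop : Continuous fun x : Pt => (x, ε)).continuousOn
      (fun x hx => ⟨hx, hε⟩)
  have hGc : ContinuousOn G (K ×ˢ Metric.closedBall (0 : ℝ) r) := by
    rintro ⟨x, ε⟩ ⟨hx, hε⟩
    exact (hsm x hx ε hε).continuousAt.continuousWithinAt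
  have hf'c : ContinuousOn f' K := (hslice hDc 0 h0r).congr hfD
  refine ⟨hf'c, ?_⟩
  obtain ⟨C, hC⟩ := (hK.prod (isCompact_closedBall (0 : ℝ) r)).exists_bound_of_continuousOn hDc
  have key := hasDerivAt_integral_of_dominated_loc_of_deriv_le (μ := volume.restrict K)
    (F := f) (F' := fun ε x => D (x, ε)) (x₀ := (0 : ℝ)) (bound := fun _ => C)
    (Metric.closedBall_mem_nhds (0 : ℝ) hr) ?_ ?_ ?_ ?_ ?_ ?_
  · rw [setIntegral_congr_fun hK.measurableSet hfD]
    exact key.2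
  · filter_upwards [Metric.closedBall_mem_nhds (0 : ℝ) hr] with ε hε
    exact (hslice hGc ε hε).aestronglyMeasurable hK.measurableSet
  · exact (hslice hGc 0 h0r).integrableOn_compact hK
  · exact (hslice hDc 0 h0r).aestronglyMeasurable hK.measurableSet
  · refine (ae_restrict_iff' hK.measurableSet).2 (ae_of_all _ fun x hx ε hε => hC (x, ε) ⟨hx, hε⟩)
  · exact integrableOn_const hK.measure_lt_top.ne
  · refine (ae_restrict_iff' hK.measurableSet).2 (ae_of_all _ fun x hx ε hε => hDd x hx ε hε)

/-- The coordinate divergence of a smooth vector field vanishing off a closed subset of a compact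
set integrates to zero. -/
theorem setIntegral_div_eq_zero {K S : Set Pt} (hK : IsCompact K) (hS : IsClosed S) (hSK : S ⊆ K)
    {V : Pt → Fin 4 → ℝ} (hV : ∀ x ∈ K, ContDiffAt ℝ ∞ V x) (hV0 : ∀ x ∉ S, V x = 0) :
    ∫ x in K, ∑ μ, pd μ (fun y => V y μ) x = 0 := by
  have hev : ∀ x ∉ S, V =ᶠ[𝓝 x] 0 := fun x hx =>
    eventually_of_mem (hS.isOpen_compl.mem_nhds hx) hV0
  have hsm : ContDiff ℝ ∞ V := by
    rw [contDiff_iff_contDiffAt]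
    intro x
    by_cases hx : x ∈ S
    · exact hV x (hSK hx)
    · exact (contDiffAt_const (c := (0 : Fin 4 → ℝ))).congr_of_eventuallyEq (hev x hx)
  have hsmi : ∀ μ, ContDiff ℝ ∞ (fun y => V y μ) := fun μ => contDiff_pi.1 hsm μ
  have hpd0 : ∀ μ, ∀ x ∉ S, pd μ (fun y => V y μ) x = 0 := by
    intro μ x hx
    have : (fun y => V y μ) =ᶠ[𝓝 x] fun _ => (0 : ℝ) := by
      filter_upwards [hev x hx] with y hy
      simp [hy]
    rw [pd_congr this]; simp [pd]
  have hcont : ∀ μ, Continuous (pd μ fun y => V y μ) := fun μ =>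
    continuous_iff_continuousAt.2 fun x => (contDiffAt_pd (hsmi μ).contDiffAt μ).continuousAt
  have hScomp : IsCompact S := hK.of_isClosed_subset hS hSK
  have hint : ∀ μ, Integrable (pd μ fun y => V y μ) := fun μ =>
    (hcont μ).integrable_of_hasCompactSupport (HasCompactSupport.intro hScomp (hpd0 μ))
  rw [setIntegral_eq_integral_of_forall_compl_eq_zero (fun x hx =>
    Finset.sum_eq_zero fun μ _ => hpd0 μ x fun h => hx (hSK h)),
    integral_finsetSum _ fun μ _ => hint μ]
  refine Finset.sum_eq_zero fun μ _ => ?_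
  have hVint : Integrable (fun y => V y μ) := (hsmi μ).continuous.integrable_of_hasCompactSupport
    (HasCompactSupport.intro hScomp fun x hx => by simp [hV0 x hx])
  have := integral_mul_fderiv_eq_neg_fderiv_mul_of_integrable (μ := (volume : Measure Pt))
    (f := fun _ : Pt => (1 : ℝ)) (g := fun y => V y μ) (v := Pi.single μ 1)
    (by simp) (by simp only [one_mul]; exact hint μ) (by simpa using hVint)
    (fun x _ => by fun_prop) (fun x _ => (hsmi μ).differentiable (by simp) x)
  simpa [pd] using this

/-- The first variation of an action: derivatives in the parameter may be taken up to divergences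
of vector fields supported inside the region. -/
theorem hasDerivAt_action {K S : Set Pt} (hK : IsCompact K) (hS : IsClosed S) (hSK : S ⊆ K)
    {ℓ f : ℝ → Pt → ℝ} {Y : ℝ → Pt → Fin 4 → ℝ} {Z : Pt → Fin 4 → ℝ} {f' : Pt → ℝ}
    (hℓ : ∀ᶠ ε in 𝓝 (0 : ℝ), ∀ x ∈ K, ℓ ε x = f ε x + ∑ μ, pd μ (fun y => Y ε y μ) x)
    (hf : ∀ᶠ ε in 𝓝 (0 : ℝ), ∀ x ∈ K, SmoothFam f (x, ε))
    (hY : ∀ᶠ ε in 𝓝 (0 : ℝ), ∀ x ∈ K, ContDiffAt ℝ ∞ (Y ε) x) (hY0 : ∀ ε, ∀ x ∉ S, Y ε x = 0)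
    (hZ : ∀ x ∈ K, ContDiffAt ℝ ∞ Z x) (hZ0 : ∀ x ∉ S, Z x = 0)
    (hf' : ∀ x ∈ K, HasDerivAt (fun ε => f ε x) (f' x + ∑ μ, pd μ (fun y => Z y μ) x) 0) :
    ContinuousOn f' K ∧ HasDerivAt (fun ε => ∫ x in K, ℓ ε x) (∫ x in K, f' x) 0 := by
  have hdiv : ∀ V : Pt → Fin 4 → ℝ, (∀ x ∈ K, ContDiffAt ℝ ∞ V x) →
      ContinuousOn (fun x => ∑ μ, pd μ (fun y => V y μ) x) K := by
    intro V hV x hx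
    refine ContinuousAt.continuousWithinAt ?_
    have : ∀ μ, ContinuousAt (pd μ fun y => V y μ) x := fun μ =>
      (contDiffAt_pd (contDiffAt_pi.1 (hV x hx) μ) μ).continuousAt
    fun_prop
  obtain ⟨hc, hd⟩ := hasDerivAt_setIntegral hK hf.self_of_nhds hf'
  have hf'c : ContinuousOn f' K :=
    (hc.sub (hdiv Z hZ)).congr fun x _ => by simp
  refine ⟨hf'c, ?_⟩
  rw [integral_add (hf'c.integrableOn_compact hK) ((hdiv Z hZ).integrableOn_compact hK),
    setIntegral_div_eq_zero hK hS hSK hZ hZ0, add_zero] at hd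
  refine hd.congr_of_eventuallyEq ?_
  filter_upwards [hℓ, hf, hY] with ε h1 h2 h3
  rw [setIntegral_congr_fun hK.measurableSet h1, integral_add, setIntegral_div_eq_zero hK hS hSK h3
    (hY0 ε), add_zero]
  · refine ContinuousOn.integrableOn_compact hK fun x hx => ?_
    exact (h2 x hx).at.continuousAt.continuousWithinAt
  · exact (hdiv _ h3).integrableOn_compact hK

/-- The fundamental lemma of the calculus of variations. -/
theorem eq_zero_of_forall_setIntegral_mul {U : Set Pt} (hU : IsOpen U) {f : Pt → ℝ}
    (hf : ContinuousOn f U)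
    (h : ∀ η : Pt → ℝ, ContDiff ℝ ∞ η → HasCompactSupport η → tsupport η ⊆ U →
      ∫ x in tsupport η, f x * η x = 0) : ∀ x ∈ U, f x = 0 := by
  have hae := hU.ae_eq_zero_of_integral_contDiff_smul_eq_zero (μ := volume) (f := f)
    (hf.locallyIntegrableOn hU.measurableSet) fun η h1 h2 h3 => by
      have h4 := h η h1 h2 h3
      rw [setIntegral_eq_integral_of_forall_compl_eq_zero fun x hx => by
        simp [image_eq_zero_of_notMem_tsupport hx]] at h4
      simpa [mul_comm] using h4
  have h0 : f =ᵐ[volume.restrict U] fun _ => (0 : ℝ) := by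
    rw [Filter.EventuallyEq, ae_restrict_iff' hU.measurableSet]
    exact hae
  exact fun x hx => Measure.eqOn_open_of_ae_eq h0 hU hf continuousOn_const hx

end Calculus

/-! ### The metric and its Levi-Civita connection -/

section Metric

variable {U : Set Pt} {g : Pt → Tensor2}

theorem ContDiffOn.at_of_isOpen {F : Type*} [NormedAddCommGroup F] [NormedSpace ℝ F] {f : Pt → F}
    (hf : ContDiffOn ℝ ∞ f U) (hU : IsOpen U) {x : Pt} (hx : x ∈ U) : ContDiffAt ℝ ∞ f x :=
  hf.contDiffAt (hU.mem_nhds hx)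

theorem IsLorentzMetricOn.entry (hg : IsLorentzMetricOn U g) (hU : IsOpen U) {x : Pt} (hx : x ∈ U)
    (μ ν : Fin 4) : ContDiffAt ℝ ∞ (fun y => g y μ ν) x := by
  have := ContDiffOn.at_of_isOpen hg.smooth hU hx
  fun_prop

theorem g_mul_ginv {x : Pt} (hd : (Matrix.of (g x)).det ≠ 0) (μ ν : Fin 4) :
    ∑ l, g x μ l * ginv g x l ν = if μ = ν then 1 else 0 := by
  have := congrFun (congrFun (Matrix.mul_nonsing_inv (Matrix.of (g x))
    (isUnit_iff_ne_zero.2 hd)) μ) ν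
  rwa [Matrix.mul_apply, Matrix.one_apply] at this

theorem ginv_mul_g {x : Pt} (hd : (Matrix.of (g x)).det ≠ 0) (μ ν : Fin 4) :
    ∑ l, ginv g x μ l * g x l ν = if μ = ν then 1 else 0 := by
  have := congrFun (congrFun (Matrix.nonsing_inv_mul (Matrix.of (g x))
    (isUnit_iff_ne_zero.2 hd)) μ) ν
  rwa [Matrix.mul_apply, Matrix.one_apply] at this

theorem ginv_symm {x : Pt} (hs : ∀ μ ν, g x μ ν = g x ν μ) (μ ν : Fin 4) :
    ginv g x μ ν = ginv g x ν μ := by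
  have h : (Matrix.of (g x)).transpose = Matrix.of (g x) := by
    ext a b; exact hs b a
  have h2 := Matrix.transpose_nonsing_inv (Matrix.of (g x))
  rw [h] at h2
  exact congrFun (congrFun h2 ν) μ

theorem sqrtNegDet_pos {x : Pt} (hd : (Matrix.of (g x)).det < 0) : 0 < sqrtNegDet g x :=
  Real.sqrt_pos.2 (by linarith)

theorem SmoothFam.ginv {G : ℝ → Pt → Tensor2} {p : Pt × ℝ} (hG : SmoothFam G p)
    (hd : (Matrix.of (G p.2 p.1)).det < 0) (μ ν : Fin 4) :
    SmoothFam (fun ε x => ginv (G ε) x μ ν) p :=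
  ContDiffAt.comp (g := fun B : Tensor2 => (Matrix.of B)⁻¹ μ ν) p
    (contDiffAt_inv_entry hd.ne μ ν) hG

theorem SmoothFam.sqrtNegDet {G : ℝ → Pt → Tensor2} {p : Pt × ℝ} (hG : SmoothFam G p)
    (hd : (Matrix.of (G p.2 p.1)).det < 0) : SmoothFam (fun ε => sqrtNegDet (G ε)) p := by
  have h1 : ContDiffAt ℝ ∞ (fun B : Tensor2 => -(Matrix.of B).det) (G p.2 p.1) :=
    contDiff_det.contDiffAt.neg
  exact (ContDiffAt.comp (g := fun B : Tensor2 => -(Matrix.of B).det) p h1 hG).sqrt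
    (neg_pos.2 hd).ne'

theorem SmoothFam.leviCivita {G : ℝ → Pt → Tensor2} {p : Pt × ℝ} (hG : SmoothFam G p)
    (hd : (Matrix.of (G p.2 p.1)).det < 0) (μ ν ρ : Fin 4) :
    SmoothFam (fun ε x => leviCivita (G ε) x μ ν ρ) p := by
  have h1 := hG.ginv hd
  have h2 : ∀ α β γ, SmoothFam (fun ε => VectorialNonmetricity.pd α (fun y => G ε y β γ)) p :=
    fun α β γ => SmoothFam.pd (f := fun ε y => G ε y β γ)
      (contDiffAt_pi.1 (contDiffAt_pi.1 hG β) γ) α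
  simp only [SmoothFam, VectorialNonmetricity.leviCivita] at *
  fun_prop

theorem SmoothFam.ricci {Γ : ℝ → Conn} {p : Pt × ℝ}
    (hΓ : ∀ μ ν ρ, SmoothFam (fun ε x => Γ ε x μ ν ρ) p) (ν σ : Fin 4) :
    SmoothFam (fun ε x => ricci (Γ ε) x ν σ) p := by
  have h2 : ∀ α μ ν ρ, SmoothFam (fun ε => VectorialNonmetricity.pd α (fun y => Γ ε y μ ν ρ)) p :=
    fun α μ ν ρ => (hΓ μ ν ρ).pd α
  exact ContDiffAt.sum fun μ _ => ((ContDiffAt.sum fun l _ =>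
    ((hΓ _ _ _).mul (hΓ _ _ _)).sub ((hΓ _ _ _).mul (hΓ _ _ _))).add (h2 _ _ _ _)).sub (h2 _ _ _ _)

variable (hU : IsOpen U) (hg : IsLorentzMetricOn U g) {x : Pt} (hx : x ∈ U)
include hU hg hx

theorem contDiffAt_ginv (μ ν : Fin 4) : ContDiffAt ℝ ∞ (fun y => ginv g y μ ν) x :=
  (SmoothFam.ginv (p := (x, 0)) (.const (ContDiffOn.at_of_isOpen hg.smooth hU hx))
    (hg.det_neg x hx) μ ν).at

theorem contDiffAt_sqrtNegDet : ContDiffAt ℝ ∞ (sqrtNegDet g) x :=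
  (SmoothFam.sqrtNegDet (p := (x, 0)) (.const (ContDiffOn.at_of_isOpen hg.smooth hU hx))
    (hg.det_neg x hx)).at

theorem contDiffAt_leviCivita (μ ν ρ : Fin 4) :
    ContDiffAt ℝ ∞ (fun y => leviCivita g y μ ν ρ) x :=
  (SmoothFam.leviCivita (p := (x, 0)) (.const (ContDiffOn.at_of_isOpen hg.smooth hU hx))
    (hg.det_neg x hx) μ ν ρ).at

theorem contDiffAt_ricci_leviCivita (ν σ : Fin 4) :
    ContDiffAt ℝ ∞ (fun y => ricci (leviCivita g) y ν σ) x :=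
  (SmoothFam.ricci (p := (x, 0)) (Γ := fun _ => leviCivita g)
    (fun μ ν ρ => .const (contDiffAt_leviCivita hU hg hx μ ν ρ)) ν σ).at

theorem pd_metric_symm (α μ ν : Fin 4) :
    pd α (fun y => g y μ ν) x = pd α (fun y => g y ν μ) x :=
  pd_congr_on hU (fun y hy => hg.symm y hy μ ν) hx α

theorem leviCivita_symm (μ ν ρ : Fin 4) : leviCivita g x μ ν ρ = leviCivita g x μ ρ ν := by
  simp only [leviCivita]
  congr 1
  refine Finset.sum_congr rfl fun σ _ => ?_
  rw [pd_metric_symm hU hg hx σ ν ρ]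
  ring

omit hU in
theorem lower_leviCivita (μ ν ρ : Fin 4) :
    ∑ l, g x μ l * leviCivita g x l ν ρ = (1 / 2) * (pd ν (fun y => g y μ ρ) x
      + pd ρ (fun y => g y μ ν) x - pd μ (fun y => g y ν ρ) x) := by
  simp only [leviCivita, Finset.mul_sum]
  rw [Finset.sum_comm]
  have h : ∀ s l, g x μ l * (1 / 2 * (ginv g x l s * (pd ν (fun y => g y s ρ) x
      + pd ρ (fun y => g y s ν) x - pd s (fun y => g y ν ρ) x)))
      = (g x μ l * ginv g x l s) * (1 / 2 * (pd ν (fun y => g y s ρ) x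
      + pd ρ (fun y => g y s ν) x - pd s (fun y => g y ν ρ) x)) := fun s l => by ring
  simp only [h, ← Finset.sum_mul, g_mul_ginv (hg.det_neg x hx).ne]
  simp

/-- Metric compatibility: `∂_α g_{μν} = g_{μl} Γ^l_{να} + g_{νl} Γ^l_{μα}`. -/
theorem pd_metric (α μ ν : Fin 4) : pd α (fun y => g y μ ν) x =
    ∑ l, (g x μ l * leviCivita g x l ν α + g x ν l * leviCivita g x l μ α) := by
  rw [Finset.sum_add_distrib, lower_leviCivita hg hx, lower_leviCivita hg hx,
    pd_metric_symm hU hg hx α ν μ]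
  ring

/-- The contraction `g^{νμ} ∂_α g_{μν}` is twice the trace of the connection. -/
theorem trace_ginv_pd_metric (α : Fin 4) :
    ∑ μ, ∑ ν, ginv g x ν μ * pd α (fun y => g y μ ν) x = 2 * ∑ l, leviCivita g x l l α := by
  have hd := (hg.det_neg x hx).ne
  have h1 : ∑ μ, ∑ ν, ∑ l, ginv g x ν μ * (g x μ l * leviCivita g x l ν α)
      = ∑ l, leviCivita g x l l α := by
    rw [Finset.sum_comm]
    refine Finset.sum_congr rfl fun ν _ => ?_
    rw [Finset.sum_comm]
    simp only [← mul_assoc, ← Finset.sum_mul, ginv_mul_g hd]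
    simp
  have h2 : ∑ μ, ∑ ν, ∑ l, ginv g x ν μ * (g x ν l * leviCivita g x l μ α)
      = ∑ l, leviCivita g x l l α := by
    refine Finset.sum_congr rfl fun μ _ => ?_
    rw [Finset.sum_comm]
    simp only [ginv_symm (hg.symm x hx) _ μ, ← mul_assoc, ← Finset.sum_mul, ginv_mul_g hd]
    simp
  simp only [pd_metric hU hg hx, Finset.mul_sum, mul_add, Finset.sum_add_distrib]
  rw [h1, h2, ← Finset.mul_sum]
  ring

theorem pd_sqrtNegDet (α : Fin 4) :
    pd α (sqrtNegDet g) x = sqrtNegDet g x * ∑ l, leviCivita g x l l α := by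
  have hgx := (ContDiffOn.at_of_isOpen hg.smooth hU hx).differentiableAt (by simp)
  have h0 : g (x + (0 : ℝ) • (Pi.single α 1 : Pt)) = g x := by simp
  have h1 := hasDerivAt_sqrt_neg_det (hasDerivAt_line hgx α) (by rw [h0]; exact hg.det_neg x hx)
  have h2 := hasDerivAt_line ((contDiffAt_sqrtNegDet hU hg hx).differentiableAt (by simp)) α
  rw [h2.unique h1, h0]
  have h3 : ∑ μ, ∑ ν, (Matrix.of (g x))⁻¹ ν μ * pd α g x μ ν
      = 2 * ∑ l, leviCivita g x l l α := by
    rw [← trace_ginv_pd_metric hU hg hx α]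
    simp only [pd_apply₂ hgx, ginv]
  rw [h3, sqrtNegDet]
  ring

/-- `∂_α g^{μν} = -Γ^μ_{lα} g^{lν} - Γ^ν_{lα} g^{μl}`. -/
theorem pd_ginv (α μ ν : Fin 4) : pd α (fun y => ginv g y μ ν) x =
    -∑ l, (leviCivita g x μ l α * ginv g x l ν + leviCivita g x ν l α * ginv g x μ l) := by
  have hd := (hg.det_neg x hx).ne
  have hgx := (ContDiffOn.at_of_isOpen hg.smooth hU hx).differentiableAt (by simp)
  have h0 : g (x + (0 : ℝ) • (Pi.single α 1 : Pt)) = g x := by simp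
  have h1 := hasDerivAt_inv_entry (hasDerivAt_line hgx α) (by rw [h0]; exact hd) μ ν
  have h2 := hasDerivAt_line ((contDiffAt_ginv hU hg hx μ ν).differentiableAt (by simp)) α
  rw [h2.unique h1, h0]
  simp only [pd_apply₂ hgx]
  change -∑ a, ∑ b, ginv g x μ a * pd α (fun y => g y a b) x * ginv g x b ν = _
  have e1 : ∑ a, ∑ b, ∑ l, ginv g x μ a * (g x a l * leviCivita g x l b α) * ginv g x b ν
      = ∑ l, leviCivita g x μ l α * ginv g x l ν := by
    rw [Finset.sum_comm]
    refine Finset.sum_congr rfl fun b _ => ?_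
    rw [Finset.sum_comm]
    simp only [← mul_assoc, ← Finset.sum_mul, ginv_mul_g hd]
    simp
  have e2 : ∑ a, ∑ b, ∑ l, ginv g x μ a * (g x b l * leviCivita g x l a α) * ginv g x b ν
      = ∑ l, leviCivita g x ν l α * ginv g x μ l := by
    refine Finset.sum_congr rfl fun a _ => ?_
    rw [Finset.sum_comm]
    have : ∀ l b, ginv g x μ a * (g x b l * leviCivita g x l a α) * ginv g x b ν
        = (ginv g x ν b * g x b l) * (ginv g x μ a * leviCivita g x l a α) := by
      intro l b
      rw [ginv_symm (hg.symm x hx) b ν]; ring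
    simp only [this, ← Finset.sum_mul, ginv_mul_g hd]
    simp [mul_comm]
  simp only [pd_metric hU hg hx, Finset.mul_sum, Finset.sum_mul, mul_add, add_mul,
    Finset.sum_add_distrib]
  rw [e1, e2]

end Metric

/-! ### Deforming a connection -/

/-- The part of the Ricci tensor of `Γ + C` that is linear in `C`. -/
def ricciLin (Γ C : Conn) (x : Pt) (ν σ : Fin 4) : ℝ :=
  ∑ μ, ((∑ l, (C x l ν σ * Γ x μ l μ + Γ x l ν σ * C x μ l μ
      - C x l ν μ * Γ x μ l σ - Γ x l ν μ * C x μ l σ))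
    + pd μ (fun y => C y μ ν σ) x - pd σ (fun y => C y μ ν μ) x)

/-- The part of the Ricci tensor of `Γ + C` that is quadratic in `C`. -/
def ricciQuad (C : Conn) (x : Pt) (ν σ : Fin 4) : ℝ :=
  ∑ μ, ∑ l, (C x l ν σ * C x μ l μ - C x l ν μ * C x μ l σ)

/-- The Ricci tensor of a deformed connection, without any remainder. -/
theorem ricci_add (Γ C : Conn) {x : Pt} (hΓ : ∀ μ ν ρ, DifferentiableAt ℝ (fun y => Γ y μ ν ρ) x)
    (hC : ∀ μ ν ρ, DifferentiableAt ℝ (fun y => C y μ ν ρ) x) (ν σ : Fin 4) :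
    ricci (fun y μ ν ρ => Γ y μ ν ρ + C y μ ν ρ) x ν σ
      = ricci Γ x ν σ + ricciLin Γ C x ν σ + ricciQuad C x ν σ := by
  simp only [ricci, ricciLin, ricciQuad, riemann, ← Finset.sum_add_distrib]
  refine Finset.sum_congr rfl fun μ _ => ?_
  rw [pd_add (hΓ _ _ _) (hC _ _ _), pd_add (hΓ _ _ _) (hC _ _ _)]
  have : ∑ l, ((Γ x l ν σ + C x l ν σ) * (Γ x μ l μ + C x μ l μ)
        - (Γ x l ν μ + C x l ν μ) * (Γ x μ l σ + C x μ l σ))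
      = ∑ l, (Γ x l ν σ * Γ x μ l μ - Γ x l ν μ * Γ x μ l σ)
        + ∑ l, (C x l ν σ * Γ x μ l μ + Γ x l ν σ * C x μ l μ
          - C x l ν μ * Γ x μ l σ - Γ x l ν μ * C x μ l σ)
        + ∑ l, (C x l ν σ * C x μ l μ - C x l ν μ * C x μ l σ) := by
    rw [← Finset.sum_add_distrib, ← Finset.sum_add_distrib]
    exact Finset.sum_congr rfl fun l _ => by ring
  rw [this]
  ring

/-- The vector density `√(-g) (g^{νσ} C^μ_{νσ} - g^{νμ} C^σ_{νσ})` whose divergence is the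
contraction of the linear part of the Ricci tensor. -/
def palatiniVec (g : Pt → Tensor2) (C : Conn) (x : Pt) (μ : Fin 4) : ℝ :=
  ∑ ν, ∑ σ, (sqrtNegDet g x * ginv g x ν σ * C x μ ν σ
    - sqrtNegDet g x * ginv g x ν μ * C x σ ν σ)

theorem sum4_reindex {f k : Fin 4 → Fin 4 → Fin 4 → Fin 4 → ℝ}
    (e : Fin 4 × Fin 4 × Fin 4 × Fin 4 ≃ Fin 4 × Fin 4 × Fin 4 × Fin 4)
    (h : ∀ p, f p.1 p.2.1 p.2.2.1 p.2.2.2 = k (e p).1 (e p).2.1 (e p).2.2.1 (e p).2.2.2) :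
    ∑ a, ∑ b, ∑ c, ∑ d, f a b c d = ∑ a, ∑ b, ∑ c, ∑ d, k a b c d := by
  have := Fintype.sum_equiv e _ (fun p => k p.1 p.2.1 p.2.2.1 p.2.2.2) h
  simpa only [Fintype.sum_prod_type] using this

/-- The index bookkeeping behind the Palatini identity: `h` stands for `√(-g) g^{νσ}`, `Γ` for
the Levi-Civita connection, `dh` and `dC` for the coordinate derivatives of `h` and `C`. -/
theorem palatini_algebra {h : Fin 4 → Fin 4 → ℝ} {Γ C : Fin 4 → Fin 4 → Fin 4 → ℝ}
    {dh : Fin 4 → Fin 4 → Fin 4 → ℝ} (dC : Fin 4 → Fin 4 → Fin 4 → Fin 4 → ℝ)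
    (hΓ : ∀ μ ν ρ, Γ μ ν ρ = Γ μ ρ ν)
    (hdh : ∀ α ν σ, dh α ν σ = ∑ l, (Γ l l α * h ν σ - Γ ν l α * h l σ - Γ σ l α * h ν l)) :
    ∑ ν, ∑ σ, h ν σ * (∑ μ, ((∑ l, (C l ν σ * Γ μ l μ + Γ l ν σ * C μ l μ
      - C l ν μ * Γ μ l σ - Γ l ν μ * C μ l σ)) + dC μ μ ν σ - dC σ μ ν μ))
    = ∑ μ, ∑ ν, ∑ σ, (dh μ ν σ * C μ ν σ + h ν σ * dC μ μ ν σ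
      - (dh μ ν μ * C σ ν σ + h ν μ * dC μ σ ν σ)) := by
  have s1 : ∑ ν, ∑ σ, ∑ μ, ∑ l, h ν σ * (C l ν σ * Γ μ l μ)
      = ∑ μ, ∑ ν, ∑ σ, ∑ l, Γ l l μ * h ν σ * C μ ν σ :=
    sum4_reindex ⟨fun p => (p.2.2.2, p.1, p.2.1, p.2.2.1), fun q => (q.2.1, q.2.2.1, q.2.2.2, q.1),
      fun _ => rfl, fun _ => rfl⟩ fun p => by
        simp only [Equiv.coe_fn_mk]; rw [hΓ p.2.2.1 p.2.2.2 p.2.2.1]; ring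
  have s2 : ∑ ν, ∑ σ, ∑ μ, ∑ l, h ν σ * (Γ l ν σ * C μ l μ)
      = ∑ μ, ∑ ν, ∑ σ, ∑ l, Γ ν l μ * h l μ * C σ ν σ :=
    sum4_reindex ⟨fun p => (p.2.1, p.2.2.2, p.2.2.1, p.1), fun q => (q.2.2.2, q.1, q.2.2.1, q.2.1),
      fun _ => rfl, fun _ => rfl⟩ fun p => by simp only [Equiv.coe_fn_mk]; ring
  have s3 : ∑ ν, ∑ σ, ∑ μ, ∑ l, h ν σ * (C l ν μ * Γ μ l σ)
      = ∑ μ, ∑ ν, ∑ σ, ∑ l, Γ σ l μ * h ν l * C μ ν σ :=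
    sum4_reindex ⟨fun p => (p.2.2.2, p.1, p.2.2.1, p.2.1), fun q => (q.2.1, q.2.2.2, q.2.2.1, q.1),
      fun _ => rfl, fun _ => rfl⟩ fun p => by
        simp only [Equiv.coe_fn_mk]; rw [hΓ p.2.2.1 p.2.2.2 p.2.1]; ring
  have s4 : ∑ ν, ∑ σ, ∑ μ, ∑ l, h ν σ * (Γ l ν μ * C μ l σ)
      = ∑ μ, ∑ ν, ∑ σ, ∑ l, Γ ν l μ * h l σ * C μ ν σ :=
    sum4_reindex ⟨fun p => (p.2.2.1, p.2.2.2, p.2.1, p.1), fun q => (q.2.2.2, q.2.2.1, q.1, q.2.1),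
      fun _ => rfl, fun _ => rfl⟩ fun p => by simp only [Equiv.coe_fn_mk]; ring
  have s5 : ∑ μ, ∑ ν, ∑ σ, ∑ l, Γ l l μ * h ν μ * C σ ν σ
      = ∑ μ, ∑ ν, ∑ σ, ∑ l, Γ μ l μ * h ν l * C σ ν σ :=
    sum4_reindex ⟨fun p => (p.2.2.2, p.2.1, p.2.2.1, p.1), fun q => (q.2.2.2, q.2.1, q.2.2.1, q.1),
      fun _ => rfl, fun _ => rfl⟩ fun p => by
        simp only [Equiv.coe_fn_mk]; rw [hΓ p.2.2.2 p.2.2.2 p.1]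
  have s6 : ∑ ν, ∑ σ, ∑ μ, h ν σ * dC μ μ ν σ = ∑ μ, ∑ ν, ∑ σ, h ν σ * dC μ μ ν σ := by
    rw [Finset.sum_congr rfl fun ν _ => Finset.sum_comm, Finset.sum_comm]
  have s7 : ∑ ν, ∑ σ, ∑ μ, h ν σ * dC σ μ ν μ = ∑ μ, ∑ ν, ∑ σ, h ν μ * dC μ σ ν σ := by
    rw [Finset.sum_comm]
  simp only [hdh, mul_add, mul_sub, Finset.mul_sum, Finset.sum_mul, sub_mul,
    Finset.sum_add_distrib, Finset.sum_sub_distrib]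
  rw [s1, s2, s3, s4, s5, s6, s7]
  ring

/-- The Palatini identity: contracted with `√(-g) g^{νσ}`, the linear part of the Ricci tensor of a
deformation of the Levi-Civita connection is a divergence. -/
theorem sum_ricciLin_eq_div {U : Set Pt} {g : Pt → Tensor2} (hU : IsOpen U)
    (hg : IsLorentzMetricOn U g) {x : Pt} (hx : x ∈ U) {C : Conn}
    (hC : ∀ μ ν ρ, DifferentiableAt ℝ (fun y => C y μ ν ρ) x) :
    ∑ ν, ∑ σ, sqrtNegDet g x * ginv g x ν σ * ricciLin (leviCivita g) C x ν σ
      = ∑ μ, pd μ (fun y => palatiniVec g C y μ) x := by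
  have hs : DifferentiableAt ℝ (sqrtNegDet g) x :=
    (contDiffAt_sqrtNegDet hU hg hx).differentiableAt (by simp)
  have hi : ∀ ν σ, DifferentiableAt ℝ (fun y => ginv g y ν σ) x := fun ν σ =>
    (contDiffAt_ginv hU hg hx ν σ).differentiableAt (by simp)
  have hh : ∀ ν σ, DifferentiableAt ℝ (fun y => sqrtNegDet g y * ginv g y ν σ) x := fun ν σ =>
    hs.mul (hi ν σ)
  have hdh : ∀ α ν σ, pd α (fun y => sqrtNegDet g y * ginv g y ν σ) x
      = ∑ l, (leviCivita g x l l α * (sqrtNegDet g x * ginv g x ν σ)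
        - leviCivita g x ν l α * (sqrtNegDet g x * ginv g x l σ)
        - leviCivita g x σ l α * (sqrtNegDet g x * ginv g x ν l)) := by
    intro α ν σ
    rw [pd_mul hs (hi ν σ), pd_sqrtNegDet hU hg hx, pd_ginv hU hg hx]
    simp only [Finset.mul_sum, Finset.sum_mul, ← Finset.sum_neg_distrib, ← Finset.sum_add_distrib]
    exact Finset.sum_congr rfl fun l _ => by ring
  have key := palatini_algebra (h := fun ν σ => sqrtNegDet g x * ginv g x ν σ)
    (Γ := leviCivita g x) (C := C x) (fun α μ ν ρ => pd α (fun y => C y μ ν ρ) x)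
    (leviCivita_symm hU hg hx) hdh
  refine key.trans (Finset.sum_congr rfl fun μ _ => ?_)
  simp only [palatiniVec]
  rw [pd_sum _ fun ν _ => by fun_prop]
  refine Finset.sum_congr rfl fun ν _ => ?_
  rw [pd_sum _ fun σ _ => by fun_prop]
  refine Finset.sum_congr rfl fun σ _ => ?_
  rw [pd_sub (by fun_prop) (by fun_prop), pd_mul (hh _ _) (hC _ _ _), pd_mul (hh _ _) (hC _ _ _)]

/-! ### The vectorial connection -/

/-- The two traces and the quadratic contraction `g^{νσ} C^l_{νμ} C^μ_{lσ}` of the deformation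
`C^μ_{νρ} = a (π_ν δ^μ_ρ + π_ρ δ^μ_ν) + b u^μ g_{νρ} + c u^μ π_ν π_ρ`, where `u^μ = π^μ` and
`P = π_μ π^μ`. Here `H` stands for the inverse metric and `D` for the Kronecker symbol. -/
theorem vectorial_contractions {H g D : Fin 4 → Fin 4 → ℝ} {π u : Fin 4 → ℝ} {P a b c : ℝ}
    {C : Fin 4 → Fin 4 → Fin 4 → ℝ}
    (hD : ∀ i j, D i j = if i = j then 1 else 0) (hHs : ∀ i j, H i j = H j i)
    (hgs : ∀ i j, g i j = g j i) (hHg : ∀ i j, ∑ l, H i l * g l j = D i j)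
    (hu : ∀ i, ∑ l, H i l * π l = u i) (hgu : ∀ i, ∑ l, g i l * u l = π i)
    (hP : ∑ i, π i * u i = P)
    (hC : ∀ μ ν ρ, C μ ν ρ = a * (π ν * D μ ρ + π ρ * D μ ν) + b * u μ * g ν ρ
      + c * u μ * π ν * π ρ) :
    (∀ μ, ∑ ν, ∑ σ, H ν σ * C μ ν σ = (2 * a + 4 * b + c * P) * u μ) ∧
    (∀ l, ∑ μ, C μ l μ = (5 * a + b + c * P) * π l) ∧
    ∑ ν, ∑ σ, H ν σ * ∑ μ, ∑ l, C l ν μ * C μ l σ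
      = (7 * a ^ 2 + 10 * a * b + b ^ 2) * P + (4 * a * c + 2 * b * c) * P ^ 2 + c ^ 2 * P ^ 3 := by
  have hD1 : ∀ (f : Fin 4 → ℝ) i, ∑ l, D i l * f l = f i := fun f i => by simp [hD]
  have hDs : ∀ i j, D i j = D j i := fun i j => by simp [hD, eq_comm]
  have hDD : ∀ i, D i i = 1 := fun i => by simp [hD]
  -- the contraction of one lower index with the inverse metric
  have hW : ∀ l σ μ, ∑ ν, H ν σ * C l ν μ
      = a * (u σ * D l μ + π μ * H l σ) + b * u l * D σ μ + c * u l * u σ * π μ := by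
    intro l σ μ
    have e : ∀ ν, H ν σ * C l ν μ = a * D l μ * (H σ ν * π ν) + a * π μ * (D l ν * H ν σ)
        + b * u l * (H σ ν * g ν μ) + c * u l * π μ * (H σ ν * π ν) := by
      intro ν; rw [hC, hHs ν σ]; ring
    simp only [e, Finset.sum_add_distrib, ← Finset.mul_sum, hu, hHg, hD1]
    ring
  refine ⟨fun μ => ?_, fun l => ?_, ?_⟩
  · rw [Finset.sum_comm]
    simp only [hW]
    have e : ∀ σ, a * (u σ * D μ σ + π σ * H μ σ) + b * u μ * D σ σ + c * u μ * u σ * π σ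
        = a * (D μ σ * u σ) + a * (H μ σ * π σ) + b * u μ + c * u μ * (π σ * u σ) := by
      intro σ; rw [hDD]; ring
    simp only [e, Finset.sum_add_distrib, ← Finset.mul_sum, hu, hD1, hP]
    simp
    ring
  · have e : ∀ μ, C μ l μ = a * π l + a * (D l μ * π μ) + b * (g l μ * u μ)
        + c * π l * (π μ * u μ) := by
      intro μ; rw [hC, hDD, hDs l μ]; ring
    simp only [e, Finset.sum_add_distrib, ← Finset.mul_sum, hD1, hgu, hP]
    simp
    ring
  · have e0 : ∑ ν, ∑ σ, H ν σ * ∑ μ, ∑ l, C l ν μ * C μ l σ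
        = ∑ σ, ∑ μ, ∑ l, (∑ ν, H ν σ * C l ν μ) * C μ l σ := by
      simp only [Finset.mul_sum, Finset.sum_mul]
      rw [Finset.sum_comm]
      refine Finset.sum_congr rfl fun σ _ => ?_
      rw [Finset.sum_comm]
      refine Finset.sum_congr rfl fun μ _ => ?_
      rw [Finset.sum_comm]
      exact Finset.sum_congr rfl fun l _ => Finset.sum_congr rfl fun ν _ => by ring
    have hgH : ∀ σ i, ∑ l, H l σ * g l i = D σ i := fun σ i => by simp only [hHs _ σ, hHg]
    have hHp : ∀ σ, ∑ l, H l σ * π l = u σ := fun σ => by simp only [hHs _ σ, hu]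
    have e1 : ∀ σ μ, ∑ l, (∑ ν, H ν σ * C l ν μ) * C μ l σ
        = a * π σ * (a * (u σ + π μ * H μ σ) + b * u μ * D σ μ + c * u μ * u σ * π μ)
          + (a * D μ σ + c * u μ * π σ) * (2 * a * u σ * π μ + b * P * D σ μ + c * P * u σ * π μ)
          + b * u μ * (a * (u σ * g μ σ + π μ) + b * π σ * D σ μ + c * π σ * u σ * π μ) := by
      intro σ μ
      have e : ∀ l, (∑ ν, H ν σ * C l ν μ) * C μ l σ
          = a * π σ * (D μ l *
              (a * (u σ * D l μ + π μ * H l σ) + b * u l * D σ μ + c * u l * u σ * π μ))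
            + (a * D μ σ + c * u μ * π σ) * (a * u σ * (D μ l * π l) + a * π μ * (H l σ * π l)
              + (b * D σ μ + c * u σ * π μ) * (π l * u l))
            + b * u μ * (a * u σ * (D μ l * g l σ) + a * π μ * (H l σ * g l σ)
              + (b * D σ μ + c * u σ * π μ) * (g σ l * u l)) := by
        intro l; rw [hW, hC, hDs l μ, hgs σ l]; ring
      simp only [e, Finset.sum_add_distrib, ← Finset.mul_sum, hD1, hgH, hHp, hP, hgu, hDD]
      ring
    have e2 : ∀ σ, ∑ μ, ∑ l, (∑ ν, H ν σ * C l ν μ) * C μ l σ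
        = 2 * a * b * P + (7 * a ^ 2 + 2 * a * b + b ^ 2 + (4 * a * c + 2 * b * c) * P
          + c ^ 2 * P ^ 2) * (π σ * u σ) := by
      intro σ
      have e : ∀ μ, a * π σ * (a * (u σ + π μ * H μ σ) + b * u μ * D σ μ + c * u μ * u σ * π μ)
          + (a * D μ σ + c * u μ * π σ) * (2 * a * u σ * π μ + b * P * D σ μ + c * P * u σ * π μ)
          + b * u μ * (a * (u σ * g μ σ + π μ) + b * π σ * D σ μ + c * π σ * u σ * π μ)
          = a * a * π σ * u σ + a * a * π σ * (H μ σ * π μ)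
            + (a * b * π σ + b * b * π σ + c * b * P * π σ) * (D σ μ * u μ)
            + (a * c * π σ * u σ + 2 * a * c * u σ * π σ + c * c * P * u σ * π σ + a * b
                + b * c * π σ * u σ) * (π μ * u μ)
            + (2 * a * a * u σ + a * c * P * u σ) * (D σ μ * π μ)
            + a * b * P * (D σ μ * D σ μ)
            + b * a * u σ * (g σ μ * u μ) := by
        intro μ; rw [hDs μ σ, hgs μ σ]; ring
      simp only [e1, e, Finset.sum_add_distrib, ← Finset.mul_sum, hD1, hHp, hP, hgu, hDD]
      simp
      ring
    rw [e0]
    simp only [e2, Finset.sum_add_distrib, ← Finset.mul_sum, hP]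
    simp
    ring

/-- The contraction of the quadratic part of the Ricci tensor in terms of the two traces of `C` and
one full contraction of `C` with itself. -/
theorem sum_ricciQuad (H : Fin 4 → Fin 4 → ℝ) (C : Conn) (x : Pt) :
    ∑ ν, ∑ σ, H ν σ * ricciQuad C x ν σ
      = ∑ l, (∑ ν, ∑ σ, H ν σ * C x l ν σ) * (∑ μ, C x μ l μ)
        - ∑ ν, ∑ σ, H ν σ * ∑ μ, ∑ l, C x l ν μ * C x μ l σ := by
  simp only [ricciQuad, Finset.sum_sub_distrib, mul_sub]
  congr 1
  have e : ∀ l, (∑ ν, ∑ σ, H ν σ * C x l ν σ) * (∑ μ, C x μ l μ)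
      = ∑ ν, ∑ σ, ∑ μ, H ν σ * C x l ν σ * C x μ l μ := fun l => by
    simp only [Finset.sum_mul]
    simp only [Finset.mul_sum]
  simp only [e, Finset.mul_sum]
  exact sum4_reindex ⟨fun p => (p.2.2.2, p.1, p.2.1, p.2.2.1),
    fun q => (q.2.1, q.2.2.1, q.2.2.2, q.1), fun _ => rfl, fun _ => rfl⟩ fun p =>
      (mul_assoc _ _ _).symm

section

variable {U : Set Pt} {g : Pt → Tensor2}

theorem lower_raise {x : Pt} (hd : (Matrix.of (g x)).det ≠ 0) (w : Pt → Fin 4 → ℝ) (μ : Fin 4) :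
    ∑ ν, g x μ ν * raise g w x ν = w x μ := by
  simp only [raise, Finset.mul_sum]
  rw [Finset.sum_comm]
  simp only [← mul_assoc, ← Finset.sum_mul, g_mul_ginv hd]
  simp

theorem SmoothFam.raise {G : ℝ → Pt → Tensor2} {w : ℝ → Pt → Fin 4 → ℝ} {p : Pt × ℝ}
    (hG : SmoothFam G p) (hd : (Matrix.of (G p.2 p.1)).det < 0) (hw : SmoothFam w p) (μ : Fin 4) :
    SmoothFam (fun ε x => raise (G ε) (w ε) x μ) p := by
  have h1 := hG.ginv hd
  have h2 : ∀ ν, SmoothFam (fun ε x => w ε x ν) p := contDiffAt_pi.1 hw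
  exact ContDiffAt.sum fun ν _ => (h1 _ _).mul (h2 _)

theorem SmoothFam.normSq {G : ℝ → Pt → Tensor2} {w : ℝ → Pt → Fin 4 → ℝ} {p : Pt × ℝ}
    (hG : SmoothFam G p) (hd : (Matrix.of (G p.2 p.1)).det < 0) (hw : SmoothFam w p) :
    SmoothFam (fun ε => normSq (G ε) (w ε)) p := by
  have h2 : ∀ ν, SmoothFam (fun ε x => w ε x ν) p := contDiffAt_pi.1 hw
  exact ContDiffAt.sum fun ν _ => (h2 _).mul (hG.raise hd hw _)

/-- The deformation of the Levi-Civita connection that produces `vnConn`; its last index is the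
direction of differentiation. -/
def distortionConn (c₁ c₂ c₃ : ℝ) (g : Pt → Tensor2) (π : Pt → Fin 4 → ℝ) : Conn :=
  fun x μ ν ρ => distortion c₁ c₂ c₃ g π x μ ρ ν

/-- The distortion after cancellation of the three nonmetricity terms, in the form required by
`vectorial_contractions`. -/
theorem distortionConn_eq (c₁ c₂ c₃ : ℝ) (π : Pt → Fin 4 → ℝ) {x : Pt}
    (hs : ∀ μ ν, g x μ ν = g x ν μ) (hd : (Matrix.of (g x)).det ≠ 0) (μ ν ρ : Fin 4) :
    distortionConn c₁ c₂ c₃ g π x μ ν ρ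
      = c₁ / 2 * (π x ν * (if μ = ρ then 1 else 0) + π x ρ * (if μ = ν then 1 else 0))
        + (c₂ - c₁ / 2) * raise g π x μ * g x ν ρ + c₃ * raise g π x μ * π x ν * π x ρ := by
  simp only [distortionConn, distortion, nonmetricity]
  have e : ∀ l, ginv g x l μ * (-(c₁ * π x l * g x ν ρ + c₂ * (π x ρ * g x l ν
      + π x ν * g x ρ l) + 2 * c₃ * π x l * π x ν * π x ρ)
      + (c₁ * π x ρ * g x l ν + c₂ * (π x ν * g x ρ l + π x l * g x ν ρ)
        + 2 * c₃ * π x ρ * π x l * π x ν)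
      + (c₁ * π x ν * g x ρ l + c₂ * (π x l * g x ν ρ + π x ρ * g x l ν)
        + 2 * c₃ * π x ν * π x ρ * π x l))
      = c₁ * π x ρ * (ginv g x μ l * g x l ν) + c₁ * π x ν * (ginv g x μ l * g x l ρ)
        + (2 * c₂ * g x ν ρ - c₁ * g x ν ρ + 2 * c₃ * π x ν * π x ρ)
          * (ginv g x μ l * π x l) := by
    intro l
    rw [ginv_symm hs l μ, hs ρ l]; ring
  simp only [e, Finset.sum_add_distrib, ← Finset.mul_sum, ginv_mul_g hd]
  simp only [raise]
  ring

variable (hU : IsOpen U) (hg : IsLorentzMetricOn U g) {x : Pt} (hx : x ∈ U)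
  {π : Pt → Fin 4 → ℝ}
include hU hg hx

theorem contDiffAt_raise (hπ : ContDiffAt ℝ ∞ π x) (μ : Fin 4) :
    ContDiffAt ℝ ∞ (fun y => raise g π y μ) x :=
  (SmoothFam.raise (p := (x, 0)) (.const (ContDiffOn.at_of_isOpen hg.smooth hU hx))
    (hg.det_neg x hx) (.const hπ) μ).at

theorem contDiffAt_normSq (hπ : ContDiffAt ℝ ∞ π x) : ContDiffAt ℝ ∞ (normSq g π) x :=
  (SmoothFam.normSq (p := (x, 0)) (.const (ContDiffOn.at_of_isOpen hg.smooth hU hx))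
    (hg.det_neg x hx) (.const hπ)).at

theorem contDiffAt_distortionConn (c₁ c₂ c₃ : ℝ) (hπ : ContDiffAt ℝ ∞ π x) (μ ν ρ : Fin 4) :
    ContDiffAt ℝ ∞ (fun y => distortionConn c₁ c₂ c₃ g π y μ ν ρ) x := by
  have h1 := contDiffAt_ginv hU hg hx
  have h2 := hg.entry hU hx
  have h3 := contDiffAt_pi.1 hπ
  simp only [distortionConn, distortion, nonmetricity]
  fun_prop

/-- `√(-g) ∇_μ V^μ = ∂_μ (√(-g) V^μ)` for the Levi-Civita connection. -/
theorem sqrtNegDet_mul_divVec {V : Pt → Fin 4 → ℝ}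
    (hV : ∀ μ, DifferentiableAt ℝ (fun y => V y μ) x) :
    sqrtNegDet g x * divVec (leviCivita g) V x
      = ∑ μ, pd μ (fun y => sqrtNegDet g y * V y μ) x := by
  have hs : DifferentiableAt ℝ (sqrtNegDet g) x :=
    (contDiffAt_sqrtNegDet hU hg hx).differentiableAt (by simp)
  simp only [divVec, covVec, pd_mul hs (hV _), pd_sqrtNegDet hU hg hx, Finset.sum_add_distrib,
    mul_add, Finset.mul_sum, Finset.sum_mul]
  rw [Finset.sum_comm (f := fun μ ν => sqrtNegDet g x * (leviCivita g x μ ν μ * V x ν)), add_comm]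
  congr 1
  refine Finset.sum_congr rfl fun μ _ => Finset.sum_congr rfl fun ν _ => ?_
  rw [leviCivita_symm hU hg hx ν μ ν]
  ring

/-- Up to a divergence, the gravitational Lagrangian is the Einstein–Hilbert Lagrangian plus a
quadratic and a quartic term in the one-form. -/
theorem gravLagrangian_eq (c₁ c₂ c₃ ξ : ℝ) (hπ : ContDiffOn ℝ ∞ π U) :
    sqrtNegDet g x * (scalarCurv g (vnConn c₁ c₂ c₃ g π) x
        + ξ * divVec (vnConn c₁ c₂ c₃ g π) (raise g π) x)
      = sqrtNegDet g x * (scalarCurv g (leviCivita g) x + b₁ c₁ c₂ ξ * normSq g π x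
          + b₂ c₂ c₃ ξ / 2 * normSq g π x ^ 2)
        + ∑ μ, pd μ (fun y => (3 * (c₂ - c₁) + ξ) * (sqrtNegDet g y * raise g π y μ)) x := by
  have hπx := fun {y} (hy : y ∈ U) => ContDiffOn.at_of_isOpen hπ hU hy
  have hcon : ∀ y ∈ U, _ := fun y hy => vectorial_contractions (H := ginv g y) (g := g y)
    (D := fun i j => if i = j then 1 else 0) (π := π y) (u := raise g π y) (P := normSq g π y)
    (a := c₁ / 2) (b := c₂ - c₁ / 2) (c := c₃) (C := distortionConn c₁ c₂ c₃ g π y)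
    (fun _ _ => rfl) (ginv_symm (hg.symm y hy)) (hg.symm y hy)
    (ginv_mul_g (hg.det_neg y hy).ne) (fun _ => rfl) (lower_raise (hg.det_neg y hy).ne π) rfl
    (distortionConn_eq c₁ c₂ c₃ π (hg.symm y hy) (hg.det_neg y hy).ne)
  have hCd := fun μ ν ρ => (contDiffAt_distortionConn hU hg hx c₁ c₂ c₃ (hπx hx) μ ν
    ρ).differentiableAt (by simp)
  have hΓd := fun μ ν ρ => (contDiffAt_leviCivita hU hg hx μ ν ρ).differentiableAt (by simp)
  have hsu : ∀ μ, DifferentiableAt ℝ (fun y => sqrtNegDet g y * raise g π y μ) x := fun μ =>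
    ((contDiffAt_sqrtNegDet hU hg hx).mul
      (contDiffAt_raise hU hg hx (hπx hx) μ)).differentiableAt (by simp)
  set C := distortionConn c₁ c₂ c₃ g π with hCdef
  have hric : ∀ ν σ, ricci (vnConn c₁ c₂ c₃ g π) x ν σ = ricci (leviCivita g) x ν σ
      + ricciLin (leviCivita g) C x ν σ + ricciQuad C x ν σ :=
    ricci_add (leviCivita g) C hΓd hCd
  -- the linear term is a divergence of a multiple of the one-form
  have hvec : ∀ y ∈ U, ∀ μ, palatiniVec g C y μ
      = 3 * (c₂ - c₁) * (sqrtNegDet g y * raise g π y μ) := by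
    intro y hy μ
    obtain ⟨h1, h2, -⟩ := hcon y hy
    have e : palatiniVec g C y μ = sqrtNegDet g y * (∑ ν, ∑ σ, ginv g y ν σ * C y μ ν σ)
        - sqrtNegDet g y * ∑ ν, ginv g y μ ν * ∑ σ, C y σ ν σ := by
      simp only [palatiniVec, Finset.sum_sub_distrib, Finset.mul_sum, ← mul_assoc,
        ginv_symm (hg.symm y hy) _ μ]
    rw [e, h1]
    simp only [h2, mul_left_comm _ (5 * (c₁ / 2) + (c₂ - c₁ / 2) + c₃ * normSq g π y),
      ← Finset.mul_sum]
    change _ - _ * (_ * raise g π y μ) = _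
    ring
  have hlin := sum_ricciLin_eq_div hU hg hx hCd
  have hlin' : ∑ μ, pd μ (fun y => palatiniVec g C y μ) x
      = 3 * (c₂ - c₁) * ∑ μ, pd μ (fun y => sqrtNegDet g y * raise g π y μ) x := by
    rw [Finset.mul_sum]
    refine Finset.sum_congr rfl fun μ _ => ?_
    rw [← pd_const_mul _ (hsu μ)]
    exact pd_congr_on hU (fun y hy => hvec y hy μ) hx μ
  obtain ⟨h1, h2, h3⟩ := hcon x hx
  have hquad : ∑ ν, ∑ σ, ginv g x ν σ * ricciQuad C x ν σ = (3 * (c₁ / 2) ^ 2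
      + 12 * (c₁ / 2) * (c₂ - c₁ / 2) + 3 * (c₂ - c₁ / 2) ^ 2) * normSq g π x
      + 3 * c₃ * c₂ * normSq g π x ^ 2 := by
    rw [sum_ricciQuad, h3]
    simp only [h1, h2]
    have e' : ∀ l, (2 * (c₁ / 2) + 4 * (c₂ - c₁ / 2) + c₃ * normSq g π x) * raise g π x l *
        ((5 * (c₁ / 2) + (c₂ - c₁ / 2) + c₃ * normSq g π x) * π x l)
        = ((2 * (c₁ / 2) + 4 * (c₂ - c₁ / 2) + c₃ * normSq g π x) *
        (5 * (c₁ / 2) + (c₂ - c₁ / 2) + c₃ * normSq g π x)) * (π x l * raise g π x l) :=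
      fun l => by ring
    simp only [e', ← Finset.mul_sum]
    change _ * normSq g π x - _ = _
    ring
  have hR : sqrtNegDet g x * scalarCurv g (vnConn c₁ c₂ c₃ g π) x
      = sqrtNegDet g x * scalarCurv g (leviCivita g) x
        + ∑ ν, ∑ σ, sqrtNegDet g x * ginv g x ν σ * ricciLin (leviCivita g) C x ν σ
        + sqrtNegDet g x * ∑ ν, ∑ σ, ginv g x ν σ * ricciQuad C x ν σ := by
    simp only [scalarCurv, hric, mul_add, Finset.sum_add_distrib, Finset.mul_sum, mul_assoc]
  have hdiv : divVec (vnConn c₁ c₂ c₃ g π) (raise g π) x = divVec (leviCivita g) (raise g π) x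
      + (5 * (c₁ / 2) + (c₂ - c₁ / 2) + c₃ * normSq g π x) * normSq g π x := by
    have e : divVec (vnConn c₁ c₂ c₃ g π) (raise g π) x = divVec (leviCivita g) (raise g π) x
        + ∑ ν, (∑ μ, C x μ ν μ) * raise g π x ν := by
      simp only [Finset.sum_mul]
      rw [Finset.sum_comm]
      simp only [divVec, covVec, vnConn, add_mul, Finset.sum_add_distrib, hCdef, distortionConn]
      ring
    rw [e]
    simp only [h2, mul_assoc, ← Finset.mul_sum]
    rfl
  have hsd := sqrtNegDet_mul_divVec hU hg hx (V := raise g π) fun μ =>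
    (contDiffAt_raise hU hg hx (hπx hx) μ).differentiableAt (by simp)
  simp only [pd_const_mul _ (hsu _), ← Finset.mul_sum]
  rw [mul_add, hR, hlin, hlin', hquad, hdiv, b₁, b₂]
  linear_combination ξ * hsd

end

/-! ### The first variation of the gravitational action -/

theorem SmoothFam.affine {F : Type*} [NormedAddCommGroup F] [NormedSpace ℝ F] {f h : Pt → F}
    {p : Pt × ℝ} (hf : ContDiffAt ℝ ∞ f p.1) (hh : ContDiff ℝ ∞ h) :
    SmoothFam (fun ε x => f x + ε • h x) p :=
  (ContDiffAt.comp (g := f) p hf contDiffAt_fst).add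
    (contDiffAt_snd.smul (hh.contDiffAt.comp p contDiffAt_fst))

theorem hasDerivAt_affine {F : Type*} [NormedAddCommGroup F] [NormedSpace ℝ F] (a b : F) (t : ℝ) :
    HasDerivAt (fun ε : ℝ => a + ε • b) b t := by
  simpa using ((hasDerivAt_id t).smul_const b).const_add a

/-- A product of two factors that both vanish has derivative zero. -/
theorem hasDerivAt_mul_of_eq_zero {a b : ℝ → ℝ} {t : ℝ} (ha : DifferentiableAt ℝ a t)
    (hb : DifferentiableAt ℝ b t) (ha0 : a t = 0) (hb0 : b t = 0) :
    HasDerivAt (fun s => a s * b s) 0 t := by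
  have := HasDerivAt.fun_mul ha.hasDerivAt hb.hasDerivAt
  rwa [ha0, hb0, mul_zero, zero_mul, add_zero] at this

/-- A small compactly supported symmetric variation of a Lorentzian metric is Lorentzian. -/
theorem eventually_isLorentzMetricOn {U K : Set Pt} {g δg : Pt → Tensor2} (hU : IsOpen U)
    (hg : IsLorentzMetricOn U g) (hK : IsCompact K) (hKU : K ⊆ U) (hδ : IsVariation K δg)
    (hδs : ∀ x μ ν, δg x μ ν = δg x ν μ) :
    ∀ᶠ ε in 𝓝 (0 : ℝ), IsLorentzMetricOn U (fun x => g x + ε • δg x) := by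
  have h1 : ∀ᶠ ε in 𝓝 (0 : ℝ), ∀ x ∈ K, (Matrix.of (g x + ε • δg x)).det < 0 := by
    refine hK.eventually_forall_of_forall_eventually fun x hx => ?_
    have hgx : ContinuousAt g x := (ContDiffOn.at_of_isOpen hg.smooth hU (hKU hx)).continuousAt
    have hc : ContinuousAt (fun z : ℝ × Pt => (Matrix.of (g z.2 + z.1 • δg z.2)).det) (0, x) := by
      refine ContinuousAt.comp (g := fun B : Tensor2 => (Matrix.of B).det)
        contDiff_det.continuous.continuousAt ?_
      have h2 : ContinuousAt (fun z : ℝ × Pt => g z.2) (0, x) :=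
        ContinuousAt.comp (g := g) (f := Prod.snd) (x := ((0 : ℝ), x)) hgx continuousAt_snd
      have h3 := hδ.1.continuous
      fun_prop
    refine hc.eventually_lt continuousAt_const ?_
    simpa using hg.det_neg x (hKU hx)
  filter_upwards [h1] with ε hε
  refine ⟨hg.smooth.add (ContDiff.const_smul ε hδ.1).contDiffOn, fun x hx μ ν => ?_, fun x hx => ?_⟩
  · simp [hg.symm x hx μ ν, hδs x μ ν]
  · by_cases hxK : x ∈ K
    · exact hε x hxK
    · have : δg x = 0 := image_eq_zero_of_notMem_tsupport fun h => hxK (hδ.2 h)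
      simpa [this] using hg.det_neg x hx

/-- The Einstein tensor with raised indices. -/
def einsteinUp (g : Pt → Tensor2) (x : Pt) (α β : Fin 4) : ℝ :=
  ∑ μ, ∑ ν, ginv g x α μ * ginv g x β ν * einstein g x μ ν

theorem einsteinUp_eq {g : Pt → Tensor2} {x : Pt} (hs : ∀ μ ν, g x μ ν = g x ν μ)
    (hd : (Matrix.of (g x)).det ≠ 0) (α β : Fin 4) :
    einsteinUp g x α β = ∑ μ, ∑ ν, ginv g x α μ * ginv g x β ν * ricci (leviCivita g) x μ ν
      - (1 / 2) * ginv g x α β * scalarCurv g (leviCivita g) x := by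
  have e : ∀ μ ν, ginv g x α μ * ginv g x β ν * einstein g x μ ν
      = ginv g x α μ * ginv g x β ν * ricci (leviCivita g) x μ ν
        - (1 / 2) * scalarCurv g (leviCivita g) x * ginv g x α μ * (ginv g x β ν * g x ν μ) := by
    intro μ ν; rw [einstein, hs μ ν]; ring
  simp only [einsteinUp, e, Finset.sum_sub_distrib, ← Finset.mul_sum, ginv_mul_g hd]
  simp
  ring

section

variable {U : Set Pt} {g δg : Pt → Tensor2} {π δπ : Pt → Fin 4 → ℝ}

/-- The change of the Levi-Civita connection under a variation of the metric. -/
def leviCivitaDiff (g δg : Pt → Tensor2) (ε : ℝ) : Conn := fun x μ ν ρ =>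
  leviCivita (fun y => g y + ε • δg y) x μ ν ρ - leviCivita g x μ ν ρ

theorem leviCivitaDiff_zero (x : Pt) (μ ν ρ : Fin 4) : leviCivitaDiff g δg 0 x μ ν ρ = 0 := by
  simp [leviCivitaDiff]

theorem ricciLin_zero (Γ C : Conn) (hC : ∀ x μ ν ρ, C x μ ν ρ = 0) (x : Pt) (ν σ : Fin 4) :
    ricciLin Γ C x ν σ = 0 := by
  simp [ricciLin, hC, pd]

/-- Off the support of the variation the connection does not change. -/
theorem leviCivitaDiff_eq_zero {x : Pt} (hx : x ∉ tsupport δg) (ε : ℝ) (μ ν ρ : Fin 4) :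
    leviCivitaDiff g δg ε x μ ν ρ = 0 := by
  have hev : (fun y => g y + ε • δg y) =ᶠ[𝓝 x] g := by
    filter_upwards [(isClosed_tsupport δg).isOpen_compl.mem_nhds hx] with y hy
    simp [image_eq_zero_of_notMem_tsupport hy]
  have hpd : ∀ α a b, pd α (fun y => (g y + ε • δg y) a b) x = pd α (fun y => g y a b) x :=
    fun α a b => pd_congr (by filter_upwards [hev] with y hy; exact congrFun (congrFun hy a) b) α
  have hi : ∀ a b, ginv (fun y => g y + ε • δg y) x a b = ginv g x a b := fun a b => by
    simp only [ginv, hev.eq_of_nhds]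
  simp only [leviCivitaDiff, leviCivita, hpd, hi, sub_self]

theorem smoothFam_leviCivitaDiff (hU : IsOpen U) (hg : IsLorentzMetricOn U g)
    (hδ : ContDiff ℝ ∞ δg) {x : Pt} (hx : x ∈ U) {ε : ℝ}
    (hd : (Matrix.of (g x + ε • δg x)).det < 0) (μ ν ρ : Fin 4) :
    SmoothFam (fun ε y => leviCivitaDiff g δg ε y μ ν ρ) (x, ε) :=
  (SmoothFam.leviCivita (p := (x, ε))
    (.affine (ContDiffOn.at_of_isOpen hg.smooth hU hx) hδ) hd μ ν ρ).sub
    (SmoothFam.const (p := (x, ε)) (contDiffAt_leviCivita hU hg hx μ ν ρ))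

theorem SmoothFam.ricciLin {Γ : Conn} {C : ℝ → Conn} {p : Pt × ℝ}
    (hΓ : ∀ μ ν ρ, ContDiffAt ℝ ∞ (fun y => Γ y μ ν ρ) p.1)
    (hC : ∀ μ ν ρ, SmoothFam (fun ε x => C ε x μ ν ρ) p) (ν σ : Fin 4) :
    SmoothFam (fun ε x => ricciLin Γ (C ε) x ν σ) p := by
  have h1 : ∀ μ ν ρ, SmoothFam (fun _ y => Γ y μ ν ρ) p := fun μ ν ρ => .const (hΓ μ ν ρ)
  have h2 : ∀ α μ ν ρ, SmoothFam (fun ε => VectorialNonmetricity.pd α (fun y => C ε y μ ν ρ)) p :=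
    fun α μ ν ρ => (hC μ ν ρ).pd α
  exact ContDiffAt.sum fun μ _ => ((ContDiffAt.sum fun l _ =>
    ((((hC _ _ _).mul (h1 _ _ _)).add ((h1 _ _ _).mul (hC _ _ _))).sub
      ((hC _ _ _).mul (h1 _ _ _))).sub ((h1 _ _ _).mul (hC _ _ _))).add
        (h2 _ _ _ _)).sub (h2 _ _ _ _)

theorem SmoothFam.ricciQuad {C : ℝ → Conn} {p : Pt × ℝ}
    (hC : ∀ μ ν ρ, SmoothFam (fun ε x => C ε x μ ν ρ) p) (ν σ : Fin 4) :
    SmoothFam (fun ε x => ricciQuad (C ε) x ν σ) p :=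
  ContDiffAt.sum fun _ _ => ContDiffAt.sum fun _ _ =>
    ((hC _ _ _).mul (hC _ _ _)).sub ((hC _ _ _).mul (hC _ _ _))

/-- The gravitational Lagrangian of the varied fields, modulo the divergence of a vector field
supported where the variation is. The last term is the divergence of the unvaried vector field; it
does not depend on `ε` but is not supported in the region. -/
def gravReduced (B₁ B₂ k : ℝ) (g δg : Pt → Tensor2) (π δπ : Pt → Fin 4 → ℝ) (ε : ℝ) (x : Pt) : ℝ :=
  (∑ ν, ∑ σ, sqrtNegDet (fun y => g y + ε • δg y) x * ginv (fun y => g y + ε • δg y) x ν σ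
      * ricci (leviCivita g) x ν σ)
  + (∑ ν, ∑ σ, (sqrtNegDet (fun y => g y + ε • δg y) x * ginv (fun y => g y + ε • δg y) x ν σ
      - sqrtNegDet g x * ginv g x ν σ)
      * ricciLin (leviCivita g) (leviCivitaDiff g δg ε) x ν σ)
  + (∑ ν, ∑ σ, sqrtNegDet (fun y => g y + ε • δg y) x * ginv (fun y => g y + ε • δg y) x ν σ
      * ricciQuad (leviCivitaDiff g δg ε) x ν σ)
  + sqrtNegDet (fun y => g y + ε • δg y) x
    * (B₁ * normSq (fun y => g y + ε • δg y) (fun y => π y + ε • δπ y) x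
      + B₂ / 2 * normSq (fun y => g y + ε • δg y) (fun y => π y + ε • δπ y) x ^ 2)
  + ∑ μ, pd μ (fun y => k * (sqrtNegDet g y * raise g π y μ)) x

/-- The vector field, supported where the variation is, whose divergence is dropped in
`gravReduced`. -/
def gravBoundary (k : ℝ) (g δg : Pt → Tensor2) (π δπ : Pt → Fin 4 → ℝ) (ε : ℝ) (x : Pt)
    (μ : Fin 4) : ℝ :=
  palatiniVec g (leviCivitaDiff g δg ε) x μ
    + k * (sqrtNegDet (fun y => g y + ε • δg y) x
      * raise (fun y => g y + ε • δg y) (fun y => π y + ε • δπ y) x μ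
      - sqrtNegDet g x * raise g π x μ)

theorem gravBoundary_eq_zero (k ε : ℝ) {x : Pt} (hx : x ∉ tsupport δg ∪ tsupport δπ) :
    gravBoundary k g δg π δπ ε x = 0 := by
  have h1 : δg x = 0 := image_eq_zero_of_notMem_tsupport fun h => hx (.inl h)
  have h2 : δπ x = 0 := image_eq_zero_of_notMem_tsupport fun h => hx (.inr h)
  funext μ
  simp [gravBoundary, palatiniVec, leviCivitaDiff_eq_zero fun h => hx (.inl h), sqrtNegDet, raise,
    ginv, h1, h2]

variable (hU : IsOpen U) (hg : IsLorentzMetricOn U g) (hπ : ContDiffOn ℝ ∞ π U)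
  (hδg : ContDiff ℝ ∞ δg) (hδπ : ContDiff ℝ ∞ δπ)
  {ε : ℝ} (hε : IsLorentzMetricOn U fun x => g x + ε • δg x) {x : Pt} (hx : x ∈ U)
include hU hg hπ hδg hδπ hε hx

theorem smoothFam_gravReduced (B₁ B₂ k : ℝ) :
    SmoothFam (gravReduced B₁ B₂ k g δg π δπ) (x, ε) := by
  have hgx := ContDiffOn.at_of_isOpen hg.smooth hU hx
  have hπx := ContDiffOn.at_of_isOpen hπ hU hx
  have hG : SmoothFam (fun ε x => g x + ε • δg x) (x, ε) := .affine hgx hδg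
  have hπε : SmoothFam (fun ε x => π x + ε • δπ x) (x, ε) := .affine hπx hδπ
  have hd := hε.det_neg x hx
  have h1 := hG.sqrtNegDet hd
  have h2 := hG.ginv hd
  have h3 := hG.normSq hd hπε
  have hC := smoothFam_leviCivitaDiff hU hg hδg hx hd
  have h4 := SmoothFam.ricciLin (contDiffAt_leviCivita hU hg hx) hC
  have h5 := SmoothFam.ricciQuad hC
  have h6 : ∀ ν σ, SmoothFam (fun _ y => ricci (leviCivita g) y ν σ) (x, ε) := fun ν σ =>
    .const (contDiffAt_ricci_leviCivita hU hg hx ν σ)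
  have h7 : SmoothFam (fun _ => sqrtNegDet g) (x, ε) := .const (contDiffAt_sqrtNegDet hU hg hx)
  have h8 : ∀ ν σ, SmoothFam (fun _ y => ginv g y ν σ) (x, ε) := fun ν σ =>
    .const (contDiffAt_ginv hU hg hx ν σ)
  have h9 : ∀ μ, SmoothFam (fun _ => pd μ (fun y => k * (sqrtNegDet g y * raise g π y μ))) (x, ε) :=
    fun μ => .const (contDiffAt_pd (contDiffAt_const.mul
      ((contDiffAt_sqrtNegDet hU hg hx).mul (contDiffAt_raise hU hg hx hπx μ))) μ)
  refine ((((ContDiffAt.sum fun ν _ => ContDiffAt.sum fun σ _ => (h1.mul (h2 _ _)).mul (h6 _ _)).add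
    (ContDiffAt.sum fun ν _ => ContDiffAt.sum fun σ _ =>
      ((h1.mul (h2 _ _)).sub (h7.mul (h8 _ _))).mul (h4 _ _))).add
    (ContDiffAt.sum fun ν _ => ContDiffAt.sum fun σ _ => (h1.mul (h2 _ _)).mul (h5 _ _))).add
    (h1.mul ((contDiffAt_const.mul h3).add (contDiffAt_const.mul (h3.pow 2))))).add
    (ContDiffAt.sum fun μ _ => h9 μ)

theorem contDiffAt_gravBoundary (k : ℝ) :
    ContDiffAt ℝ ∞ (gravBoundary k g δg π δπ ε) x := by
  have hgx := ContDiffOn.at_of_isOpen hg.smooth hU hx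
  have hπx := ContDiffOn.at_of_isOpen hπ hU hx
  have hπε : ContDiffAt ℝ ∞ (fun x => π x + ε • δπ x) x :=
    hπx.add (ContDiff.const_smul ε hδπ).contDiffAt
  have hC := fun μ ν ρ =>
    (smoothFam_leviCivitaDiff hU hg hδg hx (hε.det_neg x hx) μ ν ρ).at
  have h7 := contDiffAt_sqrtNegDet hU hg hx
  have h8 := contDiffAt_ginv hU hg hx
  refine contDiffAt_pi.2 fun μ => ?_
  refine ContDiffAt.add (ContDiffAt.sum fun ν _ => ContDiffAt.sum fun σ _ =>
    ((h7.mul (h8 _ _)).mul (hC _ _ _)).sub ((h7.mul (h8 _ _)).mul (hC _ _ _))) ?_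
  exact contDiffAt_const.mul (((contDiffAt_sqrtNegDet hU hε hx).mul
    (contDiffAt_raise hU hε hx hπε μ)).sub (h7.mul (contDiffAt_raise hU hg hx hπx μ)))

/-- The gravitational Lagrangian of the varied fields is `gravReduced` plus a divergence. -/
theorem gravLagrangian_eq_reduced (c₁ c₂ c₃ ξ : ℝ) :
    sqrtNegDet (fun y => g y + ε • δg y) x
      * (scalarCurv (fun y => g y + ε • δg y) (vnConn c₁ c₂ c₃ (fun y => g y + ε • δg y)
          (fun y => π y + ε • δπ y)) x
        + ξ * divVec (vnConn c₁ c₂ c₃ (fun y => g y + ε • δg y) (fun y => π y + ε • δπ y))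
          (raise (fun y => g y + ε • δg y) (fun y => π y + ε • δπ y)) x)
      = gravReduced (b₁ c₁ c₂ ξ) (b₂ c₂ c₃ ξ) (3 * (c₂ - c₁) + ξ) g δg π δπ ε x
        + ∑ μ, pd μ (fun y => gravBoundary (3 * (c₂ - c₁) + ξ) g δg π δπ ε y μ) x := by
  have hπε : ContDiffOn ℝ ∞ (fun x => π x + ε • δπ x) U :=
    hπ.add (ContDiff.const_smul ε hδπ).contDiffOn
  have hπx := ContDiffOn.at_of_isOpen hπ hU hx
  have hπεx := ContDiffOn.at_of_isOpen hπε hU hx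
  rw [gravLagrangian_eq hU hε hx c₁ c₂ c₃ ξ hπε]
  have hCd := fun μ ν ρ => ((smoothFam_leviCivitaDiff hU hg hδg hx (hε.det_neg x hx) μ ν
    ρ).at).differentiableAt (by simp)
  have hΓd := fun μ ν ρ => (contDiffAt_leviCivita hU hg hx μ ν ρ).differentiableAt (by simp)
  have hsum : leviCivita (fun y => g y + ε • δg y) = fun y μ ν ρ =>
      leviCivita g y μ ν ρ + leviCivitaDiff g δg ε y μ ν ρ := by
    funext y μ ν ρ; simp [leviCivitaDiff]
  have hric : ∀ ν σ, ricci (leviCivita (fun y => g y + ε • δg y)) x ν σ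
      = ricci (leviCivita g) x ν σ + ricciLin (leviCivita g) (leviCivitaDiff g δg ε) x ν σ
        + ricciQuad (leviCivitaDiff g δg ε) x ν σ := fun ν σ => by
    rw [hsum]; exact ricci_add _ _ hΓd hCd ν σ
  have hlin := sum_ricciLin_eq_div hU hg hx hCd
  have hdiff : ∀ {y : Pt → ℝ}, ContDiffAt ℝ ∞ y x → DifferentiableAt ℝ y x := fun h =>
    h.differentiableAt (by simp)
  have hu := fun μ => hdiff ((contDiffAt_sqrtNegDet hU hg hx).mul
    (contDiffAt_raise hU hg hx hπx μ))
  have hu' := fun μ => hdiff ((contDiffAt_sqrtNegDet hU hε hx).mul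
    (contDiffAt_raise hU hε hx hπεx μ))
  have hpal : ∀ μ, DifferentiableAt ℝ (fun y => palatiniVec g (leviCivitaDiff g δg ε) y μ) x := by
    intro μ
    have h7 := hdiff (contDiffAt_sqrtNegDet hU hg hx)
    have h8 := fun ν σ => hdiff (contDiffAt_ginv hU hg hx ν σ)
    exact DifferentiableAt.fun_sum fun ν _ => DifferentiableAt.fun_sum fun σ _ =>
      ((h7.mul (h8 _ _)).mul (hCd _ _ _)).sub ((h7.mul (h8 _ _)).mul (hCd _ _ _))
  have hb : ∀ μ, pd μ (fun y => gravBoundary (3 * (c₂ - c₁) + ξ) g δg π δπ ε y μ) x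
      = pd μ (fun y => palatiniVec g (leviCivitaDiff g δg ε) y μ) x
        + (pd μ (fun y => (3 * (c₂ - c₁) + ξ) * (sqrtNegDet (fun y => g y + ε • δg y) y
            * raise (fun y => g y + ε • δg y) (fun y => π y + ε • δπ y) y μ)) x
          - pd μ (fun y => (3 * (c₂ - c₁) + ξ) * (sqrtNegDet g y * raise g π y μ)) x) := by
    intro μ
    simp only [gravBoundary]
    rw [pd_add (hpal μ) (((hu' μ).fun_sub (hu μ)).const_mul _),
      pd_const_mul _ ((hu' μ).fun_sub (hu μ)), pd_const_mul _ (hu μ), pd_const_mul _ (hu' μ),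
      pd_sub (hu' μ) (hu μ)]
    ring
  simp only [hb, Finset.sum_add_distrib, Finset.sum_sub_distrib, gravReduced, ← hlin, scalarCurv,
    hric, sub_mul, mul_add, Finset.mul_sum, mul_assoc]
  ring

end

section

variable {U : Set Pt} {g δg : Pt → Tensor2} {π δπ : Pt → Fin 4 → ℝ}

theorem hasDerivAt_sqrtNegDet_variation {x : Pt} (hd : (Matrix.of (g x)).det < 0) :
    HasDerivAt (fun ε : ℝ => sqrtNegDet (fun y => g y + ε • δg y) x)
      (sqrtNegDet g x * ((1 / 2) * ∑ μ, ∑ ν, ginv g x ν μ * δg x μ ν)) 0 := by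
  have h := hasDerivAt_sqrt_neg_det (hasDerivAt_affine (g x) (δg x) 0) (by simpa using hd)
  simp only [zero_smul, add_zero] at h
  exact h

theorem hasDerivAt_ginv_variation {x : Pt} (hd : (Matrix.of (g x)).det ≠ 0) (μ ν : Fin 4) :
    HasDerivAt (fun ε : ℝ => ginv (fun y => g y + ε • δg y) x μ ν)
      (-∑ α, ∑ β, ginv g x μ α * δg x α β * ginv g x β ν) 0 := by
  have h := hasDerivAt_inv_entry (hasDerivAt_affine (g x) (δg x) 0) (by simpa using hd) μ ν
  simp only [zero_smul, add_zero] at h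
  exact h

theorem hasDerivAt_normSq_variation {x : Pt} (hs : ∀ μ ν, g x μ ν = g x ν μ)
    (hd : (Matrix.of (g x)).det ≠ 0) :
    HasDerivAt (fun ε : ℝ => normSq (fun y => g y + ε • δg y) (fun y => π y + ε • δπ y) x)
      (-(∑ α, ∑ β, raise g π x α * raise g π x β * δg x α β)
        + 2 * ∑ α, raise g π x α * δπ x α) 0 := by
  have h1 : ∀ μ, HasDerivAt (fun ε : ℝ => π x μ + ε * δπ x μ) (δπ x μ) 0 := fun μ =>
    hasDerivAt_affine (π x μ) (δπ x μ) 0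
  have h2 : HasDerivAt (fun ε : ℝ => ∑ μ, (π x μ + ε * δπ x μ)
      * ∑ ν, ginv (fun y => g y + ε • δg y) x μ ν * (π x ν + ε * δπ x ν)) _ 0 :=
    HasDerivAt.fun_sum fun μ _ => (h1 μ).mul (HasDerivAt.fun_sum fun ν _ =>
      (hasDerivAt_ginv_variation (δg := δg) hd μ ν).mul (h1 ν))
  refine h2.congr_deriv ?_
  simp only [zero_smul, add_zero, zero_mul, Finset.sum_add_distrib]
  have e1 : ∑ μ, δπ x μ * ∑ ν, ginv g x μ ν * π x ν = ∑ α, raise g π x α * δπ x α :=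
    Finset.sum_congr rfl fun μ _ => by rw [raise]; ring
  have e2 : ∑ μ, π x μ * ∑ ν, ginv g x μ ν * δπ x ν = ∑ α, raise g π x α * δπ x α := by
    simp only [raise, Finset.mul_sum, Finset.sum_mul]
    rw [Finset.sum_comm]
    refine Finset.sum_congr rfl fun ν _ => Finset.sum_congr rfl fun μ _ => ?_
    rw [ginv_symm hs μ ν]; ring
  have e3 : ∑ μ, π x μ * ∑ ν, -(∑ α, ∑ β, ginv g x μ α * δg x α β * ginv g x β ν) * π x ν
      = -∑ α, ∑ β, raise g π x α * raise g π x β * δg x α β := by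
    simp only [raise, Finset.mul_sum, Finset.sum_mul, ← Finset.sum_neg_distrib]
    have : ∀ μ ν α β, π x μ * (-(ginv g x μ α * δg x α β * ginv g x β ν) * π x ν)
        = -(ginv g x α μ * π x μ * (ginv g x β ν * π x ν) * δg x α β) := fun μ ν α β => by
      rw [ginv_symm hs μ α]; ring
    simp only [neg_mul, mul_neg] at this ⊢
    refine sum4_reindex ⟨fun p => (p.2.2.1, p.2.2.2, p.2.1, p.1),
      fun q => (q.2.2.2, q.2.2.1, q.1, q.2.1), fun _ => rfl, fun _ => rfl⟩ fun p => ?_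
    simp only [Equiv.coe_fn_mk]
    rw [this]
  simp only [mul_add, Finset.sum_add_distrib]
  rw [e1, e2, e3]
  ring

/-- The coefficient of `½ √(-g) δg_{αβ} / κ` in the first variation of the gravitational action. -/
def gravEL (B₁ B₂ : ℝ) (g : Pt → Tensor2) (π : Pt → Fin 4 → ℝ) (x : Pt) (α β : Fin 4) : ℝ :=
  -einsteinUp g x α β - raise g π x α * raise g π x β * (B₁ + B₂ * normSq g π x)
    + (1 / 2) * ginv g x α β * (B₁ * normSq g π x + B₂ / 2 * normSq g π x ^ 2)

theorem hasDerivAt_gravReduced (hU : IsOpen U) (hg : IsLorentzMetricOn U g)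
    (hδg : ContDiff ℝ ∞ δg) {x : Pt} (hx : x ∈ U) (B₁ B₂ k : ℝ) :
    HasDerivAt (fun ε => gravReduced B₁ B₂ k g δg π δπ ε x)
      (sqrtNegDet g x * ((∑ α, ∑ β, gravEL B₁ B₂ g π x α β * δg x α β)
        + 2 * (B₁ + B₂ * normSq g π x) * ∑ α, raise g π x α * δπ x α)) 0 := by
  have hd := hg.det_neg x hx
  have hs := hg.symm x hx
  have h1 := hasDerivAt_sqrtNegDet_variation (δg := δg) hd
  have h2 := hasDerivAt_ginv_variation (δg := δg) hd.ne
  have h3 := hasDerivAt_normSq_variation (δg := δg) (π := π) (δπ := δπ) hs hd.ne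
  have h0 : (fun y => g y + (0 : ℝ) • δg y) = g := by funext y; simp
  have h0π : (fun y => π y + (0 : ℝ) • δπ y) = π := by funext y; simp
  have hC : ∀ μ ν ρ, SmoothFam (fun ε y => leviCivitaDiff g δg ε y μ ν ρ) (x, 0) :=
    smoothFam_leviCivitaDiff hU hg hδg hx (by simpa using hd)
  have hC' : ∀ μ ν ρ, DifferentiableAt ℝ (fun ε => leviCivitaDiff g δg ε x μ ν ρ) 0 :=
    fun μ ν ρ => (hC μ ν ρ).differentiableAt_param
  have hlin : ∀ ν σ, DifferentiableAt ℝ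
      (fun ε => ricciLin (leviCivita g) (leviCivitaDiff g δg ε) x ν σ) 0 := fun ν σ =>
    (SmoothFam.ricciLin (contDiffAt_leviCivita hU hg hx) hC ν σ).differentiableAt_param
  have hh : ∀ ν σ, HasDerivAt (fun ε : ℝ => sqrtNegDet (fun y => g y + ε • δg y) x
      * ginv (fun y => g y + ε • δg y) x ν σ)
      (sqrtNegDet g x * ((1 / 2) * ∑ μ, ∑ ν, ginv g x ν μ * δg x μ ν) * ginv g x ν σ
        + sqrtNegDet g x * -∑ α, ∑ β, ginv g x ν α * δg x α β * ginv g x β σ) 0 := fun ν σ => by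
    have := HasDerivAt.fun_mul h1 (h2 ν σ)
    simpa only [h0] using this
  -- both remainder terms are products of two factors that vanish for the unvaried metric
  have t2 : ∀ ν σ, HasDerivAt (fun ε : ℝ => (sqrtNegDet (fun y => g y + ε • δg y) x
      * ginv (fun y => g y + ε • δg y) x ν σ - sqrtNegDet g x * ginv g x ν σ)
      * ricciLin (leviCivita g) (leviCivitaDiff g δg ε) x ν σ) 0 0 := fun ν σ =>
    hasDerivAt_mul_of_eq_zero ((hh ν σ).differentiableAt.sub_const _) (hlin ν σ)
      (by simp only [h0, sub_self]) (ricciLin_zero _ _ leviCivitaDiff_zero x ν σ)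
  have tq : ∀ ν σ, HasDerivAt (fun ε : ℝ => ricciQuad (leviCivitaDiff g δg ε) x ν σ) 0 0 := by
    intro ν σ
    have hz := fun a b c => leviCivitaDiff_zero (g := g) (δg := δg) x a b c
    have : HasDerivAt (fun ε : ℝ => ricciQuad (leviCivitaDiff g δg ε) x ν σ)
        (∑ _μ : Fin 4, ∑ _l : Fin 4, (0 - 0 : ℝ)) 0 :=
      HasDerivAt.fun_sum fun μ _ => HasDerivAt.fun_sum fun l _ =>
        (hasDerivAt_mul_of_eq_zero (hC' _ _ _) (hC' _ _ _) (hz _ _ _) (hz _ _ _)).sub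
          (hasDerivAt_mul_of_eq_zero (hC' _ _ _) (hC' _ _ _) (hz _ _ _) (hz _ _ _))
    simpa using this
  have t3 : ∀ ν σ, HasDerivAt (fun ε : ℝ => sqrtNegDet (fun y => g y + ε • δg y) x
      * ginv (fun y => g y + ε • δg y) x ν σ * ricciQuad (leviCivitaDiff g δg ε) x ν σ) 0 0 := by
    intro ν σ
    have hz : ricciQuad (leviCivitaDiff g δg 0) x ν σ = 0 := by
      simp [ricciQuad, leviCivitaDiff_zero]
    have := HasDerivAt.fun_mul (hh ν σ) (tq ν σ)
    simpa only [hz, mul_zero, add_zero] using this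
  have t1 := HasDerivAt.fun_sum (u := Finset.univ) fun ν _ => HasDerivAt.fun_sum
    (u := Finset.univ) fun σ _ => (hh ν σ).mul_const (ricci (leviCivita g) x ν σ)
  have t4 := h1.fun_mul ((h3.const_mul B₁).fun_add ((h3.fun_pow 2).const_mul (B₂ / 2)))
  have key := ((((t1.fun_add (HasDerivAt.fun_sum (u := Finset.univ) fun ν _ => HasDerivAt.fun_sum
    (u := Finset.univ) fun σ _ => t2 ν σ)).fun_add (HasDerivAt.fun_sum (u := Finset.univ) fun ν _ =>
    HasDerivAt.fun_sum (u := Finset.univ) fun σ _ => t3 ν σ)).fun_add t4).add_const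
      (∑ μ, pd μ (fun y => k * (sqrtNegDet g y * raise g π y μ)) x))
  refine (key : HasDerivAt (fun ε => gravReduced B₁ B₂ k g δg π δπ ε x) _ 0).congr_deriv ?_
  simp only [h0, h0π, Finset.sum_const_zero, add_zero]
  set s := sqrtNegDet g x
  set P := normSq g π x
  set tr := ∑ μ, ∑ ν, ginv g x ν μ * δg x μ ν with htr
  set uu := ∑ α, ∑ β, raise g π x α * raise g π x β * δg x α β with huu
  set v := ∑ α, raise g π x α * δπ x α
  set R := scalarCurv g (leviCivita g) x with hR
  set Q := ∑ α, ∑ β, (∑ μ, ∑ ν, ginv g x α μ * ginv g x β ν * ricci (leviCivita g) x μ ν)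
    * δg x α β with hQ
  have a1 : ∑ ν, ∑ σ, (s * (1 / 2 * tr) * ginv g x ν σ
      + s * -∑ α, ∑ β, ginv g x ν α * δg x α β * ginv g x β σ) * ricci (leviCivita g) x ν σ
      = s * (1 / 2 * tr) * R - s * Q := by
    have b1 : ∑ ν, ∑ σ, s * (1 / 2 * tr) * ginv g x ν σ * ricci (leviCivita g) x ν σ
        = s * (1 / 2 * tr) * R := by
      simp only [hR, scalarCurv, Finset.mul_sum, mul_assoc]
    have b2 : ∑ ν, ∑ σ, s * (-∑ α, ∑ β, ginv g x ν α * δg x α β * ginv g x β σ)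
        * ricci (leviCivita g) x ν σ = -(s * Q) := by
      simp only [hQ, Finset.mul_sum, Finset.sum_mul, neg_mul, mul_neg, ← Finset.sum_neg_distrib]
      refine sum4_reindex ⟨fun p => (p.2.2.1, p.2.2.2, p.1, p.2.1),
        fun q => (q.2.2.1, q.2.2.2, q.1, q.2.1), fun _ => rfl, fun _ => rfl⟩ fun p => ?_
      simp only [Equiv.coe_fn_mk]
      rw [ginv_symm hs p.1 p.2.2.1]
      ring
    simp only [add_mul, Finset.sum_add_distrib]
    rw [b1, b2]
    ring
  have a2 : ∑ α, ∑ β, gravEL B₁ B₂ g π x α β * δg x α β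
      = -Q + (1 / 2) * R * tr - (B₁ + B₂ * P) * uu + (1 / 2) * (B₁ * P + B₂ / 2 * P ^ 2) * tr := by
    have e : ∀ α β, gravEL B₁ B₂ g π x α β * δg x α β
        = -((∑ μ, ∑ ν, ginv g x α μ * ginv g x β ν * ricci (leviCivita g) x μ ν) * δg x α β)
          + (1 / 2) * R * (ginv g x β α * δg x α β)
          - (B₁ + B₂ * P) * (raise g π x α * raise g π x β * δg x α β)
          + (1 / 2) * (B₁ * P + B₂ / 2 * P ^ 2) * (ginv g x β α * δg x α β) := by
      intro α β
      rw [gravEL, einsteinUp_eq hs hd.ne, ginv_symm hs α β]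
      ring
    simp only [e, Finset.sum_add_distrib, Finset.sum_sub_distrib, Finset.sum_neg_distrib,
      ← Finset.mul_sum]
    rw [hQ, huu, htr]
  rw [a1, a2]
  push_cast
  ring

/-- The first variation of the gravitational action. -/
theorem hasDerivAt_gravAction (hU : IsOpen U) (hg : IsLorentzMetricOn U g)
    (hπ : ContDiffOn ℝ ∞ π U) (c₁ c₂ c₃ ξ κ : ℝ) {K : Set Pt} (hK : IsCompact K) (hKU : K ⊆ U)
    (hδg : IsVariation K δg) (hδs : ∀ x μ ν, δg x μ ν = δg x ν μ) (hδπ : IsVariation K δπ) :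
    ContinuousOn (fun x => sqrtNegDet g x
      * ((∑ α, ∑ β, gravEL (b₁ c₁ c₂ ξ) (b₂ c₂ c₃ ξ) g π x α β * δg x α β)
        + 2 * (b₁ c₁ c₂ ξ + b₂ c₂ c₃ ξ * normSq g π x) * ∑ α, raise g π x α * δπ x α)) K ∧
    HasDerivAt (fun ε : ℝ => gravAction c₁ c₂ c₃ ξ κ K (fun x => g x + ε • δg x)
        (fun x => π x + ε • δπ x))
      ((1 / (2 * κ)) * ∫ x in K, sqrtNegDet g x
        * ((∑ α, ∑ β, gravEL (b₁ c₁ c₂ ξ) (b₂ c₂ c₃ ξ) g π x α β * δg x α β)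
          + 2 * (b₁ c₁ c₂ ξ + b₂ c₂ c₃ ξ * normSq g π x) * ∑ α, raise g π x α * δπ x α)) 0 := by
  have hev := eventually_isLorentzMetricOn hU hg hK hKU hδg hδs
  have key := hasDerivAt_action hK ((isClosed_tsupport δg).union (isClosed_tsupport δπ))
    (Set.union_subset hδg.2 hδπ.2)
    (f := gravReduced (b₁ c₁ c₂ ξ) (b₂ c₂ c₃ ξ) (3 * (c₂ - c₁) + ξ) g δg π δπ)
    (Y := gravBoundary (3 * (c₂ - c₁) + ξ) g δg π δπ) (Z := fun _ => 0)
    (hev.mono fun ε hε x hx => gravLagrangian_eq_reduced hU hg hπ hδg.1 hδπ.1 hε (hKU hx)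
      c₁ c₂ c₃ ξ)
    (hev.mono fun ε hε x hx => smoothFam_gravReduced hU hg hπ hδg.1 hδπ.1 hε (hKU hx) _ _ _)
    (hev.mono fun ε hε x hx => contDiffAt_gravBoundary hU hg hπ hδg.1 hδπ.1 hε (hKU hx) _)
    (fun ε x hx => gravBoundary_eq_zero _ ε hx) (fun _ _ => contDiffAt_const) (fun _ _ => rfl)
    (fun x hx => by
      simpa [pd] using hasDerivAt_gravReduced (π := π) (δπ := δπ) hU hg hδg.1 (hKU hx)
        (b₁ c₁ c₂ ξ) (b₂ c₂ c₃ ξ) (3 * (c₂ - c₁) + ξ))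
  exact ⟨key.1, key.2.const_mul _⟩

end

/-! ### The first variation of the matter action -/

section Matter

variable {E : Type*} [NormedAddCommGroup E] [NormedSpace ℝ E] {U : Set Pt} {L : Jet E → ℝ}
  {ψ : Pt → E} {g δg : Pt → Tensor2}

theorem symUnit_comm (μ ν : Fin 4) : symUnit μ ν = symUnit ν μ := by
  funext a b
  simp only [symUnit]
  ring

/-- The matrices `symUnit μ ν`, although linearly dependent, resolve every symmetric matrix. -/
theorem eq_sum_symUnit {A : Tensor2} (hA : ∀ μ ν, A μ ν = A ν μ) :
    A = ∑ μ, ∑ ν, A μ ν • symUnit μ ν := by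
  funext a b
  simp only [Finset.sum_apply, Pi.smul_apply, smul_eq_mul, symUnit]
  have e : ∀ μ ν, A μ ν * (1 / 2 * ((if a = μ ∧ b = ν then 1 else 0)
      + if a = ν ∧ b = μ then 1 else 0))
      = (if b = ν then if a = μ then 1 / 2 * A μ ν else 0 else 0)
        + (if a = ν then if b = μ then 1 / 2 * A μ ν else 0 else 0) := by
    intro μ ν
    split_ifs <;> first | ring1 | (exfalso; tauto)
  simp only [e, Finset.sum_add_distrib, Finset.sum_ite_eq, Finset.mem_univ, if_true]
  rw [hA b a]
  ring

theorem stressUp_symm (L : Jet E → ℝ) (g : Pt → Tensor2) (ψ : Pt → E) (x : Pt) (μ ν : Fin 4) :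
    stressUp L g ψ x μ ν = stressUp L g ψ x ν μ := by
  simp only [stressUp, dLdg, dLddg, symUnit_comm μ ν]

theorem SmoothFam.jet {G : ℝ → Pt → Tensor2} {p : Pt × ℝ} (hG : SmoothFam G p)
    (hψ : ContDiffAt ℝ ∞ ψ p.1) : SmoothFam (fun ε => jet (G ε) ψ) p := by
  have h1 : SmoothFam (fun ε x => (fun α μ ν => VectorialNonmetricity.pd α (fun y => G ε y μ ν) x :
      Fin 4 → Tensor2)) p :=
    contDiffAt_pi.2 fun α => contDiffAt_pi.2 fun μ => contDiffAt_pi.2 fun ν =>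
      SmoothFam.pd (f := fun ε y => G ε y μ ν) (contDiffAt_pi.1 (contDiffAt_pi.1 hG μ) ν) α
  have h2 : SmoothFam (fun _ => ψ) p := .const hψ
  have h3 : SmoothFam (fun _ x => (fun α => VectorialNonmetricity.pd α ψ x : Fin 4 → E)) p :=
    contDiffAt_pi.2 fun α => h2.pd α
  exact contDiffAt_fst.prodMk (hG.prodMk (h1.prodMk (h2.prodMk h3)))

variable (hL : IsMatterLagrangianOn U L) (hU : IsOpen U) (hψ : ContDiffOn ℝ ∞ ψ U)
  (hg : IsLorentzMetricOn U g) {x : Pt} (hx : x ∈ U)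
include hL hU hψ hg hx

omit hψ hU in
theorem contDiffAt_lagrangian_jet : ContDiffAt ℝ ∞ L (jet g ψ x) :=
  hL x hx (g x) (hg.symm x hx) (hg.det_neg x hx) _ _ _

theorem contDiffAt_fderiv_jet (v : Jet E) :
    ContDiffAt ℝ ∞ (fun y => fderiv ℝ L (jet g ψ y) v) x := by
  have hj : ContDiffAt ℝ ∞ (jet g ψ) x := (SmoothFam.jet (p := (x, 0)) (G := fun _ => g)
    (.const (ContDiffOn.at_of_isOpen hg.smooth hU hx)) (ContDiffOn.at_of_isOpen hψ hU hx)).at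
  have h1 : ContDiffAt ℝ ∞ (fderiv ℝ L) (jet g ψ x) :=
    (contDiffAt_lagrangian_jet hL hg hx).fderiv_right (by simp)
  exact (h1.comp x hj).clm_apply contDiffAt_const

theorem contDiffAt_dLdg (μ ν : Fin 4) : ContDiffAt ℝ ∞ (fun y => dLdg L g ψ y μ ν) x :=
  contDiffAt_fderiv_jet hL hU hψ hg hx _

theorem contDiffAt_dLddg (α μ ν : Fin 4) : ContDiffAt ℝ ∞ (fun y => dLddg L g ψ y α μ ν) x :=
  contDiffAt_fderiv_jet hL hU hψ hg hx _

theorem contDiffAt_stressUp (μ ν : Fin 4) :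
    ContDiffAt ℝ ∞ (fun y => stressUp L g ψ y μ ν) x :=
  (contDiffAt_const.div (contDiffAt_sqrtNegDet hU hg hx)
    (sqrtNegDet_pos (hg.det_neg x hx)).ne').mul ((contDiffAt_dLdg hL hU hψ hg hx μ ν).sub
      (ContDiffAt.sum fun α _ => contDiffAt_pd (contDiffAt_dLddg hL hU hψ hg hx α μ ν) α))

omit hψ in
/-- The chain rule along a variation of the metric. -/
theorem hasDerivAt_lagrangian_jet (hδg : ContDiff ℝ ∞ δg) (hδs : ∀ x μ ν, δg x μ ν = δg x ν μ) :
    HasDerivAt (fun ε : ℝ => L (jet (fun y => g y + ε • δg y) ψ x))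
      ((∑ μ, ∑ ν, dLdg L g ψ x μ ν * δg x μ ν)
        + ∑ α, ∑ μ, ∑ ν, dLddg L g ψ x α μ ν * pd α (fun y => δg y μ ν) x) 0 := by
  set V : Jet E := (0, δg x, fun α μ ν => pd α (fun y => δg y μ ν) x, 0, 0) with hV
  have hgd : ∀ μ ν, DifferentiableAt ℝ (fun y => g y μ ν) x := fun μ ν =>
    (hg.entry hU hx μ ν).differentiableAt (by simp)
  have hδc : ∀ μ ν, ContDiff ℝ ∞ (fun y => δg y μ ν) := fun μ ν =>
    contDiff_pi.1 (contDiff_pi.1 hδg μ) ν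
  have hδd : ∀ μ ν, DifferentiableAt ℝ (fun y => δg y μ ν) x := fun μ ν =>
    (hδc μ ν).contDiffAt.differentiableAt (by simp)
  have hjet : ∀ ε : ℝ, jet (fun y => g y + ε • δg y) ψ x = jet g ψ x + ε • V := by
    intro ε
    have : ∀ α μ ν, pd α (fun y => (g y + ε • δg y) μ ν) x
        = pd α (fun y => g y μ ν) x + ε * pd α (fun y => δg y μ ν) x := fun α μ ν => by
      simp only [Pi.add_apply, Pi.smul_apply, smul_eq_mul]
      rw [pd_add (hgd μ ν) ((hδd μ ν).const_mul ε), pd_const_mul ε (hδd μ ν)]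
    simp only [jet, this]
    simp only [hV, Prod.smul_mk, Prod.mk_add_mk, smul_zero, add_zero]
    rfl
  simp only [hjet]
  have hd := ((contDiffAt_lagrangian_jet (ψ := ψ) hL hg hx).differentiableAt (by simp)).hasFDerivAt
  have h1 := HasFDerivAt.comp_hasDerivAt (f := fun ε : ℝ => jet g ψ x + ε • V) (0 : ℝ)
    (by simpa using hd) (hasDerivAt_affine (jet g ψ x) V 0)
  refine h1.congr_deriv ?_
  have hsplit : V = (∑ μ, ∑ ν, δg x μ ν • ((0, symUnit μ ν, 0, 0, 0) : Jet E))
      + ∑ α, ∑ μ, ∑ ν, pd α (fun y => δg y μ ν) x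
          • ((0, 0, Pi.single α (symUnit μ ν), 0, 0) : Jet E) := by
    have e1 : ((0, δg x, 0, 0, 0) : Jet E)
        = ∑ μ, ∑ ν, δg x μ ν • ((0, symUnit μ ν, 0, 0, 0) : Jet E) := by
      let i : Tensor2 →ₗ[ℝ] Jet E := LinearMap.inr ℝ Pt _ ∘ₗ LinearMap.inl ℝ Tensor2 _
      have := congrArg i (eq_sum_symUnit (hδs x))
      simp only [map_sum, map_smul] at this
      exact this
    have e2 : ((0, 0, fun α μ ν => pd α (fun y => δg y μ ν) x, 0, 0) : Jet E)
        = ∑ α, ∑ μ, ∑ ν, pd α (fun y => δg y μ ν) x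
          • ((0, 0, Pi.single α (symUnit μ ν), 0, 0) : Jet E) := by
      let i : (Fin 4 → Tensor2) →ₗ[ℝ] Jet E := LinearMap.inr ℝ Pt _ ∘ₗ LinearMap.inr ℝ Tensor2 _
        ∘ₗ LinearMap.inl ℝ (Fin 4 → Tensor2) _
      have e3 : (fun α μ ν => pd α (fun y => δg y μ ν) x : Fin 4 → Tensor2)
          = ∑ α, ∑ μ, ∑ ν, pd α (fun y => δg y μ ν) x
            • (Pi.single α (symUnit μ ν) : Fin 4 → Tensor2) := by
        rw [← Finset.univ_sum_single (fun α μ ν => pd α (fun y => δg y μ ν) x : Fin 4 → Tensor2)]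
        refine Finset.sum_congr rfl fun α _ => ?_
        have hs : ∀ μ ν, pd α (fun y => δg y μ ν) x = pd α (fun y => δg y ν μ) x :=
          fun μ ν => by simp only [hδs _ μ ν]
        have := congrArg (LinearMap.single ℝ (fun _ : Fin 4 => Tensor2) α) (eq_sum_symUnit hs)
        simp only [map_sum, map_smul] at this
        exact this
      have := congrArg i e3
      simp only [map_sum, map_smul] at this
      exact this
    rw [← e1, ← e2, hV]
    simp
  rw [hsplit, map_add]
  simp only [map_sum, map_smul, smul_eq_mul, dLdg, dLddg]
  congr 1
  · exact Finset.sum_congr rfl fun μ _ => Finset.sum_congr rfl fun ν _ => mul_comm _ _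
  · exact Finset.sum_congr rfl fun α _ => Finset.sum_congr rfl fun μ _ =>
      Finset.sum_congr rfl fun ν _ => mul_comm _ _

omit hx in
/-- The stress tensor is the response of the matter action to the metric. -/
theorem hasDerivAt_matterAction {K : Set Pt} (hK : IsCompact K) (hKU : K ⊆ U)
    (hδg : IsVariation K δg) (hδs : ∀ x μ ν, δg x μ ν = δg x ν μ) :
    ContinuousOn (fun x => (1 / 2) * (sqrtNegDet g x
      * ∑ μ, ∑ ν, stressUp L g ψ x μ ν * δg x μ ν)) K ∧
    HasDerivAt (fun ε : ℝ => matterAction L K (fun x => g x + ε • δg x) ψ)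
      (∫ x in K, (1 / 2) * (sqrtNegDet g x
        * ∑ μ, ∑ ν, stressUp L g ψ x μ ν * δg x μ ν)) 0 := by
  have hev := eventually_isLorentzMetricOn hU hg hK hKU hδg hδs
  have hδc : ∀ μ ν, ContDiff ℝ ∞ (fun y => δg y μ ν) := fun μ ν =>
    contDiff_pi.1 (contDiff_pi.1 hδg.1 μ) ν
  refine hasDerivAt_action hK (isClosed_tsupport δg) hδg.2
    (f := fun ε x => L (jet (fun y => g y + ε • δg y) ψ x)) (Y := fun _ _ => 0)
    (Z := fun x α => ∑ μ, ∑ ν, dLddg L g ψ x α μ ν * δg x μ ν)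
    (.of_forall fun ε x _ => by simp [pd]) (hev.mono fun ε hε x hx => ?_)
    (.of_forall fun _ _ _ => contDiffAt_const) (fun _ _ _ => rfl) (fun x hx => ?_) (fun x hx => ?_)
    (fun x hx => ?_)
  · exact ContDiffAt.comp (g := L) (x, ε) (contDiffAt_lagrangian_jet hL hε (hKU hx))
      (SmoothFam.jet (p := (x, ε)) (.affine (ContDiffOn.at_of_isOpen hg.smooth hU (hKU hx)) hδg.1)
        (ContDiffOn.at_of_isOpen hψ hU (hKU hx)))
  · exact contDiffAt_pi.2 fun α => ContDiffAt.sum fun μ _ => ContDiffAt.sum fun ν _ =>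
      (contDiffAt_dLddg hL hU hψ hg (hKU hx) α μ ν).mul (hδc μ ν).contDiffAt
  · funext α
    simp [image_eq_zero_of_notMem_tsupport hx]
  · refine (hasDerivAt_lagrangian_jet hL hU hg (hKU hx) hδg.1 hδs).congr_deriv ?_
    have hdd : ∀ α μ ν, DifferentiableAt ℝ (fun y => dLddg L g ψ y α μ ν) x := fun α μ ν =>
      (contDiffAt_dLddg hL hU hψ hg (hKU hx) α μ ν).differentiableAt (by simp)
    have hδd : ∀ μ ν, DifferentiableAt ℝ (fun y => δg y μ ν) x := fun μ ν =>
      (hδc μ ν).contDiffAt.differentiableAt (by simp)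
    have hs := (sqrtNegDet_pos (hg.det_neg x (hKU hx))).ne'
    have e1 : ∀ α, pd α (fun y => ∑ μ, ∑ ν, dLddg L g ψ y α μ ν * δg y μ ν) x
        = ∑ μ, ∑ ν, (pd α (fun y => dLddg L g ψ y α μ ν) x * δg x μ ν
          + dLddg L g ψ x α μ ν * pd α (fun y => δg y μ ν) x) := by
      intro α
      rw [pd_sum _ fun μ _ => DifferentiableAt.fun_sum fun ν _ => (hdd α μ ν).fun_mul (hδd μ ν)]
      refine Finset.sum_congr rfl fun μ _ => ?_
      rw [pd_sum _ fun ν _ => (hdd α μ ν).fun_mul (hδd μ ν)]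
      exact Finset.sum_congr rfl fun ν _ => pd_mul (hdd α μ ν) (hδd μ ν) α
    have e2 : (1 / 2) * (sqrtNegDet g x * ∑ μ, ∑ ν, stressUp L g ψ x μ ν * δg x μ ν)
        = ∑ μ, ∑ ν, dLdg L g ψ x μ ν * δg x μ ν
          - ∑ α, ∑ μ, ∑ ν, pd α (fun y => dLddg L g ψ y α μ ν) x * δg x μ ν := by
      have e3 : ∑ α, ∑ μ, ∑ ν, pd α (fun y => dLddg L g ψ y α μ ν) x * δg x μ ν
          = ∑ μ, ∑ ν, ∑ α, pd α (fun y => dLddg L g ψ y α μ ν) x * δg x μ ν := by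
        rw [Finset.sum_comm]
        exact Finset.sum_congr rfl fun μ _ => Finset.sum_comm
      rw [e3, ← Finset.sum_sub_distrib, Finset.mul_sum, Finset.mul_sum]
      refine Finset.sum_congr rfl fun μ _ => ?_
      rw [← Finset.sum_sub_distrib, Finset.mul_sum, Finset.mul_sum]
      refine Finset.sum_congr rfl fun ν _ => ?_
      rw [stressUp, ← Finset.sum_mul]
      field_simp
    rw [e2]
    simp only [e1, Finset.sum_add_distrib]
    ring

end Matter

/-! ### The first variation of the multiplier action -/

section Multiplier

variable {U : Set Pt} {g δg : Pt → Tensor2} {π δπ lam δlam : Pt → Fin 4 → ℝ} {φ δφ : Pt → ℝ}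

/-- The first variation of the multiplier action; the term in `δφ` is integrated by parts. -/
theorem hasDerivAt_multiplierAction (hU : IsOpen U) (hg : IsLorentzMetricOn U g)
    (hπ : ContDiffOn ℝ ∞ π U) (hlam : ContDiffOn ℝ ∞ lam U) (hφ : ContDiffOn ℝ ∞ φ U)
    {K : Set Pt} (hK : IsCompact K) (hKU : K ⊆ U) (hδg : IsVariation K δg)
    (hδs : ∀ x μ ν, δg x μ ν = δg x ν μ) (hδπ : IsVariation K δπ) (hδφ : IsVariation K δφ)
    (hδlam : IsVariation K δlam) :
    ContinuousOn (fun x => sqrtNegDet g x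
      * ((1 / 2) * (∑ μ, ∑ ν, ginv g x ν μ * δg x μ ν) * ∑ μ, lam x μ * (π x μ - pd μ φ x)
        + ∑ μ, (δlam x μ * (π x μ - pd μ φ x) + lam x μ * δπ x μ)
        + divVec (leviCivita g) lam x * δφ x)) K ∧
    HasDerivAt (fun ε : ℝ => multiplierAction K (fun x => g x + ε • δg x)
        (fun x => π x + ε • δπ x) (fun x => φ x + ε * δφ x) (fun x => lam x + ε • δlam x))
      (∫ x in K, sqrtNegDet g x
      * ((1 / 2) * (∑ μ, ∑ ν, ginv g x ν μ * δg x μ ν) * ∑ μ, lam x μ * (π x μ - pd μ φ x)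
        + ∑ μ, (δlam x μ * (π x μ - pd μ φ x) + lam x μ * δπ x μ)
        + divVec (leviCivita g) lam x * δφ x)) 0 := by
  have hev := eventually_isLorentzMetricOn hU hg hK hKU hδg hδs
  refine hasDerivAt_action hK (isClosed_tsupport δφ) hδφ.2
    (f := fun ε x => sqrtNegDet (fun y => g y + ε • δg y) x * ∑ μ, (lam x + ε • δlam x) μ
      * ((π x + ε • δπ x) μ - pd μ (fun y => φ y + ε * δφ y) x)) (Y := fun _ _ => 0)
    (Z := fun x μ => -(sqrtNegDet g x * lam x μ * δφ x))
    (.of_forall fun ε x _ => by simp [pd]) (hev.mono fun ε hε x hx => ?_)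
    (.of_forall fun _ _ _ => contDiffAt_const) (fun _ _ _ => rfl) (fun x hx => ?_) (fun x hx => ?_)
    (fun x hx => ?_)
  · have hG : SmoothFam (fun ε x => g x + ε • δg x) (x, ε) :=
      .affine (ContDiffOn.at_of_isOpen hg.smooth hU (hKU hx)) hδg.1
    have h1 := hG.sqrtNegDet (hε.det_neg x (hKU hx))
    have h2 : SmoothFam (fun ε x => lam x + ε • δlam x) (x, ε) :=
      .affine (ContDiffOn.at_of_isOpen hlam hU (hKU hx)) hδlam.1
    have h3 : SmoothFam (fun ε x => π x + ε • δπ x) (x, ε) :=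
      .affine (ContDiffOn.at_of_isOpen hπ hU (hKU hx)) hδπ.1
    have h4 : SmoothFam (fun ε x => φ x + ε * δφ x) (x, ε) :=
      .affine (ContDiffOn.at_of_isOpen hφ hU (hKU hx)) hδφ.1
    exact h1.mul (ContDiffAt.sum fun μ _ => (contDiffAt_pi.1 h2 μ).mul
      ((contDiffAt_pi.1 h3 μ).sub (h4.pd μ)))
  · exact contDiffAt_pi.2 fun μ => (((contDiffAt_sqrtNegDet hU hg (hKU hx)).mul (contDiffAt_pi.1
      (ContDiffOn.at_of_isOpen hlam hU (hKU hx)) μ)).mul hδφ.1.contDiffAt).neg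
  · funext μ
    simp [image_eq_zero_of_notMem_tsupport hx]
  · have hxU := hKU hx
    have hφd : DifferentiableAt ℝ φ x :=
      (ContDiffOn.at_of_isOpen hφ hU hxU).differentiableAt (by simp)
    have hδφd : DifferentiableAt ℝ δφ x := hδφ.1.contDiffAt.differentiableAt (by simp)
    have hlamd : ∀ μ, DifferentiableAt ℝ (fun y => lam y μ) x := fun μ =>
      (contDiffAt_pi.1 (ContDiffOn.at_of_isOpen hlam hU hxU) μ).differentiableAt (by simp)
    have hsd : DifferentiableAt ℝ (sqrtNegDet g) x :=
      (contDiffAt_sqrtNegDet hU hg hxU).differentiableAt (by simp)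
    have hpd : ∀ (ε : ℝ) μ, pd μ (fun y => φ y + ε * δφ y) x = pd μ φ x + ε * pd μ δφ x :=
      fun ε μ => by rw [pd_add hφd (hδφd.const_mul ε), pd_const_mul ε hδφd]
    simp only [hpd, Pi.add_apply, Pi.smul_apply, smul_eq_mul]
    have h1 := hasDerivAt_sqrtNegDet_variation (δg := δg) (hg.det_neg x hxU)
    have ha : ∀ a b : ℝ, HasDerivAt (fun ε : ℝ => a + ε * b) b 0 := fun a b =>
      hasDerivAt_affine a b 0
    have h2 := h1.fun_mul (HasDerivAt.fun_sum (u := Finset.univ) fun μ _ =>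
      (ha (lam x μ) (δlam x μ)).fun_mul ((ha (π x μ) (δπ x μ)).fun_sub (ha (pd μ φ x) (pd μ δφ x))))
    refine h2.congr_deriv ?_
    simp only [zero_smul, zero_mul, add_zero]
    have hdiv := sqrtNegDet_mul_divVec hU hg hxU hlamd
    have e1 : ∀ μ, pd μ (fun y => -(sqrtNegDet g y * lam y μ * δφ y)) x
        = -(pd μ (fun y => sqrtNegDet g y * lam y μ) x * δφ x)
          - sqrtNegDet g x * (lam x μ * pd μ δφ x) := fun μ => by
      rw [pd_neg, pd_mul (hsd.fun_mul (hlamd μ)) hδφd]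
      ring
    have e2 : ∀ μ, δlam x μ * (π x μ - pd μ φ x) + lam x μ * (δπ x μ - pd μ δφ x)
        = (δlam x μ * (π x μ - pd μ φ x) + lam x μ * δπ x μ) - lam x μ * pd μ δφ x := fun μ => by
      ring
    simp only [e1, e2, Finset.sum_sub_distrib, Finset.sum_neg_distrib, ← Finset.sum_mul,
      ← Finset.mul_sum, ← hdiv]
    ring

end Multiplier

/-! ### The contracted Bianchi identity -/

/-- The entrywise coordinate derivative of a matrix-valued function. -/
def pdMat (α : Fin 4) (M : Pt → Matrix (Fin 4) (Fin 4) ℝ) (x : Pt) : Matrix (Fin 4) (Fin 4) ℝ :=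
  fun i j => pd α (fun y => M y i j) x

/-- The entries of a matrix-valued function are smooth at a point. -/
def SmoothMatAt (M : Pt → Matrix (Fin 4) (Fin 4) ℝ) (x : Pt) : Prop :=
  ∀ i j, ContDiffAt ℝ ∞ (fun y => M y i j) x

section

variable {M N : Pt → Matrix (Fin 4) (Fin 4) ℝ} {x : Pt}

theorem SmoothMatAt.diff (hM : SmoothMatAt M x) (i j : Fin 4) :
    DifferentiableAt ℝ (fun y => M y i j) x := (hM i j).differentiableAt (by simp)

theorem SmoothMatAt.mul (hM : SmoothMatAt M x) (hN : SmoothMatAt N x) :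
    SmoothMatAt (fun y => M y * N y) x := fun i j => by
  simp only [Matrix.mul_apply]
  exact ContDiffAt.sum fun l _ => (hM i l).mul (hN l j)

theorem SmoothMatAt.add (hM : SmoothMatAt M x) (hN : SmoothMatAt N x) :
    SmoothMatAt (fun y => M y + N y) x := fun i j => (hM i j).add (hN i j)

theorem SmoothMatAt.sub (hM : SmoothMatAt M x) (hN : SmoothMatAt N x) :
    SmoothMatAt (fun y => M y - N y) x := fun i j => (hM i j).sub (hN i j)

theorem SmoothMatAt.transpose (hM : SmoothMatAt M x) :
    SmoothMatAt (fun y => (M y).transpose) x := fun i j => hM j i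

theorem SmoothMatAt.pdMat (hM : SmoothMatAt M x) (α : Fin 4) : SmoothMatAt (pdMat α M) x :=
  fun i j => contDiffAt_pd (hM i j) α

theorem pdMat_add (hM : SmoothMatAt M x) (hN : SmoothMatAt N x) (α : Fin 4) :
    pdMat α (fun y => M y + N y) x = pdMat α M x + pdMat α N x := by
  ext i j
  exact pd_add (hM.diff i j) (hN.diff i j) α

theorem pdMat_sub (hM : SmoothMatAt M x) (hN : SmoothMatAt N x) (α : Fin 4) :
    pdMat α (fun y => M y - N y) x = pdMat α M x - pdMat α N x := by
  ext i j
  exact pd_sub (hM.diff i j) (hN.diff i j) α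

theorem pdMat_neg (M : Pt → Matrix (Fin 4) (Fin 4) ℝ) (x : Pt) (α : Fin 4) :
    pdMat α (fun y => -M y) x = -pdMat α M x := by
  ext i j
  exact pd_neg (fun y => M y i j) x α

theorem pdMat_mul (hM : SmoothMatAt M x) (hN : SmoothMatAt N x) (α : Fin 4) :
    pdMat α (fun y => M y * N y) x = pdMat α M x * N x + M x * pdMat α N x := by
  ext i j
  simp only [pdMat, Matrix.mul_apply, Matrix.add_apply]
  rw [pd_sum _ fun l _ => (hM.diff i l).fun_mul (hN.diff l j), ← Finset.sum_add_distrib]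
  exact Finset.sum_congr rfl fun l _ => pd_mul (hM.diff i l) (hN.diff l j) α

theorem pdMat_comm (hM : SmoothMatAt M x) (α β : Fin 4) :
    pdMat α (pdMat β M) x = pdMat β (pdMat α M) x := by
  ext i j
  exact pd_comm (hM i j) α β

theorem pdMat_congr_on {U : Set Pt} (hU : IsOpen U) (h : ∀ y ∈ U, M y = N y) (hx : x ∈ U)
    (α : Fin 4) : pdMat α M x = pdMat α N x := by
  ext i j
  exact pd_congr_on hU (fun y hy => by rw [h y hy]) hx α

end

/-- The connection matrix `(A_α)^μ_ν = Γ^μ_{να}`. -/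
def connMat (Γ : Conn) (α : Fin 4) (x : Pt) : Matrix (Fin 4) (Fin 4) ℝ := fun μ ν => Γ x μ ν α

/-- The curvature matrix `(F_{ρσ})^μ_ν = R^μ_{νρσ} = (∂_ρ A_σ - ∂_σ A_ρ + [A_ρ, A_σ])^μ_ν`. -/
def curvMat (Γ : Conn) (ρ σ : Fin 4) (x : Pt) : Matrix (Fin 4) (Fin 4) ℝ :=
  pdMat ρ (connMat Γ σ) x - pdMat σ (connMat Γ ρ) x
    + (connMat Γ ρ x * connMat Γ σ x - connMat Γ σ x * connMat Γ ρ x)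

theorem curvMat_apply (Γ : Conn) (ρ σ : Fin 4) (x : Pt) (μ ν : Fin 4) :
    curvMat Γ ρ σ x μ ν = riemann Γ x μ ν ρ σ := by
  simp only [curvMat, riemann, pdMat, connMat, Matrix.add_apply, Matrix.sub_apply, Matrix.mul_apply,
    Finset.sum_sub_distrib]
  have e1 : ∑ j, Γ x μ j ρ * Γ x j ν σ = ∑ l, Γ x l ν σ * Γ x μ l ρ :=
    Finset.sum_congr rfl fun l _ => mul_comm _ _
  have e2 : ∑ j, Γ x μ j σ * Γ x j ν ρ = ∑ l, Γ x l ν ρ * Γ x μ l σ :=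
    Finset.sum_congr rfl fun l _ => mul_comm _ _
  rw [e1, e2]
  ring

/-- The inverse metric as a matrix. -/
def ginvMat (g : Pt → Tensor2) (x : Pt) : Matrix (Fin 4) (Fin 4) ℝ := (Matrix.of (g x))⁻¹

theorem ginvMat_apply (g : Pt → Tensor2) (x : Pt) (μ ν : Fin 4) :
    ginvMat g x μ ν = ginv g x μ ν := rfl

/-- The differential Bianchi identity. -/
theorem bianchi {Γ : Conn} {x : Pt} (hΓ : ∀ α, SmoothMatAt (connMat Γ α) x) (α ρ σ : Fin 4) :
    (pdMat α (curvMat Γ ρ σ) x + connMat Γ α x * curvMat Γ ρ σ x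
      - curvMat Γ ρ σ x * connMat Γ α x)
    + (pdMat ρ (curvMat Γ σ α) x + connMat Γ ρ x * curvMat Γ σ α x
      - curvMat Γ σ α x * connMat Γ ρ x)
    + (pdMat σ (curvMat Γ α ρ) x + connMat Γ σ x * curvMat Γ α ρ x
      - curvMat Γ α ρ x * connMat Γ σ x) = 0 := by
  have h : ∀ α ρ σ, pdMat α (curvMat Γ ρ σ) x
      = pdMat α (pdMat ρ (connMat Γ σ)) x - pdMat α (pdMat σ (connMat Γ ρ)) x
        + ((pdMat α (connMat Γ ρ) x * connMat Γ σ x + connMat Γ ρ x * pdMat α (connMat Γ σ) x)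
        - (pdMat α (connMat Γ σ) x * connMat Γ ρ x + connMat Γ σ x * pdMat α (connMat Γ ρ) x)) := by
    intro α ρ σ
    have h1 := (hΓ σ).pdMat ρ
    have h2 := (hΓ ρ).pdMat σ
    have h3 := (hΓ ρ).mul (hΓ σ)
    have h4 := (hΓ σ).mul (hΓ ρ)
    change pdMat α (fun y => pdMat ρ (connMat Γ σ) y - pdMat σ (connMat Γ ρ) y
      + (connMat Γ ρ y * connMat Γ σ y - connMat Γ σ y * connMat Γ ρ y)) x = _
    rw [pdMat_add (h1.sub h2) (h3.sub h4), pdMat_sub h1 h2, pdMat_sub h3 h4,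
      pdMat_mul (hΓ ρ) (hΓ σ), pdMat_mul (hΓ σ) (hΓ ρ)]
  rw [h, h, h, pdMat_comm (hΓ α) ρ σ, pdMat_comm (hΓ ρ) σ α, pdMat_comm (hΓ σ) α ρ]
  simp only [curvMat]
  noncomm_ring

/-- The index bookkeeping behind the contraction of the Bianchi identity: `k μ ν ρ σ` stands for
`R^{μν}_{ρσ}` and `dk` for its coordinate derivatives. -/
theorem bianchi_contraction {Γ : Fin 4 → Fin 4 → Fin 4 → ℝ} {k : Fin 4 → Fin 4 → Fin 4 → Fin 4 → ℝ}
    {dk : Fin 4 → Fin 4 → Fin 4 → Fin 4 → Fin 4 → ℝ} (hΓ : ∀ μ ν ρ, Γ μ ν ρ = Γ μ ρ ν)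
    (hk₁ : ∀ μ ν ρ σ, k μ ν ρ σ = -k ν μ ρ σ) (hk₂ : ∀ μ ν ρ σ, k μ ν ρ σ = -k μ ν σ ρ)
    (hdk₁ : ∀ α μ ν ρ σ, dk α μ ν ρ σ = -dk α ν μ ρ σ)
    (hdk₂ : ∀ α μ ν ρ σ, dk α μ ν ρ σ = -dk α μ ν σ ρ)
    (hB : ∀ α ρ σ μ ν,
      (dk α μ ν ρ σ + ∑ l, Γ μ l α * k l ν ρ σ + ∑ l, k μ l ρ σ * Γ ν l α)
      + (dk ρ μ ν σ α + ∑ l, Γ μ l ρ * k l ν σ α + ∑ l, k μ l σ α * Γ ν l ρ)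
      + (dk σ μ ν α ρ + ∑ l, Γ μ l σ * k l ν α ρ + ∑ l, k μ l α ρ * Γ ν l σ) = 0) (α : Fin 4) :
    ∑ μ, (∑ ν, dk μ μ ν α ν + ∑ l, Γ μ l μ * ∑ ν, k l ν α ν)
      = (1 / 2) * ∑ μ, ∑ ν, dk α μ ν μ ν + ∑ μ, ∑ l, Γ μ l α * ∑ ν, k l ν μ ν := by
  have h0 : ∑ μ, ∑ ν, ((dk α μ ν μ ν + ∑ l, Γ μ l α * k l ν μ ν + ∑ l, k μ l μ ν * Γ ν l α)
      + (dk μ μ ν ν α + ∑ l, Γ μ l μ * k l ν ν α + ∑ l, k μ l ν α * Γ ν l μ)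
      + (dk ν μ ν α μ + ∑ l, Γ μ l ν * k l ν α μ + ∑ l, k μ l α μ * Γ ν l ν)) = 0 :=
    Finset.sum_eq_zero fun μ _ => Finset.sum_eq_zero fun ν _ => hB α μ ν μ ν
  simp only [Finset.sum_add_distrib] at h0
  have swap : ∀ f : Fin 4 → Fin 4 → Fin 4 → ℝ, (∀ a b c, f a b c = -f c b a) →
      ∑ a, ∑ b, ∑ c, f a b c = 0 := by
    intro f hf
    have : ∑ a, ∑ b, ∑ c, f a b c = -∑ a, ∑ b, ∑ c, f a b c := by
      conv_lhs => rw [Finset.sum_comm, Finset.sum_congr rfl fun b _ => Finset.sum_comm,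
        Finset.sum_comm]
      simp only [← Finset.sum_neg_distrib]
      exact Finset.sum_congr rfl fun a _ => Finset.sum_congr rfl fun b _ =>
        Finset.sum_congr rfl fun c _ => hf c b a
    linarith
  have t1 : ∑ μ, ∑ ν, ∑ l, Γ μ l α * k l ν μ ν = ∑ μ, ∑ l, Γ μ l α * ∑ ν, k l ν μ ν := by
    refine Finset.sum_congr rfl fun μ _ => ?_
    rw [Finset.sum_comm]
    simp only [Finset.mul_sum]
  have t2 : ∑ μ, ∑ ν, ∑ l, k μ l μ ν * Γ ν l α = ∑ μ, ∑ l, Γ μ l α * ∑ ν, k l ν μ ν := by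
    rw [Finset.sum_comm]
    refine Finset.sum_congr rfl fun ν _ => ?_
    rw [Finset.sum_comm]
    refine Finset.sum_congr rfl fun l _ => ?_
    rw [Finset.mul_sum]
    refine Finset.sum_congr rfl fun μ _ => ?_
    rw [hk₁, hk₂]
    ring
  have t3 : ∑ μ, ∑ ν, dk μ μ ν ν α = -∑ μ, ∑ ν, dk μ μ ν α ν := by
    simp only [← Finset.sum_neg_distrib]
    exact Finset.sum_congr rfl fun μ _ => Finset.sum_congr rfl fun ν _ => hdk₂ _ _ _ _ _
  have t4 : ∑ μ, ∑ ν, ∑ l, Γ μ l μ * k l ν ν α = -∑ μ, ∑ l, Γ μ l μ * ∑ ν, k l ν α ν := by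
    simp only [Finset.mul_sum, ← Finset.sum_neg_distrib]
    refine Finset.sum_congr rfl fun μ _ => ?_
    rw [Finset.sum_comm]
    refine Finset.sum_congr rfl fun l _ => Finset.sum_congr rfl fun ν _ => ?_
    rw [hk₂]
    ring
  have t5 : ∑ μ, ∑ ν, ∑ l, k μ l ν α * Γ ν l μ = 0 := swap _ fun a b c => by
    rw [hk₁, hΓ]
    ring
  have t6 : ∑ μ, ∑ ν, dk ν μ ν α μ = -∑ μ, ∑ ν, dk μ μ ν α ν := by
    rw [Finset.sum_comm]
    simp only [← Finset.sum_neg_distrib]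
    exact Finset.sum_congr rfl fun ν _ => Finset.sum_congr rfl fun μ _ => hdk₁ _ _ _ _ _
  have t7 : ∑ μ, ∑ ν, ∑ l, Γ μ l ν * k l ν α μ = 0 := by
    rw [Finset.sum_comm]
    refine swap (fun ν μ l => Γ μ l ν * k l ν α μ) fun a b c => ?_
    rw [hk₁, hΓ]
    ring
  have t8 : ∑ μ, ∑ ν, ∑ l, k μ l α μ * Γ ν l ν = -∑ μ, ∑ l, Γ μ l μ * ∑ ν, k l ν α ν := by
    simp only [Finset.mul_sum, ← Finset.sum_neg_distrib]
    rw [Finset.sum_comm]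
    refine Finset.sum_congr rfl fun ν _ => ?_
    rw [Finset.sum_comm]
    refine Finset.sum_congr rfl fun l _ => Finset.sum_congr rfl fun μ _ => ?_
    rw [hk₁]
    ring
  rw [t1, t2, t3, t4, t5, t6, t7, t8] at h0
  rw [Finset.sum_add_distrib]
  linarith

section

variable {U : Set Pt} {g : Pt → Tensor2} (hU : IsOpen U) (hg : IsLorentzMetricOn U g)
  {x : Pt} (hx : x ∈ U)
include hU hg hx

theorem smoothMatAt_connMat (α : Fin 4) : SmoothMatAt (connMat (leviCivita g) α) x :=
  fun μ ν => contDiffAt_leviCivita hU hg hx μ ν α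

theorem smoothMatAt_ginvMat : SmoothMatAt (ginvMat g) x := contDiffAt_ginv hU hg hx

theorem smoothMatAt_curvMat (ρ σ : Fin 4) : SmoothMatAt (curvMat (leviCivita g) ρ σ) x := by
  have h := smoothMatAt_connMat hU hg hx
  exact (((h σ).pdMat ρ).sub ((h ρ).pdMat σ)).add (((h ρ).mul (h σ)).sub ((h σ).mul (h ρ)))

theorem pdMat_ginvMat (α : Fin 4) : pdMat α (ginvMat g) x
    = -(connMat (leviCivita g) α x * ginvMat g x
      + ginvMat g x * (connMat (leviCivita g) α x).transpose) := by
  ext μ ν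
  have := pd_ginv hU hg hx α μ ν
  simp only [Finset.sum_add_distrib] at this
  simp only [pdMat, ginvMat_apply, this, Matrix.neg_apply, Matrix.add_apply, Matrix.mul_apply,
    Matrix.transpose_apply, connMat]
  simp only [mul_comm]

/-- Metric compatibility makes `R^{μν}_{ρσ}` antisymmetric in its upper indices. -/
theorem curvMat_mul_ginvMat_antisymm (ρ σ : Fin 4) :
    curvMat (leviCivita g) ρ σ x * ginvMat g x
      + ginvMat g x * (curvMat (leviCivita g) ρ σ x).transpose = 0 := by
  have hA := smoothMatAt_connMat hU hg hx
  have hH := smoothMatAt_ginvMat hU hg hx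
  have h : ∀ ρ σ, pdMat ρ (pdMat σ (ginvMat g)) x
      = -((pdMat ρ (connMat (leviCivita g) σ) x * ginvMat g x
        + connMat (leviCivita g) σ x * pdMat ρ (ginvMat g) x)
        + (pdMat ρ (ginvMat g) x * (connMat (leviCivita g) σ x).transpose
          + ginvMat g x * (pdMat ρ (connMat (leviCivita g) σ) x).transpose)) := by
    intro ρ σ
    rw [pdMat_congr_on hU (fun y hy => pdMat_ginvMat hU hg hy σ) hx ρ, pdMat_neg,
      pdMat_add ((hA σ).mul hH) (hH.mul (hA σ).transpose), pdMat_mul (hA σ) hH,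
      pdMat_mul hH (hA σ).transpose]
    rfl
  have hc := pdMat_comm hH ρ σ
  rw [h, h, pdMat_ginvMat hU hg hx, pdMat_ginvMat hU hg hx] at hc
  rw [← sub_eq_zero] at hc
  rw [← neg_eq_zero, ← hc]
  simp only [curvMat, Matrix.transpose_add, Matrix.transpose_sub, Matrix.transpose_mul]
  noncomm_ring

/-- The differential Bianchi identity with the second index of the curvature raised. -/
theorem bianchi_ginvMat (α ρ σ : Fin 4) :
    let A := fun α => connMat (leviCivita g) α x
    let K := fun ρ σ y => curvMat (leviCivita g) ρ σ y * ginvMat g y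
    (pdMat α (K ρ σ) x + A α * K ρ σ x + K ρ σ x * (A α).transpose)
    + (pdMat ρ (K σ α) x + A ρ * K σ α x + K σ α x * (A ρ).transpose)
    + (pdMat σ (K α ρ) x + A σ * K α ρ x + K α ρ x * (A σ).transpose) = 0 := by
  intro A K
  have hF := smoothMatAt_curvMat hU hg hx
  have hH := smoothMatAt_ginvMat hU hg hx
  have h : ∀ α ρ σ, pdMat α (K ρ σ) x + A α * K ρ σ x + K ρ σ x * (A α).transpose
      = (pdMat α (curvMat (leviCivita g) ρ σ) x + A α * curvMat (leviCivita g) ρ σ x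
        - curvMat (leviCivita g) ρ σ x * A α) * ginvMat g x := by
    intro α ρ σ
    simp only [K]
    rw [pdMat_mul (hF ρ σ) hH, pdMat_ginvMat hU hg hx]
    simp only [A]
    noncomm_ring
  rw [h, h, h, ← add_mul, ← add_mul, bianchi (smoothMatAt_connMat hU hg hx), zero_mul]

/-- The mixed Ricci tensor `R^l_α = g^{lμ} R_{μα}` as a contraction of `R^{lν}_{αν}`. -/
theorem mixedRicci_eq (l α : Fin 4) :
    ∑ μ, ginv g x l μ * ricci (leviCivita g) x μ α
      = ∑ ν, (curvMat (leviCivita g) α ν x * ginvMat g x) l ν := by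
  have hs := hg.symm x hx
  have ha : ∀ ν, (curvMat (leviCivita g) α ν x * ginvMat g x) l ν
      = (curvMat (leviCivita g) ν α x * ginvMat g x) ν l := by
    intro ν
    have h1 := congrFun (congrFun (curvMat_mul_ginvMat_antisymm hU hg hx α ν) l) ν
    have h2 : curvMat (leviCivita g) ν α x = -curvMat (leviCivita g) α ν x := by
      simp only [curvMat]; abel
    rw [h2]
    simp only [Matrix.add_apply, Matrix.mul_apply, Matrix.transpose_apply, Matrix.zero_apply,
      Matrix.neg_apply, ginvMat_apply, Finset.sum_neg_distrib, neg_mul] at h1 ⊢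
    rw [eq_neg_of_add_eq_zero_left h1]
    congr 1
    refine Finset.sum_congr rfl fun b _ => ?_
    rw [ginv_symm hs]
    ring
  simp only [ha, Matrix.mul_apply, ricci, ginvMat_apply, curvMat_apply, Finset.mul_sum]
  rw [Finset.sum_comm]
  refine Finset.sum_congr rfl fun ν _ => Finset.sum_congr rfl fun μ _ => ?_
  rw [ginv_symm hs]
  ring

/-- The contracted Bianchi identity
`∂_μ R^μ_α + Γ^μ_{lμ} R^l_α - Γ^μ_{lα} R^l_μ = ½ ∂_α R` for the mixed Ricci tensor. -/
theorem contracted_bianchi (α : Fin 4) :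
    ∑ μ, (pd μ (fun y => ∑ ν, ginv g y μ ν * ricci (leviCivita g) y ν α) x
      + ∑ l, leviCivita g x μ l μ * ∑ ν, ginv g x l ν * ricci (leviCivita g) x ν α)
      = (1 / 2) * pd α (scalarCurv g (leviCivita g)) x
        + ∑ μ, ∑ l, leviCivita g x μ l α * ∑ ν, ginv g x l ν * ricci (leviCivita g) x ν μ := by
  have hFH : ∀ ρ σ, SmoothMatAt (fun y => curvMat (leviCivita g) ρ σ y * ginvMat g y) x :=
    fun ρ σ => (smoothMatAt_curvMat hU hg hx ρ σ).mul (smoothMatAt_ginvMat hU hg hx)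
  have ha₁ : ∀ y ∈ U, ∀ μ ν ρ σ, (curvMat (leviCivita g) ρ σ y * ginvMat g y) μ ν
      = -(curvMat (leviCivita g) ρ σ y * ginvMat g y) ν μ := by
    intro y hy μ ν ρ σ
    have h1 := congrFun (congrFun (curvMat_mul_ginvMat_antisymm hU hg hy ρ σ) μ) ν
    simp only [Matrix.add_apply, Matrix.mul_apply, Matrix.transpose_apply, Matrix.zero_apply,
      ginvMat_apply] at h1 ⊢
    rw [eq_neg_of_add_eq_zero_left h1]
    congr 1
    refine Finset.sum_congr rfl fun b _ => ?_
    rw [ginv_symm (hg.symm y hy)]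
    ring
  have ha₂ : ∀ y, ∀ μ ν ρ σ, (curvMat (leviCivita g) ρ σ y * ginvMat g y) μ ν
      = -(curvMat (leviCivita g) σ ρ y * ginvMat g y) μ ν := by
    intro y μ ν ρ σ
    have h2 : curvMat (leviCivita g) ρ σ y = -curvMat (leviCivita g) σ ρ y := by
      simp only [curvMat]; abel
    rw [h2, neg_mul, Matrix.neg_apply]
  have key := bianchi_contraction (Γ := leviCivita g x)
    (k := fun μ ν ρ σ => (curvMat (leviCivita g) ρ σ x * ginvMat g x) μ ν)
    (dk := fun α μ ν ρ σ => pd α (fun y => (curvMat (leviCivita g) ρ σ y * ginvMat g y) μ ν) x)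
    (leviCivita_symm hU hg hx) (ha₁ x hx) (ha₂ x)
    (fun α μ ν ρ σ => by
      rw [pd_congr_on hU (fun y hy => ha₁ y hy μ ν ρ σ) hx α, pd_neg])
    (fun α μ ν ρ σ => by
      rw [pd_congr_on hU (fun y hy => ha₂ y μ ν ρ σ) hx α, pd_neg])
    (fun α ρ σ μ ν => by
      have := congrFun (congrFun (bianchi_ginvMat hU hg hx α ρ σ) μ) ν
      simpa only [Matrix.add_apply, pdMat, Matrix.zero_apply,
        Matrix.mul_apply (M := connMat (leviCivita g) _ x),
        Matrix.mul_apply (N := (connMat (leviCivita g) _ x).transpose), Matrix.transpose_apply,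
        connMat] using this) α
  have hr : ∀ μ α, pd μ (fun y => ∑ ν, ginv g y μ ν * ricci (leviCivita g) y ν α) x
      = ∑ ν, pd μ (fun y => (curvMat (leviCivita g) α ν y * ginvMat g y) μ ν) x := by
    intro μ α
    rw [pd_congr_on hU (fun y hy => mixedRicci_eq hU hg hy μ α) hx μ]
    exact pd_sum _ (fun ν _ => (hFH α ν).diff μ ν) μ
  have hR : pd α (scalarCurv g (leviCivita g)) x
      = ∑ μ, ∑ ν, pd α (fun y => (curvMat (leviCivita g) μ ν y * ginvMat g y) μ ν) x := by
    have e : ∀ y ∈ U, scalarCurv g (leviCivita g) y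
        = ∑ μ, ∑ ν, (curvMat (leviCivita g) μ ν y * ginvMat g y) μ ν := by
      intro y hy
      simp only [← mixedRicci_eq hU hg hy, scalarCurv]
      rw [Finset.sum_comm]
      exact Finset.sum_congr rfl fun μ _ => Finset.sum_congr rfl fun ν _ => by
        rw [ginv_symm (hg.symm y hy)]
    rw [pd_congr_on hU e hx α, pd_sum _ fun μ _ => DifferentiableAt.fun_sum fun ν _ =>
      (hFH μ ν).diff μ ν]
    exact Finset.sum_congr rfl fun μ _ => pd_sum _ (fun ν _ => (hFH μ ν).diff μ ν) α
  simp only [hr, hR, mixedRicci_eq hU hg hx]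
  exact key

end

/-! ### Covariant derivatives and divergences -/

section

variable {U : Set Pt} {g : Pt → Tensor2}

theorem divVec_congr_on (Γ : Conn) {V W : Pt → Fin 4 → ℝ} (hU : IsOpen U)
    (h : ∀ y ∈ U, ∀ μ, V y μ = W y μ) {x : Pt} (hx : x ∈ U) : divVec Γ V x = divVec Γ W x := by
  simp only [divVec, covVec, h x hx]
  exact Finset.sum_congr rfl fun μ _ => by rw [pd_congr_on hU (fun y hy => h y hy μ) hx μ]

theorem divVec_mul (Γ : Conn) {f : Pt → ℝ} {V : Pt → Fin 4 → ℝ} {x : Pt}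
    (hf : DifferentiableAt ℝ f x) (hV : ∀ μ, DifferentiableAt ℝ (fun y => V y μ) x) :
    divVec Γ (fun y μ => f y * V y μ) x = f x * divVec Γ V x + ∑ μ, pd μ f x * V x μ := by
  simp only [divVec, covVec, pd_mul hf (hV _), Finset.sum_add_distrib, mul_add, Finset.mul_sum,
    mul_left_comm (f x)]
  ring

/-- The covariant derivative `∇_α w_ρ` of a one-form. -/
def covForm (Γ : Conn) (w : Pt → Fin 4 → ℝ) (x : Pt) (α ρ : Fin 4) : ℝ :=
  pd α (fun y => w y ρ) x - ∑ l, Γ x l ρ α * w x l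

/-- The divergence `∇_α M^α_ν` of a mixed tensor. -/
def divMixed (Γ : Conn) (M : Pt → Tensor2) (x : Pt) (ν : Fin 4) : ℝ :=
  ∑ α, (pd α (fun y => M y α ν) x + ∑ l, Γ x α l α * M x l ν) - ∑ α, ∑ l, Γ x l ν α * M x α l

theorem divMixed_add (Γ : Conn) {M N : Pt → Tensor2} {x : Pt}
    (hM : ∀ μ ν, DifferentiableAt ℝ (fun y => M y μ ν) x)
    (hN : ∀ μ ν, DifferentiableAt ℝ (fun y => N y μ ν) x) (ν : Fin 4) :
    divMixed Γ (fun y a b => M y a b + N y a b) x ν = divMixed Γ M x ν + divMixed Γ N x ν := by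
  simp only [divMixed, pd_add (hM _ _) (hN _ _), mul_add, Finset.sum_add_distrib]
  ring

/-- `∇_α (V^α w_ν) = (∇_α V^α) w_ν + V^α ∇_α w_ν`. -/
theorem divMixed_vec_form (Γ : Conn) {V w : Pt → Fin 4 → ℝ} {x : Pt}
    (hV : ∀ μ, DifferentiableAt ℝ (fun y => V y μ) x)
    (hw : ∀ μ, DifferentiableAt ℝ (fun y => w y μ) x) (ν : Fin 4) :
    divMixed Γ (fun y α ν => V y α * w y ν) x ν
      = divVec Γ V x * w x ν + ∑ α, V x α * covForm Γ w x α ν := by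
  simp only [divMixed, divVec, covVec, covForm, pd_mul (hV _) (hw _), Finset.sum_add_distrib,
    mul_sub, Finset.sum_sub_distrib, add_mul, Finset.sum_mul, Finset.mul_sum]
  have e1 : ∑ α, ∑ l, Γ x α l α * (V x l * w x ν) = ∑ α, ∑ l, Γ x α l α * V x l * w x ν :=
    Finset.sum_congr rfl fun α _ => Finset.sum_congr rfl fun l _ => by ring
  have e2 : ∑ α, ∑ l, Γ x l ν α * (V x α * w x l) = ∑ α, ∑ l, V x α * (Γ x l ν α * w x l) :=
    Finset.sum_congr rfl fun α _ => Finset.sum_congr rfl fun l _ => by ring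
  rw [e1, e2]
  ring

/-- `∇_α (h δ^α_ν) = ∂_ν h` for a symmetric connection. -/
theorem divMixed_scalar {Γ : Conn} {x : Pt} (hΓ : ∀ μ ν ρ, Γ x μ ν ρ = Γ x μ ρ ν) (h : Pt → ℝ)
    (ν : Fin 4) :
    divMixed Γ (fun y a b => if a = b then h y else 0) x ν = pd ν h x := by
  have e : ∀ α, pd α (fun y => if α = ν then h y else 0) x = if α = ν then pd ν h x else 0 := by
    intro α
    split_ifs with hα
    · rw [hα]
    · simp [pd]
  simp only [divMixed, e, Finset.sum_add_distrib]
  simp [hΓ _ ν]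

variable (hU : IsOpen U) (hg : IsLorentzMetricOn U g) {x : Pt} (hx : x ∈ U)
include hU hg hx

/-- Raising an index commutes with the Levi-Civita covariant derivative. -/
theorem covVec_raise {w : Pt → Fin 4 → ℝ} (hw : ∀ μ, DifferentiableAt ℝ (fun y => w y μ) x)
    (α μ : Fin 4) : covVec (leviCivita g) (raise g w) x α μ
      = ∑ ρ, ginv g x μ ρ * covForm (leviCivita g) w x α ρ := by
  have hi : ∀ ν σ, DifferentiableAt ℝ (fun y => ginv g y ν σ) x := fun ν σ =>
    (contDiffAt_ginv hU hg hx ν σ).differentiableAt (by simp)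
  simp only [covVec, covForm, raise]
  rw [pd_sum _ fun ρ _ => (hi μ ρ).fun_mul (hw ρ)]
  simp only [pd_mul (hi _ _) (hw _), pd_ginv hU hg hx, Finset.sum_add_distrib, mul_sub,
    Finset.sum_sub_distrib, neg_mul, Finset.sum_neg_distrib, add_mul, Finset.sum_mul,
    Finset.mul_sum]
  have e1 : ∑ ρ, ∑ l, leviCivita g x μ l α * ginv g x l ρ * w x ρ
      = ∑ ν, ∑ ρ, leviCivita g x μ ν α * (ginv g x ν ρ * w x ρ) := by
    rw [Finset.sum_comm]
    simp only [mul_assoc]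
  have e2 : ∑ ρ, ∑ l, leviCivita g x ρ l α * ginv g x μ l * w x ρ
      = ∑ ρ, ∑ l, ginv g x μ ρ * (leviCivita g x l ρ α * w x l) := by
    rw [Finset.sum_comm]
    exact Finset.sum_congr rfl fun α _ => Finset.sum_congr rfl fun l _ => by ring
  rw [e1, e2]
  ring

theorem sum_mul_covVec_raise {w : Pt → Fin 4 → ℝ}
    (hw : ∀ μ, DifferentiableAt ℝ (fun y => w y μ) x) (α : Fin 4) :
    ∑ μ, w x μ * covVec (leviCivita g) (raise g w) x α μ
      = ∑ ρ, raise g w x ρ * covForm (leviCivita g) w x α ρ := by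
  simp only [covVec_raise hU hg hx hw, Finset.mul_sum]
  rw [Finset.sum_comm]
  refine Finset.sum_congr rfl fun ρ _ => ?_
  simp only [raise, Finset.sum_mul]
  refine Finset.sum_congr rfl fun μ _ => ?_
  rw [ginv_symm (hg.symm x hx) μ ρ]
  ring

/-- `∂_α (w_ρ w^ρ) = 2 w^ρ ∇_α w_ρ`. -/
theorem pd_normSq {w : Pt → Fin 4 → ℝ} (hw : ContDiffAt ℝ ∞ w x) (α : Fin 4) :
    pd α (normSq g w) x = 2 * ∑ ρ, raise g w x ρ * covForm (leviCivita g) w x α ρ := by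
  have hwd : ∀ μ, DifferentiableAt ℝ (fun y => w y μ) x := fun μ =>
    (contDiffAt_pi.1 hw μ).differentiableAt (by simp)
  have hud : ∀ μ, DifferentiableAt ℝ (fun y => raise g w y μ) x := fun μ =>
    (contDiffAt_raise hU hg hx hw μ).differentiableAt (by simp)
  have h1 : pd α (normSq g w) x = ∑ μ, (pd α (fun y => w y μ) x * raise g w x μ
      + w x μ * pd α (fun y => raise g w y μ) x) :=
    (pd_sum _ (fun μ _ => (hwd μ).fun_mul (hud μ)) α).trans
      (Finset.sum_congr rfl fun μ _ => pd_mul (hwd μ) (hud μ) α)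
  have h2 := sum_mul_covVec_raise hU hg hx hwd α
  have h3 : ∑ μ, w x μ * covVec (leviCivita g) (raise g w) x α μ
      = ∑ μ, w x μ * pd α (fun y => raise g w y μ) x
        + ∑ ρ, ∑ l, raise g w x ρ * (leviCivita g x l ρ α * w x l) := by
    simp only [covVec, mul_add, Finset.sum_add_distrib, Finset.mul_sum]
    congr 1
    rw [Finset.sum_comm]
    exact Finset.sum_congr rfl fun α _ => Finset.sum_congr rfl fun l _ => by ring
  have h4 : ∑ ρ, raise g w x ρ * covForm (leviCivita g) w x α ρ
      = ∑ μ, pd α (fun y => w y μ) x * raise g w x μ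
        - ∑ ρ, ∑ l, raise g w x ρ * (leviCivita g x l ρ α * w x l) := by
    simp only [covForm, mul_sub, Finset.sum_sub_distrib, Finset.mul_sum]
    congr 1
    exact Finset.sum_congr rfl fun μ _ => mul_comm _ _
  rw [h1, Finset.sum_add_distrib]
  linarith

/-- Raising the second index of a mixed tensor commutes with its Levi-Civita divergence. -/
theorem divTensor_mixed {M : Pt → Tensor2} (hM : ∀ μ ν, DifferentiableAt ℝ (fun y => M y μ ν) x)
    (β : Fin 4) : divTensor (leviCivita g) (fun y α β => ∑ ν, M y α ν * ginv g y ν β) x β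
      = ∑ ν, divMixed (leviCivita g) M x ν * ginv g x ν β := by
  have hi : ∀ ν σ, DifferentiableAt ℝ (fun y => ginv g y ν σ) x := fun ν σ =>
    (contDiffAt_ginv hU hg hx ν σ).differentiableAt (by simp)
  have e : ∀ α, pd α (fun y => ∑ ν, M y α ν * ginv g y ν β) x
      = ∑ ν, (pd α (fun y => M y α ν) x * ginv g x ν β
        - (∑ l, M x α ν * (leviCivita g x ν l α * ginv g x l β)
          + ∑ l, M x α ν * (leviCivita g x β l α * ginv g x ν l))) := by
    intro α
    rw [pd_sum _ fun ν _ => (hM α ν).fun_mul (hi ν β)]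
    refine Finset.sum_congr rfl fun ν _ => ?_
    rw [pd_mul (hM α ν) (hi ν β), pd_ginv hU hg hx, Finset.sum_add_distrib, ← Finset.mul_sum,
      ← Finset.mul_sum]
    ring
  simp only [divTensor, e, divMixed, Finset.sum_add_distrib, Finset.sum_sub_distrib, sub_mul,
    add_mul, Finset.sum_mul, Finset.mul_sum]
  have e1 : ∑ α, ∑ ν, pd α (fun y => M y α ν) x * ginv g x ν β
      = ∑ ν, ∑ α, pd α (fun y => M y α ν) x * ginv g x ν β := Finset.sum_comm
  have e2 : ∑ α, ∑ ν, ∑ l, M x α ν * (leviCivita g x ν l α * ginv g x l β)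
      = ∑ ν, ∑ α, ∑ l, leviCivita g x l ν α * M x α l * ginv g x ν β := by
    rw [Finset.sum_comm (s := Finset.univ (α := Fin 4))
      (f := fun ν α => ∑ l, leviCivita g x l ν α * M x α l * ginv g x ν β)]
    refine Finset.sum_congr rfl fun α _ => ?_
    rw [Finset.sum_comm]
    exact Finset.sum_congr rfl fun α _ => Finset.sum_congr rfl fun l _ => by ring
  have e3 : ∑ α, ∑ ν, ∑ l, M x α ν * (leviCivita g x β l α * ginv g x ν l)
      = ∑ α, ∑ a, ∑ ν, leviCivita g x β a α * (M x α ν * ginv g x ν a) := by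
    refine Finset.sum_congr rfl fun α _ => ?_
    rw [Finset.sum_comm]
    exact Finset.sum_congr rfl fun α _ => Finset.sum_congr rfl fun l _ => by ring
  have e4 : ∑ α, ∑ a, ∑ ν, leviCivita g x α a α * (M x a ν * ginv g x ν β)
      = ∑ ν, ∑ α, ∑ l, leviCivita g x α l α * M x l ν * ginv g x ν β := by
    rw [Finset.sum_comm (s := Finset.univ (α := Fin 4))
      (f := fun ν α => ∑ l, leviCivita g x α l α * M x l ν * ginv g x ν β)]
    refine Finset.sum_congr rfl fun α _ => ?_
    rw [Finset.sum_comm]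
    exact Finset.sum_congr rfl fun α _ => Finset.sum_congr rfl fun l _ => by ring
  rw [e1, e2, e3, e4]
  ring

/-- The contracted Bianchi identity `∇_α R^α_ν = ½ ∂_ν R`. -/
theorem divMixed_ricci (ν : Fin 4) : divMixed (leviCivita g)
    (fun y α ν => ∑ μ, ginv g y α μ * ricci (leviCivita g) y μ ν) x ν
      = (1 / 2) * pd ν (scalarCurv g (leviCivita g)) x := by
  have h := contracted_bianchi hU hg hx ν
  have e : ∑ α, ∑ l, leviCivita g x l ν α * ∑ μ, ginv g x α μ * ricci (leviCivita g) x μ l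
      = ∑ μ, ∑ l, leviCivita g x μ l ν * ∑ ν, ginv g x l ν * ricci (leviCivita g) x ν μ := by
    rw [Finset.sum_comm]
    exact Finset.sum_congr rfl fun μ _ => Finset.sum_congr rfl fun l _ => by
      rw [leviCivita_symm hU hg hx μ ν l]
  rw [divMixed, e, h]
  ring

/-- The trace of the Levi-Civita connection is a gradient. -/
theorem trace_leviCivita_eq_pd_log (ν : Fin 4) :
    ∑ l, leviCivita g x l ν l = pd ν (fun y => Real.log (sqrtNegDet g y)) x := by
  have hs := (sqrtNegDet_pos (hg.det_neg x hx)).ne'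
  have hd := ((contDiffAt_sqrtNegDet hU hg hx).differentiableAt (by simp)).hasFDerivAt.log hs
  have h1 : pd ν (fun y => Real.log (sqrtNegDet g y)) x
      = (sqrtNegDet g x)⁻¹ * pd ν (sqrtNegDet g) x := by
    rw [pd, hd.fderiv]
    rfl
  rw [h1, pd_sqrtNegDet hU hg hx, ← mul_assoc, inv_mul_cancel₀ hs, one_mul]
  exact Finset.sum_congr rfl fun l _ => leviCivita_symm hU hg hx l ν l

/-- The Ricci tensor of the Levi-Civita connection is symmetric, because the trace of the connection
is the gradient of `log √(-g)`. -/
theorem ricci_leviCivita_symm (ν σ : Fin 4) :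
    ricci (leviCivita g) x ν σ = ricci (leviCivita g) x σ ν := by
  have hsm := fun {y} (hy : y ∈ U) => contDiffAt_leviCivita hU hg hy
  have hd : ∀ μ ν ρ, DifferentiableAt ℝ (fun y => leviCivita g y μ ν ρ) x := fun μ ν ρ =>
    (hsm hx μ ν ρ).differentiableAt (by simp)
  have hlog : ContDiffAt ℝ ∞ (fun y => Real.log (sqrtNegDet g y)) x :=
    (contDiffAt_sqrtNegDet hU hg hx).log (sqrtNegDet_pos (hg.det_neg x hx)).ne'
  have h4 : ∀ ν σ, ∑ μ, pd σ (fun y => leviCivita g y μ ν μ) x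
      = pd σ (pd ν fun y => Real.log (sqrtNegDet g y)) x := by
    intro ν σ
    rw [← pd_sum _ (fun μ _ => hd μ ν μ)]
    exact pd_congr_on hU (fun y hy => trace_leviCivita_eq_pd_log hU hg hy ν) hx σ
  have hsy : ∀ a b c, leviCivita g x a b c = leviCivita g x a c b := leviCivita_symm hU hg hx
  have h3 : ∀ μ, pd μ (fun y => leviCivita g y μ ν σ) x = pd μ (fun y => leviCivita g y μ σ ν) x :=
    fun μ => pd_congr_on hU (fun y hy => leviCivita_symm hU hg hy μ ν σ) hx μ
  have h2 : ∑ μ, ∑ l, leviCivita g x l ν μ * leviCivita g x μ l σ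
      = ∑ μ, ∑ l, leviCivita g x l σ μ * leviCivita g x μ l ν := by
    rw [Finset.sum_comm]
    refine Finset.sum_congr rfl fun μ _ => Finset.sum_congr rfl fun l _ => ?_
    rw [hsy μ ν l, hsy l μ σ]
    ring
  simp only [ricci, riemann, Finset.sum_add_distrib, Finset.sum_sub_distrib]
  rw [h2, h4, h4, pd_comm hlog σ ν]
  simp only [h3, hsy _ ν σ]

theorem einsteinUp_symm (α β : Fin 4) : einsteinUp g x α β = einsteinUp g x β α := by
  simp only [einsteinUp]
  rw [Finset.sum_comm]
  refine Finset.sum_congr rfl fun μ _ => Finset.sum_congr rfl fun ν _ => ?_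
  rw [einstein, einstein, hg.symm x hx ν μ, ricci_leviCivita_symm hU hg hx ν μ]
  ring

theorem gravEL_symm (B₁ B₂ : ℝ) (π : Pt → Fin 4 → ℝ) (α β : Fin 4) :
    gravEL B₁ B₂ g π x α β = gravEL B₁ B₂ g π x β α := by
  rw [gravEL, gravEL, einsteinUp_symm hU hg hx, ginv_symm (hg.symm x hx) α β]
  ring

theorem contDiffAt_scalarCurv : ContDiffAt ℝ ∞ (scalarCurv g (leviCivita g)) x :=
  ContDiffAt.sum fun ν _ => ContDiffAt.sum fun σ _ =>
    (contDiffAt_ginv hU hg hx ν σ).mul (contDiffAt_ricci_leviCivita hU hg hx ν σ)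

theorem contDiffAt_gravEL (B₁ B₂ : ℝ) {π : Pt → Fin 4 → ℝ} (hπ : ContDiffAt ℝ ∞ π x)
    (α β : Fin 4) : ContDiffAt ℝ ∞ (fun y => gravEL B₁ B₂ g π y α β) x := by
  have h1 := contDiffAt_ginv hU hg hx
  have h2 := contDiffAt_raise hU hg hx hπ
  have h3 := contDiffAt_normSq hU hg hx hπ
  have h4 : ∀ μ ν, ContDiffAt ℝ ∞ (fun y => einstein g y μ ν) x := fun μ ν =>
    (contDiffAt_ricci_leviCivita hU hg hx μ ν).sub
      ((contDiffAt_const.mul (hg.entry hU hx μ ν)).mul (contDiffAt_scalarCurv hU hg hx))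
  have h5 : ContDiffAt ℝ ∞ (fun y => einsteinUp g y α β) x :=
    ContDiffAt.sum fun μ _ => ContDiffAt.sum fun ν _ => ((h1 _ _).mul (h1 _ _)).mul (h4 _ _)
  simp only [gravEL]
  fun_prop

/-- The scalar equation says that the current `(b₁ + b₂ (∂φ)²) ∂^μ φ` is conserved. -/
theorem divVec_current (c B₁ B₂ : ℝ) {w : Pt → Fin 4 → ℝ} (hw : ContDiffAt ℝ ∞ w x) :
    divVec (leviCivita g) (fun y μ => (c * (B₁ + B₂ * normSq g w y)) * raise g w y μ) x
      = c * (B₁ * divVec (leviCivita g) (raise g w) x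
        + B₂ * (normSq g w x * divVec (leviCivita g) (raise g w) x
          + 2 * ∑ μ, ∑ ν, w x μ * raise g w x ν * covVec (leviCivita g) (raise g w) x ν μ)) := by
  have hwd : ∀ μ, DifferentiableAt ℝ (fun y => w y μ) x := fun μ =>
    (contDiffAt_pi.1 hw μ).differentiableAt (by simp)
  have hud : ∀ μ, DifferentiableAt ℝ (fun y => raise g w y μ) x := fun μ =>
    (contDiffAt_raise hU hg hx hw μ).differentiableAt (by simp)
  have hP : DifferentiableAt ℝ (normSq g w) x :=
    (contDiffAt_normSq hU hg hx hw).differentiableAt (by simp)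
  have hf : ∀ μ, pd μ (fun y => c * (B₁ + B₂ * normSq g w y)) x
      = c * (B₂ * (2 * ∑ ρ, w x ρ * covVec (leviCivita g) (raise g w) x μ ρ)) := by
    intro μ
    rw [pd_const_mul c (by fun_prop), pd_add (by fun_prop) (by fun_prop), pd_const_mul B₂ hP,
      pd_normSq hU hg hx hw, sum_mul_covVec_raise hU hg hx hwd]
    simp [pd]
  rw [divVec_mul _ (by fun_prop) hud]
  have e : ∑ μ, pd μ (fun y => c * (B₁ + B₂ * normSq g w y)) x * raise g w x μ
      = c * (B₂ * (2 * ∑ μ, ∑ ν, w x μ * raise g w x ν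
        * covVec (leviCivita g) (raise g w) x ν μ)) := by
    simp only [hf, Finset.mul_sum, Finset.sum_mul]
    rw [Finset.sum_comm]
    exact Finset.sum_congr rfl fun μ _ => Finset.sum_congr rfl fun ν _ => by ring
  rw [e]
  ring

/-- The Euler–Lagrange tensor of the metric is divergence-free when the one-form is closed and its
current is conserved. -/
theorem divTensor_gravEL (B₁ B₂ : ℝ) {w : Pt → Fin 4 → ℝ} (hw : ContDiffOn ℝ ∞ w U)
    (hclosed : ∀ α ρ, pd α (fun y => w y ρ) x = pd ρ (fun y => w y α) x)
    (hcur : divVec (leviCivita g) (fun y μ => (B₁ + B₂ * normSq g w y) * raise g w y μ) x = 0)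
    (β : Fin 4) : divTensor (leviCivita g) (fun y α β => -gravEL B₁ B₂ g w y α β) x β = 0 := by
  have hwx := ContDiffOn.at_of_isOpen hw hU hx
  have hwd : ∀ μ, DifferentiableAt ℝ (fun y => w y μ) x := fun μ =>
    (contDiffAt_pi.1 hwx μ).differentiableAt (by simp)
  have hud : ∀ μ, DifferentiableAt ℝ (fun y => raise g w y μ) x := fun μ =>
    (contDiffAt_raise hU hg hx hwx μ).differentiableAt (by simp)
  have hP : DifferentiableAt ℝ (normSq g w) x :=
    (contDiffAt_normSq hU hg hx hwx).differentiableAt (by simp)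
  have hR := (contDiffAt_scalarCurv hU hg hx).differentiableAt (by simp)
  let M₁ : Pt → Tensor2 := fun y α ν => ∑ μ, ginv g y α μ * ricci (leviCivita g) y μ ν
  let V : Pt → Fin 4 → ℝ := fun y μ => (B₁ + B₂ * normSq g w y) * raise g w y μ
  let h : Pt → ℝ := fun y => -(1 / 2) * (scalarCurv g (leviCivita g) y + B₁ * normSq g w y
    + B₂ / 2 * (normSq g w y * normSq g w y))
  let M : Pt → Tensor2 := fun y α ν =>
    (M₁ y α ν + V y α * w y ν) + (if α = ν then h y else 0)
  have hM₁ : ∀ μ ν, DifferentiableAt ℝ (fun y => M₁ y μ ν) x := fun μ ν =>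
    (ContDiffAt.sum (n := ∞) fun l _ => (contDiffAt_ginv hU hg hx μ l).mul
      (contDiffAt_ricci_leviCivita hU hg hx l ν)).differentiableAt (by simp)
  have hV : ∀ μ, DifferentiableAt ℝ (fun y => V y μ) x := fun μ => by fun_prop
  have hh : DifferentiableAt ℝ h x := by fun_prop
  have hM₃ : ∀ μ ν : Fin 4, DifferentiableAt ℝ (fun y => if μ = ν then h y else 0) x := by
    intro μ ν
    split_ifs
    · exact hh
    · exact differentiableAt_const _
  have hM₂ : ∀ μ ν : Fin 4, DifferentiableAt ℝ (fun y => V y μ * w y ν) x := fun μ ν =>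
    (hV μ).fun_mul (hwd ν)
  have hM : ∀ μ ν, DifferentiableAt ℝ (fun y => M y μ ν) x := fun μ ν =>
    ((hM₁ μ ν).fun_add (hM₂ μ ν)).fun_add (hM₃ μ ν)
  have heq : ∀ y ∈ U, ∀ α β, -gravEL B₁ B₂ g w y α β = ∑ ν, M y α ν * ginv g y ν β := by
    intro y hy α β
    have hs := hg.symm y hy
    have e1 : ∑ ν, M₁ y α ν * ginv g y ν β
        = ∑ μ, ∑ ν, ginv g y α μ * ginv g y β ν * ricci (leviCivita g) y μ ν := by
      simp only [M₁, Finset.sum_mul]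
      rw [Finset.sum_comm]
      refine Finset.sum_congr rfl fun μ _ => Finset.sum_congr rfl fun ν _ => ?_
      rw [ginv_symm hs ν β]
      ring
    have e2 : ∑ ν, V y α * w y ν * ginv g y ν β = V y α * raise g w y β := by
      simp only [raise, Finset.mul_sum]
      refine Finset.sum_congr rfl fun ν _ => ?_
      rw [ginv_symm hs ν β]
      ring
    simp only [M, add_mul, Finset.sum_add_distrib, e1, e2]
    simp only [ite_mul, zero_mul, Finset.sum_ite_eq, Finset.mem_univ, if_true]
    rw [gravEL, einsteinUp_eq hs (hg.det_neg y hy).ne]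
    simp only [V, h]
    ring
  have hdiv : divTensor (leviCivita g) (fun y α β => -gravEL B₁ B₂ g w y α β) x β
      = divTensor (leviCivita g) (fun y α β => ∑ ν, M y α ν * ginv g y ν β) x β := by
    simp only [divTensor]
    refine Finset.sum_congr rfl fun α _ => ?_
    rw [pd_congr_on hU (fun y hy => heq y hy α β) hx]
    simp only [heq x hx]
  rw [hdiv, divTensor_mixed hU hg hx hM]
  refine Finset.sum_eq_zero fun ν _ => ?_
  have hsy := leviCivita_symm hU hg hx
  have hcov : ∀ α, covForm (leviCivita g) w x α ν = covForm (leviCivita g) w x ν α := fun α => by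
    simp only [covForm, hclosed α ν, hsy _ ν α]
  have hpdh : pd ν h x = -(1 / 2) * (pd ν (scalarCurv g (leviCivita g)) x
      + (B₁ + B₂ * normSq g w x) * pd ν (normSq g w) x) := by
    simp only [h]
    rw [pd_const_mul _ (by fun_prop), pd_add (by fun_prop) (by fun_prop),
      pd_add hR (by fun_prop), pd_const_mul _ hP, pd_const_mul _ (by fun_prop), pd_mul hP hP]
    ring
  have e : divMixed (leviCivita g) M x ν = 0 := by
    rw [divMixed_add _ (fun μ ν => (hM₁ μ ν).fun_add (hM₂ μ ν)) hM₃, divMixed_add _ hM₁ hM₂,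
      divMixed_ricci hU hg hx, divMixed_vec_form _ hV hwd, divMixed_scalar hsy, hcur, hpdh,
      pd_normSq hU hg hx hwx]
    simp only [hcov, V, mul_assoc, ← Finset.mul_sum]
    ring
  rw [e, zero_mul]

end

/-! ### The Euler–Lagrange equations -/

/-- Contraction of both indices of `A` with `G`. -/
def sandwich (G A : Tensor2) : Tensor2 := fun μ ν => ∑ α, ∑ β, G μ α * G ν β * A α β

theorem sandwich_eq (G A : Tensor2) : Matrix.of (sandwich G A)
    = Matrix.of G * Matrix.of A * (Matrix.of G).transpose := by
  ext μ ν
  simp only [sandwich, Matrix.of_apply, Matrix.mul_apply, Matrix.transpose_apply, Finset.sum_mul]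
  rw [Finset.sum_comm]
  exact Finset.sum_congr rfl fun α _ => Finset.sum_congr rfl fun β _ => by ring

theorem sandwich_sandwich {G H : Tensor2} (h : Matrix.of G * Matrix.of H = 1) (A : Tensor2) :
    sandwich G (sandwich H A) = A := by
  apply Matrix.of.injective
  rw [sandwich_eq, sandwich_eq]
  calc Matrix.of G * (Matrix.of H * Matrix.of A * (Matrix.of H).transpose) * (Matrix.of G).transpose
      = (Matrix.of G * Matrix.of H) * Matrix.of A * (Matrix.of G * Matrix.of H).transpose := by
        rw [Matrix.transpose_mul]; simp only [mul_assoc]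
    _ = Matrix.of A := by rw [h]; simp

section

variable {U : Set Pt} {g : Pt → Tensor2}

/-- The metric equation with both indices raised. -/
theorem metricEq_iff (hg : IsLorentzMetricOn U g) (B₁ B₂ κ : ℝ) (φ : Pt → ℝ) {E : Type*}
    [NormedAddCommGroup E] [NormedSpace ℝ E] (L : Jet E → ℝ) (ψ : Pt → E) :
    MetricEq U B₁ B₂ κ g φ (stressDown L g ψ) ↔
      ∀ x ∈ U, ∀ α β, gravEL B₁ B₂ g (grad φ) x α β + κ * stressUp L g ψ x α β = 0 := by
  refine forall₂_congr fun x hx => ?_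
  have hd := (hg.det_neg x hx).ne
  have hs := hg.symm x hx
  have hgH : Matrix.of (g x) * Matrix.of (ginv g x) = 1 :=
    Matrix.mul_nonsing_inv _ (isUnit_iff_ne_zero.2 hd)
  have hHg : Matrix.of (ginv g x) * Matrix.of (g x) = 1 :=
    Matrix.nonsing_inv_mul _ (isUnit_iff_ne_zero.2 hd)
  set D : Tensor2 := fun μ ν => einstein g x μ ν
    + grad φ x μ * grad φ x ν * (B₁ + B₂ * normSq g (grad φ) x)
    - (1 / 2) * g x μ ν * normSq g (grad φ) x * (B₁ + B₂ / 2 * normSq g (grad φ) x) with hD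
  have hup : ∀ α β, gravEL B₁ B₂ g (grad φ) x α β = -sandwich (ginv g x) D α β := by
    intro α β
    have e : ∀ μ ν, ginv g x α μ * ginv g x β ν * D μ ν
        = ginv g x α μ * ginv g x β ν * einstein g x μ ν
          + (B₁ + B₂ * normSq g (grad φ) x) * (ginv g x α μ * grad φ x μ)
            * (ginv g x β ν * grad φ x ν)
          - (1 / 2) * normSq g (grad φ) x * (B₁ + B₂ / 2 * normSq g (grad φ) x)
            * ginv g x α μ * (ginv g x β ν * g x ν μ) := by
      intro μ ν; rw [hD, hs ν μ]; ring
    simp only [sandwich, e, Finset.sum_add_distrib, Finset.sum_sub_distrib, ← Finset.mul_sum,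
      ← Finset.sum_mul, ginv_mul_g hd]
    rw [gravEL, einsteinUp]
    simp only [raise, mul_ite, mul_one, mul_zero, Finset.sum_ite_eq, Finset.mem_univ, if_true]
    ring
  have hdown : stressDown L g ψ x = sandwich (g x) (stressUp L g ψ x) := rfl
  have h1 : (∀ μ ν, D μ ν = κ * stressDown L g ψ x μ ν) ↔
      D = κ • sandwich (g x) (stressUp L g ψ x) := by
    rw [hdown]
    exact ⟨fun h => funext fun μ => funext fun ν => h μ ν, fun h μ ν => by rw [h]; rfl⟩
  have h2 : (∀ α β, gravEL B₁ B₂ g (grad φ) x α β + κ * stressUp L g ψ x α β = 0) ↔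
      sandwich (ginv g x) D = κ • stressUp L g ψ x := by
    simp only [hup]
    refine ⟨fun h => funext fun μ => funext fun ν => ?_, fun h μ ν => ?_⟩
    · have := h μ ν
      simp only [Pi.smul_apply, smul_eq_mul]
      linarith
    · rw [h]
      simp
  have hlin : ∀ (G A : Tensor2) (c : ℝ), sandwich G (c • A) = c • sandwich G A := by
    intro G A c
    funext μ ν
    simp only [sandwich, Pi.smul_apply, smul_eq_mul, Finset.mul_sum]
    exact Finset.sum_congr rfl fun α _ => Finset.sum_congr rfl fun β _ => by ring
  refine h1.trans (Iff.trans ⟨fun h => ?_, fun h => ?_⟩ h2.symm)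
  · rw [h, hlin, sandwich_sandwich hHg]
  · rw [← hlin, ← h, sandwich_sandwich hgH]

/-- The coefficient of `½ √(-g) δg_{αβ}` in the first variation of the total action. -/
def metricEL {E : Type*} [NormedAddCommGroup E] [NormedSpace ℝ E] (B₁ B₂ κ : ℝ) (L : Jet E → ℝ)
    (g : Pt → Tensor2) (π : Pt → Fin 4 → ℝ) (φ : Pt → ℝ) (lam : Pt → Fin 4 → ℝ) (ψ : Pt → E)
    (x : Pt) (α β : Fin 4) : ℝ :=
  κ⁻¹ * gravEL B₁ B₂ g π x α β + stressUp L g ψ x α β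
    + ginv g x α β * ∑ μ, lam x μ * (π x μ - pd μ φ x)

/-- The coefficient of `√(-g) δπ_α` in the first variation of the total action. -/
def formEL (B₁ B₂ κ : ℝ) (g : Pt → Tensor2) (π lam : Pt → Fin 4 → ℝ) (x : Pt) (α : Fin 4) : ℝ :=
  κ⁻¹ * (B₁ + B₂ * normSq g π x) * raise g π x α + lam x α

variable {E : Type*} [NormedAddCommGroup E] [NormedSpace ℝ E] {L : Jet E → ℝ} {ψ : Pt → E}
  {π lam : Pt → Fin 4 → ℝ} {φ : Pt → ℝ}
  (hU : IsOpen U) (hL : IsMatterLagrangianOn U L) (hψ : ContDiffOn ℝ ∞ ψ U)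
  (hg : IsLorentzMetricOn U g) (hφ : ContDiffOn ℝ ∞ φ U) (hπ : ContDiffOn ℝ ∞ π U)
  (hlam : ContDiffOn ℝ ∞ lam U)
include hU hL hψ hg hφ hπ hlam

/-- The first variation of the total action. -/
theorem hasDerivAt_totalAction (c₁ c₂ c₃ ξ κ : ℝ) {K : Set Pt} (hK : IsCompact K) (hKU : K ⊆ U)
    {δg : Pt → Tensor2} {δπ δlam : Pt → Fin 4 → ℝ} {δφ : Pt → ℝ} (hδg : IsVariation K δg)
    (hδs : ∀ x μ ν, δg x μ ν = δg x ν μ) (hδπ : IsVariation K δπ) (hδφ : IsVariation K δφ)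
    (hδlam : IsVariation K δlam) :
    HasDerivAt (fun ε : ℝ => totalAction c₁ c₂ c₃ ξ κ L K (fun x => g x + ε • δg x)
      (fun x => π x + ε • δπ x) (fun x => φ x + ε * δφ x) (fun x => lam x + ε • δlam x) ψ)
      (∫ x in K, sqrtNegDet g x * ((1 / 2) * (∑ α, ∑ β,
          metricEL (b₁ c₁ c₂ ξ) (b₂ c₂ c₃ ξ) κ L g π φ lam ψ x α β * δg x α β)
        + ∑ α, formEL (b₁ c₁ c₂ ξ) (b₂ c₂ c₃ ξ) κ g π lam x α * δπ x α
        + divVec (leviCivita g) lam x * δφ x + ∑ μ, (π x μ - pd μ φ x) * δlam x μ)) 0 := by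
  obtain ⟨ha, hA⟩ := hasDerivAt_gravAction hU hg hπ c₁ c₂ c₃ ξ κ hK hKU hδg hδs hδπ
  obtain ⟨hb, hB⟩ := hasDerivAt_multiplierAction hU hg hπ hlam hφ hK hKU hδg hδs hδπ hδφ hδlam
  obtain ⟨hc, hC⟩ := hasDerivAt_matterAction hL hU hψ hg hK hKU hδg hδs
  have key := (hA.fun_add hB).fun_add hC
  refine key.congr_deriv ?_
  have ha' := ha.const_mul (1 / (2 * κ))
  rw [← integral_const_mul, ← integral_add (ha'.integrableOn_compact hK)
    (hb.integrableOn_compact hK), ← integral_add ((ha'.fun_add hb).integrableOn_compact hK)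
    (hc.integrableOn_compact hK)]
  refine setIntegral_congr_fun hK.measurableSet fun x hx => ?_
  have e1 : ∑ α, ∑ β, metricEL (b₁ c₁ c₂ ξ) (b₂ c₂ c₃ ξ) κ L g π φ lam ψ x α β * δg x α β
      = κ⁻¹ * (∑ α, ∑ β, gravEL (b₁ c₁ c₂ ξ) (b₂ c₂ c₃ ξ) g π x α β * δg x α β)
        + ∑ α, ∑ β, stressUp L g ψ x α β * δg x α β
        + (∑ μ, ∑ ν, ginv g x ν μ * δg x μ ν) * ∑ μ, lam x μ * (π x μ - pd μ φ x) := by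
    have e : ∀ α β, metricEL (b₁ c₁ c₂ ξ) (b₂ c₂ c₃ ξ) κ L g π φ lam ψ x α β * δg x α β
        = κ⁻¹ * (gravEL (b₁ c₁ c₂ ξ) (b₂ c₂ c₃ ξ) g π x α β * δg x α β)
          + stressUp L g ψ x α β * δg x α β
          + (ginv g x β α * δg x α β) * ∑ μ, lam x μ * (π x μ - pd μ φ x) := by
      intro α β
      rw [metricEL, ginv_symm (hg.symm x (hKU hx)) α β]; ring
    simp only [e, Finset.sum_add_distrib, ← Finset.mul_sum, ← Finset.sum_mul]
  have e2 : ∑ α, formEL (b₁ c₁ c₂ ξ) (b₂ c₂ c₃ ξ) κ g π lam x α * δπ x α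
      = κ⁻¹ * (b₁ c₁ c₂ ξ + b₂ c₂ c₃ ξ * normSq g π x) * (∑ α, raise g π x α * δπ x α)
        + ∑ α, lam x α * δπ x α := by
    simp only [formEL, add_mul _ _ (δπ x _), Finset.sum_add_distrib, Finset.mul_sum, mul_assoc]
  have e3 : ∑ μ, (π x μ - pd μ φ x) * δlam x μ = ∑ μ, δlam x μ * (π x μ - pd μ φ x) :=
    Finset.sum_congr rfl fun μ _ => mul_comm _ _
  simp only [e1, e2, e3, Finset.sum_add_distrib, one_div, mul_inv]
  ring

/-- Stationarity is equivalent to the vanishing of all four Euler–Lagrange expressions. -/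
theorem isStationaryOn_iff (c₁ c₂ c₃ ξ κ : ℝ) :
    IsStationaryOn U c₁ c₂ c₃ ξ κ L g π φ lam ψ ↔
      (∀ x ∈ U, ∀ α β, metricEL (b₁ c₁ c₂ ξ) (b₂ c₂ c₃ ξ) κ L g π φ lam ψ x α β = 0) ∧
      (∀ x ∈ U, ∀ α, formEL (b₁ c₁ c₂ ξ) (b₂ c₂ c₃ ξ) κ g π lam x α = 0) ∧
      (∀ x ∈ U, divVec (leviCivita g) lam x = 0) ∧ (∀ x ∈ U, ∀ μ, π x μ = pd μ φ x) := by
  constructor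
  · intro hst
    have hsmπ := fun {x} (hx : x ∈ U) => ContDiffOn.at_of_isOpen hπ hU hx
    have hsmlam := fun {x} (hx : x ∈ U) => contDiffAt_pi.1 (ContDiffOn.at_of_isOpen hlam hU hx)
    have hsmφ := fun {x} (hx : x ∈ U) μ => contDiffAt_pd (ContDiffOn.at_of_isOpen hφ hU hx) μ
    have hsq := fun {x} (hx : x ∈ U) => contDiffAt_sqrtNegDet hU hg hx
    have hdiff : ∀ {x}, x ∈ U → ∀ μ, ContDiffAt ℝ ∞ (fun y => π y μ - pd μ φ y) x :=
      fun hx μ => (contDiffAt_pi.1 (hsmπ hx) μ).sub (hsmφ hx μ)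
    have hz : ∀ {F : Type} [NormedAddCommGroup F] [NormedSpace ℝ F] (K : Set Pt),
        IsVariation K (fun _ : Pt => (0 : F)) := fun K => ⟨contDiff_const, by simp [tsupport]⟩
    have hv : ∀ {F : Type} [NormedAddCommGroup F] [NormedSpace ℝ F] {η : Pt → ℝ} (A : F),
        ContDiff ℝ ∞ η → IsVariation (tsupport η) (fun x => η x • A) := fun A hη =>
      ⟨hη.smul contDiff_const, tsupport_smul_subset_left _ _⟩
    -- testing with one bump function at a time
    have hfl : ∀ f : Pt → ℝ, (∀ x ∈ U, ContDiffAt ℝ ∞ f x) →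
        (∀ η : Pt → ℝ, ContDiff ℝ ∞ η → HasCompactSupport η → tsupport η ⊆ U →
          ∫ x in tsupport η, sqrtNegDet g x * (f x * η x) = 0) → ∀ x ∈ U, f x = 0 := by
      intro f hf h x hx
      have h1 := eq_zero_of_forall_setIntegral_mul hU (f := fun x => sqrtNegDet g x * f x)
        (fun y hy => ((hsq hy).mul (hf y hy)).continuousAt.continuousWithinAt)
        (fun η h1 h2 h3 => by simpa only [mul_assoc] using h η h1 h2 h3) x hx
      exact (mul_eq_zero.1 h1).resolve_left (sqrtNegDet_pos (hg.det_neg x hx)).ne'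
    refine ⟨fun x hx α β => ?_, fun x hx α => ?_, ?_, fun x hx μ => ?_⟩
    · refine (mul_eq_zero.1 (hfl (fun x => (1 / 2) * metricEL (b₁ c₁ c₂ ξ) (b₂ c₂ c₃ ξ) κ L g π φ
        lam ψ x α β) (fun x hx => ?_) (fun η h1 h2 h3 => ?_) x hx)).resolve_left (by norm_num)
      · exact contDiffAt_const.mul <| ((contDiffAt_const.mul
          (contDiffAt_gravEL hU hg hx _ _ (hsmπ hx) α β)).add
          (contDiffAt_stressUp hL hU hψ hg hx α β)).add ((contDiffAt_ginv hU hg hx α β).mul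
            (ContDiffAt.sum fun μ _ => (hsmlam hx μ).mul (hdiff hx μ)))
      · have hsy : ∀ (x : Pt) (μ ν : Fin 4), (η x • symUnit α β) μ ν = (η x • symUnit α β) ν μ := by
          intro x μ ν
          simp only [Pi.smul_apply, symUnit]
          congr 2
          rw [add_comm]
          simp only [and_comm]
        have hd := hasDerivAt_totalAction hU hL hψ hg hφ hπ hlam c₁ c₂ c₃ ξ κ h2 h3
          (hv (symUnit α β) h1) hsy (hz (F := Fin 4 → ℝ) _) (hz _) (hz (F := Fin 4 → ℝ) _)
        have h0 := hd.unique (hst _ h2 h3 _ _ _ _ (hv (symUnit α β) h1) hsy (hz _) (hz _) (hz _))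
        rw [← h0]
        refine setIntegral_congr_fun h2.measurableSet fun x hx => ?_
        have hms : metricEL (b₁ c₁ c₂ ξ) (b₂ c₂ c₃ ξ) κ L g π φ lam ψ x α β
            = metricEL (b₁ c₁ c₂ ξ) (b₂ c₂ c₃ ξ) κ L g π φ lam ψ x β α := by
          simp only [metricEL]
          rw [gravEL_symm hU hg (h3 hx), stressUp_symm, ginv_symm (hg.symm x (h3 hx))]
        have e : ∑ a, ∑ b, metricEL (b₁ c₁ c₂ ξ) (b₂ c₂ c₃ ξ) κ L g π φ lam ψ x a b
            * (η x • symUnit α β) a b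
            = metricEL (b₁ c₁ c₂ ξ) (b₂ c₂ c₃ ξ) κ L g π φ lam ψ x α β * η x := by
          have e' : ∀ a b, metricEL (b₁ c₁ c₂ ξ) (b₂ c₂ c₃ ξ) κ L g π φ lam ψ x a b
              * (η x • symUnit α β) a b
              = (if b = β then if a = α then (1 / 2) * η x
                  * metricEL (b₁ c₁ c₂ ξ) (b₂ c₂ c₃ ξ) κ L g π φ lam ψ x a b else 0 else 0)
                + (if b = α then if a = β then (1 / 2) * η x
                  * metricEL (b₁ c₁ c₂ ξ) (b₂ c₂ c₃ ξ) κ L g π φ lam ψ x a b else 0 else 0) := by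
            intro a b
            simp only [Pi.smul_apply, smul_eq_mul, symUnit]
            split_ifs <;> first | ring1 | (exfalso; tauto)
          simp only [e', Finset.sum_add_distrib, Finset.sum_ite_eq', Finset.mem_univ, if_true]
          rw [← hms]
          ring
        simp only [e]
        simp [mul_assoc]
    · refine hfl (fun x => formEL (b₁ c₁ c₂ ξ) (b₂ c₂ c₃ ξ) κ g π lam x α)
        (fun x hx => ?_) (fun η h1 h2 h3 => ?_) x hx
      · exact ((contDiffAt_const.mul (contDiffAt_const.add (contDiffAt_const.mul
          (contDiffAt_normSq hU hg hx (hsmπ hx))))).mul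
            (contDiffAt_raise hU hg hx (hsmπ hx) α)).add (hsmlam hx α)
      · have hd := hasDerivAt_totalAction hU hL hψ hg hφ hπ hlam c₁ c₂ c₃ ξ κ h2 h3
          (hz (F := Tensor2) _) (fun _ _ _ => rfl) (hv (Pi.single α 1 : Fin 4 → ℝ) h1) (hz _)
          (hz (F := Fin 4 → ℝ) _)
        have h0 := hd.unique (hst _ h2 h3 _ _ _ _ (hz _) (fun _ _ _ => rfl)
          (hv (Pi.single α 1) h1) (hz _) (hz _))
        rw [← h0]
        simp [Pi.single_apply]
    · refine hfl (fun x => divVec (leviCivita g) lam x) (fun x hx => ?_) (fun η h1 h2 h3 => ?_)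
      · exact ContDiffAt.sum fun μ _ => (contDiffAt_pd (hsmlam hx μ) μ).add
          (ContDiffAt.sum fun ν _ => (contDiffAt_leviCivita hU hg hx _ _ _).mul (hsmlam hx ν))
      · have hd := hasDerivAt_totalAction hU hL hψ hg hφ hπ hlam c₁ c₂ c₃ ξ κ h2 h3
          (hz (F := Tensor2) _) (fun _ _ _ => rfl) (hz (F := Fin 4 → ℝ) _) ⟨h1, le_rfl⟩
          (hz (F := Fin 4 → ℝ) _)
        have h0 := hd.unique (hst _ h2 h3 _ _ _ _ (hz _) (fun _ _ _ => rfl)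
          (hz _) ⟨h1, le_rfl⟩ (hz _))
        rw [← h0]
        simp
    · refine sub_eq_zero.1 (hfl (fun x => π x μ - pd μ φ x) (fun x hx => hdiff hx μ)
        (fun η h1 h2 h3 => ?_) x hx)
      have hd := hasDerivAt_totalAction hU hL hψ hg hφ hπ hlam c₁ c₂ c₃ ξ κ h2 h3
          (hz (F := Tensor2) _) (fun _ _ _ => rfl) (hz (F := Fin 4 → ℝ) _) (hz _)
          (hv (Pi.single μ 1 : Fin 4 → ℝ) h1)
      have h0 := hd.unique (hst _ h2 h3 _ _ _ _ (hz _) (fun _ _ _ => rfl)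
          (hz _) (hz _) (hv (Pi.single μ 1) h1))
      rw [← h0]
      simp [Pi.single_apply]
  · rintro ⟨h1, h2, h3, h4⟩ K hK hKU δg δπ δφ δlam hδg hδs hδπ hδφ hδlam
    refine (hasDerivAt_totalAction hU hL hψ hg hφ hπ hlam c₁ c₂ c₃ ξ κ hK hKU hδg hδs hδπ hδφ
      hδlam).congr_deriv (setIntegral_eq_zero_of_forall_eq_zero fun x hx => ?_)
    simp [h1 x (hKU hx), h2 x (hKU hx), h3 x (hKU hx), h4 x (hKU hx)]

end

end VectorialNonmetricity

end

open VectorialNonmetricity in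
theorem mainTheorem2 {E : Type*} [NormedAddCommGroup E] [NormedSpace ℝ E]
    (U : Set Pt) (hU : IsOpen U) (c₁ c₂ c₃ ξ κ : ℝ) (hκ : κ ≠ 0)
    (L : Jet E → ℝ) (hL : IsMatterLagrangianOn U L)
    (ψ : Pt → E) (hψ : ContDiffOn ℝ ∞ ψ U)
    (g : Pt → Tensor2) (hg : IsLorentzMetricOn U g)
    (φ : Pt → ℝ) (hφ : ContDiffOn ℝ ∞ φ U) :
    -- the stress tensor is the response of the matter action to the metric
    (∀ K : Set Pt, IsCompact K → K ⊆ U → ∀ δg : Pt → Tensor2, IsVariation K δg →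
      (∀ x μ ν, δg x μ ν = δg x ν μ) →
      HasDerivAt (fun ε : ℝ => matterAction L K (fun x => g x + ε • δg x) ψ)
        ((1 / 2) * ∫ x in K, sqrtNegDet g x * ∑ μ, ∑ ν, stressUp L g ψ x μ ν * δg x μ ν) 0) ∧
    -- the Euler-Lagrange equations
    (∀ π lam : Pt → Fin 4 → ℝ, ContDiffOn ℝ ∞ π U → ContDiffOn ℝ ∞ lam U →
      (IsStationaryOn U c₁ c₂ c₃ ξ κ L g π φ lam ψ ↔
        (∀ x ∈ U, ∀ μ, π x μ = pd μ φ x) ∧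
        (∀ x ∈ U, ∀ μ, κ * lam x μ
          + (b₁ c₁ c₂ ξ + b₂ c₂ c₃ ξ * normSq g π x) * raise g π x μ = 0) ∧
        (∀ x ∈ U, divVec (leviCivita g) lam x = 0) ∧
        MetricEq U (b₁ c₁ c₂ ξ) (b₂ c₂ c₃ ξ) κ g φ (stressDown L g ψ) ∧
        ScalarEq U (b₁ c₁ c₂ ξ) (b₂ c₂ c₃ ξ) g φ)) ∧
    -- after elimination of the one-form and of the multiplier
    ((∃ π lam : Pt → Fin 4 → ℝ, ContDiffOn ℝ ∞ π U ∧ ContDiffOn ℝ ∞ lam U ∧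
        IsStationaryOn U c₁ c₂ c₃ ξ κ L g π φ lam ψ) ↔
      MetricEq U (b₁ c₁ c₂ ξ) (b₂ c₂ c₃ ξ) κ g φ (stressDown L g ψ) ∧
      ScalarEq U (b₁ c₁ c₂ ξ) (b₂ c₂ c₃ ξ) g φ) ∧
    -- conservation of matter
    (MetricEq U (b₁ c₁ c₂ ξ) (b₂ c₂ c₃ ξ) κ g φ (stressDown L g ψ) →
      ScalarEq U (b₁ c₁ c₂ ξ) (b₂ c₂ c₃ ξ) g φ →
      ∀ x ∈ U, ∀ ν, divTensor (leviCivita g) (stressUp L g ψ) x ν = 0) := by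
  set B₁ := b₁ c₁ c₂ ξ with hB₁
  set B₂ := b₂ c₂ c₃ ξ with hB₂
  have hgrad : ContDiffOn ℝ ∞ (grad φ) U := fun x hx =>
    (contDiffAt_pi.2 fun μ => contDiffAt_pd (ContDiffOn.at_of_isOpen hφ hU hx) μ).contDiffWithinAt
  have hgradx := fun {x} (hx : x ∈ U) => ContDiffOn.at_of_isOpen hgrad hU hx
  -- the divergence of a multiple of the current is the same multiple of the scalar equation
  have hcur : ∀ c : ℝ, c ≠ 0 → (ScalarEq U B₁ B₂ g φ ↔ ∀ x ∈ U, divVec (leviCivita g)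
      (fun y μ => (c * (B₁ + B₂ * normSq g (grad φ) y)) * raise g (grad φ) y μ) x = 0) := by
    intro c hc
    refine forall₂_congr fun x hx => ?_
    rw [divVec_current hU hg hx c B₁ B₂ (hgradx hx), mul_eq_zero, or_iff_right hc]
  have hEL : ∀ π lam : Pt → Fin 4 → ℝ, ContDiffOn ℝ ∞ π U → ContDiffOn ℝ ∞ lam U →
      (IsStationaryOn U c₁ c₂ c₃ ξ κ L g π φ lam ψ ↔
        (∀ x ∈ U, ∀ μ, π x μ = pd μ φ x) ∧
        (∀ x ∈ U, ∀ μ, κ * lam x μ + (B₁ + B₂ * normSq g π x) * raise g π x μ = 0) ∧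
        (∀ x ∈ U, divVec (leviCivita g) lam x = 0) ∧
        MetricEq U B₁ B₂ κ g φ (stressDown L g ψ) ∧ ScalarEq U B₁ B₂ g φ) := by
    intro π lam hπ hlam
    rw [isStationaryOn_iff hU hL hψ hg hφ hπ hlam, metricEq_iff hg]
    have hform : ∀ x μ, formEL B₁ B₂ κ g π lam x μ = 0 ↔
        κ * lam x μ + (B₁ + B₂ * normSq g π x) * raise g π x μ = 0 := by
      intro x μ
      rw [← mul_right_inj' hκ, mul_zero, formEL, mul_add, mul_assoc, mul_inv_cancel_left₀ hκ,
        add_comm]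
    have hmet : (∀ x ∈ U, ∀ μ, π x μ = pd μ φ x) → ∀ x ∈ U, ∀ α β,
        (metricEL B₁ B₂ κ L g π φ lam ψ x α β = 0 ↔
          gravEL B₁ B₂ g (grad φ) x α β + κ * stressUp L g ψ x α β = 0) := by
      intro h x hx α β
      have hπx : π x = grad φ x := funext fun μ => h x hx μ
      have h0 : ∑ μ, lam x μ * (π x μ - pd μ φ x) = 0 :=
        Finset.sum_eq_zero fun μ _ => by rw [h x hx μ, sub_self, mul_zero]
      have h1 : gravEL B₁ B₂ g π x α β = gravEL B₁ B₂ g (grad φ) x α β := by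
        simp only [gravEL, normSq, raise, hπx]
      rw [metricEL, h0, h1, mul_zero, add_zero, ← mul_right_inj' hκ, mul_zero, mul_add,
        mul_inv_cancel_left₀ hκ]
    constructor
    · rintro ⟨h1, h2, h3, h4⟩
      have h2' := fun x hx μ => (hform x μ).1 (h2 x hx μ)
      refine ⟨h4, h2', h3, fun x hx α β => (hmet h4 x hx α β).1 (h1 x hx α β),
        (hcur (-κ⁻¹) (by simpa using hκ)).2 fun x hx => ?_⟩
      rw [← h3 x hx]
      refine divVec_congr_on _ hU (fun y hy μ => ?_) hx
      have hπy : π y = grad φ y := funext fun μ => h4 y hy μ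
      have h5 := h2' y hy μ
      simp only [normSq, raise, hπy] at h5 ⊢
      apply mul_left_cancel₀ hκ
      rw [eq_neg_of_add_eq_zero_left h5]
      field_simp
    · rintro ⟨h1, h2, h3, h4, -⟩
      exact ⟨fun x hx α β => (hmet h1 x hx α β).2 (h4 x hx α β),
        fun x hx μ => (hform x μ).2 (h2 x hx μ), h3, h1⟩
  refine ⟨fun K hK hKU δg hδg hδs => ?_, hEL, ⟨?_, fun ⟨hM, hS⟩ => ?_⟩, fun hM hS x hx ν => ?_⟩
  · rw [← integral_const_mul]
    exact (hasDerivAt_matterAction hL hU hψ hg hK hKU hδg hδs).2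
  · rintro ⟨π, lam, hπ, hlam, hst⟩
    exact ((hEL π lam hπ hlam).1 hst).2.2.2
  · have hlam : ContDiffOn ℝ ∞ (fun y μ => (-κ⁻¹ * (B₁ + B₂ * normSq g (grad φ) y))
        * raise g (grad φ) y μ : Pt → Fin 4 → ℝ) U := fun x hx =>
      (contDiffAt_pi.2 fun μ => (contDiffAt_const.mul (contDiffAt_const.add (contDiffAt_const.mul
        (contDiffAt_normSq hU hg hx (hgradx hx))))).mul
          (contDiffAt_raise hU hg hx (hgradx hx) μ)).contDiffWithinAt
    refine ⟨grad φ, _, hgrad, hlam, (hEL _ _ hgrad hlam).2 ⟨fun _ _ _ => rfl, fun x hx μ => ?_,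
      (hcur (-κ⁻¹) (by simpa using hκ)).1 hS, hM, hS⟩⟩
    field_simp
    ring
  · have hT : ∀ y ∈ U, ∀ α β, stressUp L g ψ y α β
        = κ⁻¹ * -gravEL B₁ B₂ g (grad φ) y α β := fun y hy α β => by
      have := (metricEq_iff hg B₁ B₂ κ φ L ψ).1 hM y hy α β
      have h : -gravEL B₁ B₂ g (grad φ) y α β = κ * stressUp L g ψ y α β := by linarith
      rw [h, inv_mul_cancel_left₀ hκ]
    have hd := divTensor_gravEL hU hg hx B₁ B₂ hgrad
      (fun α ρ => pd_comm (ContDiffOn.at_of_isOpen hφ hU hx) α ρ)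
      (by simpa only [one_mul] using (hcur 1 one_ne_zero).1 hS x hx) ν
    have hsm : ∀ α β, DifferentiableAt ℝ (fun y => -gravEL B₁ B₂ g (grad φ) y α β) x :=
      fun α β => (contDiffAt_gravEL hU hg hx B₁ B₂ (hgradx hx) α β).neg.differentiableAt (by simp)
    have e : divTensor (leviCivita g) (stressUp L g ψ) x ν
        = κ⁻¹ * divTensor (leviCivita g) (fun y α β => -gravEL B₁ B₂ g (grad φ) y α β) x ν := by
      simp only [divTensor, Finset.mul_sum, mul_add]
      refine Finset.sum_congr rfl fun μ _ => ?_
      rw [pd_congr_on hU (fun y hy => hT y hy μ ν) hx, pd_const_mul _ (hsm μ ν)]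
      simp only [hT x hx, mul_left_comm κ⁻¹]
    rw [e, hd, mul_zero]
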